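/- **Theorem.** The class $\#\Sigma_0$ is properly contained in the class FO-uniform $\#\mathrm{AC}^0$, that is, $\#\Sigma_0 \subsetneq \text{FO-uniform } \#\mathrm{AC}^0$. Moreover, the function $w \mapsto |w|^{\lceil |w|/2\rceil}$ belongs to FO-uniform $\#\mathrm{AC}^0$ but not to $\#\Sigma_0$. Here both classes consist of functions $f\colon \{0,1\}^+ \to \mathbb{N}$ on nonempty binary strings, and all structures have a universe $\{0,\dots,n-1\}$ with $n\ge 1$. *The class $\#\Sigma_0$.* A function $f$ is in $\#\Sigma_0$ if there are a finite vocabulary $\sigma$ of relation and constant symbols and a quantifier-free first-order formula $\varphi(F_1,\dots,F_k,x_1,\dots,x_\ell)$ over $\sigma$ and the built-in symbols $\le$, $\mathrm{BIT}$, $\min$ (with their standard interpretation), with free function variables $F_1,\dots,F_k$ (of any arities) and free individual variables $x_1,\dots,x_\ell$, such that for every finite $\sigma$-structure $\mathcal A$ $$f(\mathrm{enc}_\sigma(\mathcal A)) = \bigl|\{(f_1,\dots,f_k,c_1,\dots,c_\ell) : \mathcal A \models \varphi(f_1,\dots,f_k,c_1,\dots,c_\ell)\}\bigr|,$$ and $f(w)=0$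 for every $w$ that is not the encoding of a $\sigma$-structure. Here $\mathrm{enc}_\sigma(\mathcal A)$ is the standard binary encoding: the truth tables of the relations of $\sigma$ (rows in lexicographic order), followed by the constants of $\sigma$ in binary with $\lceil\log_2 n\rceil$ digits each; if $\sigma$ has no relation symbol of positive arity, one unary relation symbol that is always false is encoded in addition. *The class FO-uniform $\#\mathrm{AC}^0$.* A function $f$ is in FO-uniform $\#\mathrm{AC}^0$ if there is an FO-uniform family $(C_n)_{n}$ of Boolean circuits of polynomial size and constant depth, with $\wedge$- and $\vee$-gates of unbounded fan-in and with leaves labelled by constants or by possibly negated input bits, such that for all $w$, $f(w)$ is the number of proof trees of $C_{|w|}$ on input $w$. A proof tree is a subtree of the tree unfolding of the circuit that contains the root, exactly one child of each of its $\vee$-gates and all children of each of its $\wedge$-gates, and all of whose leaves are true. The family is FO-uniform if there is one first-order interpretation that maps, for every nonempty string $w$, the structure $\mathcal A_w = (\{0,\dots,|w|-1\}; \le, \mathrm{BIT}, S)$, where $S(i)$ holds iff the $i$-th bit of $w$ is $1$, to the circuit $C_{|w|}$ on input $w$ as a structure $(E, G_\wedge, G_\vee, B, r)$ (edges, $\wedge$-gates,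 $\vee$-gates, leaves that are true on input $w$, root); which tuple represents which gate depends only on $|w|$. -/

import Mathlib

namespace CountAC

open FirstOrder

/-- Nonempty binary strings (structures have universe `{0, …, n - 1}` with `n ≥ 1`). -/
abbrev Word : Type := {w : List Bool // w ≠ []}

/-! ### Vocabularies, finite structures and their encodings -/

/-- A finite vocabulary of relation and constant symbols. The built-in symbols `≤`, `BIT`, `min`
are not listed: they are added in `countLang`. -/
structure Vocabulary where
  numRel : ℕ
  relArity : Fin numRel → ℕ
  numConst : ℕ

/-- A structure over `σ` with universe `{0, …, n - 1}`. -/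
structure FinStr (σ : Vocabulary) (n : ℕ) where
  rel : (i : Fin σ.numRel) → (Fin (σ.relArity i) → Fin n) → Bool
  const : Fin σ.numConst → Fin n

namespace FinStr

variable {σ : Vocabulary} {n : ℕ}

/-- The truth values of the `i`-th relation, listed in lexicographic order of the argument tuples
(the first coordinate is the most significant digit of the position). -/
def relBits (A : FinStr σ n) (i : Fin σ.numRel) : List Bool :=
  List.ofFn fun p : Fin (n ^ σ.relArity i) => A.rel i fun j => finFunctionFinEquiv.symm p j.rev

/-- The `i`-th constant in binary with `⌈log₂ n⌉` digits, most significant digit first. -/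
def constBits (A : FinStr σ n) (i : Fin σ.numConst) : List Bool :=
  List.ofFn fun j : Fin (Nat.clog 2 n) => (A.const i : ℕ).testBit j.rev

/-- The standard binary encoding of a structure: all relations, then all constants. As usual, a
vocabulary without a (non-built-in) relation symbol of positive arity is treated as if it had one
more, unary, relation symbol that is always false; so the encoding determines the structure. -/
def enc (A : FinStr σ n) : List Bool :=
  (if ∃ i, 0 < σ.relArity i then [] else List.replicate n false) ++
    (List.finRange σ.numRel).flatMap A.relBits ++ (List.finRange σ.numConst).flatMap A.constBits

end FinStr

/-! ### Counting assignments to free function and individual variables -/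

/-- Function symbols: the built-in constant `min`, the constants of `σ`, and the free function
variables `F_i` of arity `b i`. -/
inductive CountFun (σ : Vocabulary) {k : ℕ} (b : Fin k → ℕ) : ℕ → Type
  | min : CountFun σ b 0
  | const (c : Fin σ.numConst) : CountFun σ b 0
  | var (i : Fin k) : CountFun σ b (b i)

/-- Relation symbols: the built-in relations `≤`, `BIT` and the relation symbols of `σ`. -/
inductive CountRel (σ : Vocabulary) : ℕ → Type
  | le : CountRel σ 2
  | bit : CountRel σ 2
  | rel (i : Fin σ.numRel) : CountRel σ (σ.relArity i)

/-- The language of first-order formulas over `σ` with built-in `≤`, `BIT`, `min` and with free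
function variables of arities `b`. -/
def countLang (σ : Vocabulary) {k : ℕ} (b : Fin k → ℕ) : FirstOrder.Language.{0, 0} :=
  ⟨CountFun σ b, CountRel σ⟩

/-- The structure `A` with the built-in symbols, and `F` assigned to the function variables.
`BIT(i, j)` says that bit `i` (bit `0` is the least significant one) of `j` is `1`. -/
@[reducible]
def FinStr.toStructure {σ : Vocabulary} {n : ℕ} [NeZero n] (A : FinStr σ n) {k : ℕ}
    {b : Fin k → ℕ} (F : (i : Fin k) → (Fin (b i) → Fin n) → Fin n) :
    (countLang σ b).Structure (Fin n) where
  funMap {_} s x :=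
    match s, x with
    | CountFun.min, _ => 0
    | CountFun.const c, _ => A.const c
    | CountFun.var i, x => F i x
  RelMap {_} r x :=
    match r, x with
    | CountRel.le, x => x 0 ≤ x 1
    | CountRel.bit, x => (x 1 : ℕ).testBit (x 0 : ℕ) = true
    | CountRel.rel i, x => A.rel i x = true

/-- The number of assignments `(f₁, …, f_k, c₁, …, c_l)` with `A ⊨ φ(f₁, …, f_k, c₁, …, c_l)`. -/
noncomputable def countAssignments {σ : Vocabulary} {k : ℕ} {b : Fin k → ℕ} {l : ℕ}
    (φ : (countLang σ b).Formula (Fin l)) {n : ℕ} [NeZero n] (A : FinStr σ n) : ℕ :=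
  Nat.card {p : ((i : Fin k) → (Fin (b i) → Fin n) → Fin n) × (Fin l → Fin n) //
    @FirstOrder.Language.Formula.Realize (countLang σ b) (Fin n) (A.toStructure p.1) (Fin l) φ p.2}

/-- `f` is the counting function of `φ`: its value at the encoding of a structure `A` is the number
of assignments that satisfy `φ` in `A`, and its value at a string that encodes no structure
is `0`. -/
def IsCountingFunction {σ : Vocabulary} {k : ℕ} {b : Fin k → ℕ} {l : ℕ}
    (φ : (countLang σ b).Formula (Fin l)) (f : Word → ℕ) : Prop :=
  (∀ (n : ℕ) [NeZero n] (A : FinStr σ n) (w : Word), w.1 = A.enc → f w = countAssignments φ A) ∧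
  (∀ w : Word, (∀ (n : ℕ) [NeZero n] (A : FinStr σ n), w.1 ≠ A.enc) → f w = 0)

/-- The class `#Σ₀`: counting functions of quantifier-free formulas. -/
def SharpSigma0 : Set (Word → ℕ) :=
  {f | ∃ (σ : Vocabulary) (k : ℕ) (b : Fin k → ℕ) (l : ℕ) (φ : (countLang σ b).Formula (Fin l)),
    FirstOrder.Language.BoundedFormula.IsQF φ ∧ IsCountingFunction φ f}

/-! ### First-order interpretations -/

/-- A first-order interpretation of `τ`-structures in `L`-structures: `univ` has `dim` free
variables and the formula of an `a`-ary relation symbol has `a * dim` free variables. -/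
structure Interpretation (L τ : FirstOrder.Language.{0, 0}) where
  dim : ℕ
  univ : L.Formula (Fin dim)
  rel : {a : ℕ} → τ.Relations a → L.Formula (Fin a × Fin dim)

/-- The universe of the interpreted structure. -/
def Interpretation.Carrier {L τ : FirstOrder.Language.{0, 0}} (I : Interpretation L τ) (M : Type)
    [L.Structure M] : Type :=
  {t : Fin I.dim → M // I.univ.Realize t}

/-- The interpreted structure. -/
@[reducible]
def Interpretation.apply {L τ : FirstOrder.Language.{0, 0}} [τ.IsRelational] (I : Interpretation L τ)
    (M : Type) [L.Structure M] : τ.Structure (I.Carrier M) where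
  funMap {_} s _ := isEmptyElim s
  RelMap {_} r x := (I.rel r).Realize fun p => (x p.1).1 p.2

/-- Relation symbols for binary strings: `≤`, `S`, and `BIT`. -/
inductive StringRel : ℕ → Type
  | le : StringRel 2
  | S : StringRel 1
  | bit : StringRel 2

/-- The vocabulary of binary strings together with `BIT`. -/
def stringLang : FirstOrder.Language.{0, 0} := ⟨fun _ => Empty, StringRel⟩

/-- The structure of the binary string `x` of length `n`. -/
@[reducible]
def stringStructure {n : ℕ} (x : Fin n → Bool) : stringLang.Structure (Fin n) where
  funMap {_} s _ := Empty.elim s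
  RelMap {_} r y :=
    match r, y with
    | StringRel.le, y => y 0 ≤ y 1
    | StringRel.S, y => x (y 0) = true
    | StringRel.bit, y => (y 1 : ℕ).testBit (y 0 : ℕ) = true

/-! ### Circuits and proof trees -/

/-- Labels of gates of a circuit in negation normal form with `n` inputs; `lit i true` is the
`i`-th input bit and `lit i false` its negation. -/
inductive Label (n : ℕ) : Type
  | and : Label n
  | or : Label n
  | const (v : Bool) : Label n
  | lit (i : Fin n) (positive : Bool) : Label n

/-- The gate is an input gate: a constant, or a possibly negated input bit. -/
def Label.IsInput {n : ℕ} : Label n → Prop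
  | and => False
  | or => False
  | const _ => True
  | lit _ _ => True

/-- The gate is an input gate that is true on the input `x`. -/
def Label.IsTrue {n : ℕ} (x : Fin n → Bool) : Label n → Prop
  | and => False
  | or => False
  | const v => v = true
  | lit i positive => x i = positive

/-- A Boolean circuit with `n` inputs and gates of unbounded fan-in: a finite directed acyclic
graph; `child g h` says that `h` is a child of `g`. -/
structure Circuit (n : ℕ) where
  Gate : Type
  finite : Finite Gate
  label : Gate → Label n
  child : Gate → Gate → Prop
  output : Gate
  acyclic : ∀ g, ¬ Relation.TransGen child g g
  input_no_child : ∀ g h, (label g).IsInput → ¬ child g h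

/-- The number of non-input gates. -/
noncomputable def Circuit.size {n : ℕ} (C : Circuit n) : ℕ :=
  Nat.card {g : C.Gate // ¬ (C.label g).IsInput}

/-- The depth is at most `d`: every path that starts at the output gate has at most `d` edges. -/
def Circuit.DepthLE {n : ℕ} (C : Circuit n) (d : ℕ) : Prop :=
  ∀ l : List C.Gate, List.IsChain C.child (C.output :: l) → l.length ≤ d

/-- The proof trees below a gate `g` of the tree unfolding of `C` on the input `x`: exactly one
child is chosen at an or-gate, all children at an and-gate, and all leaves reached are true. -/
inductive ProofTree {n : ℕ} (C : Circuit n) (x : Fin n → Bool) : C.Gate → Type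
  | leaf (g : C.Gate) (hg : (C.label g).IsTrue x) : ProofTree C x g
  | and (g : C.Gate) (hg : C.label g = Label.and)
      (t : (h : C.Gate) → C.child g h → ProofTree C x h) : ProofTree C x g
  | or (g : C.Gate) (hg : C.label g = Label.or) (h : C.Gate) (hh : C.child g h)
      (t : ProofTree C x h) : ProofTree C x g

/-- The number of proof trees of `C` on the input `x`. -/
noncomputable def Circuit.numProofTrees {n : ℕ} (C : Circuit n) (x : Fin n → Bool) : ℕ :=
  Nat.card (ProofTree C x C.output)

/-- Relation symbols for circuits: edges, and-gates, or-gates, true leaves, and the root. -/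
inductive CircRel : ℕ → Type
  | E : CircRel 2
  | andGate : CircRel 1
  | orGate : CircRel 1
  | B : CircRel 1
  | root : CircRel 1

/-- The vocabulary of circuits. -/
def circLang : FirstOrder.Language.{0, 0} := ⟨fun _ => Empty, CircRel⟩

instance : circLang.IsRelational := fun _ => inferInstanceAs (IsEmpty Empty)

/-- The circuit `C` on the input `x` as a structure over the vocabulary of circuits. -/
@[reducible]
def Circuit.toStructure {n : ℕ} (C : Circuit n) (x : Fin n → Bool) :
    circLang.Structure C.Gate where
  funMap {_} s _ := Empty.elim s
  RelMap {_} r g :=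
    match r, g with
    | CircRel.E, g => C.child (g 0) (g 1)
    | CircRel.andGate, g => C.label (g 0) = Label.and
    | CircRel.orGate, g => C.label (g 0) = Label.or
    | CircRel.B, g => (C.label (g 0)).IsTrue x
    | CircRel.root, g => g 0 = C.output

/-- The interpretation `I` maps the structure of every string `x` of length `n` to the circuit `C`
on the input `x`; the tuple `ν g` that represents a gate `g` does not depend on `x`. -/
def Interpretation.Describes (I : Interpretation stringLang circLang) {n : ℕ} (C : Circuit n) :
    Prop :=
  ∃ ν : C.Gate → Fin I.dim → Fin n, ∀ x : Fin n → Bool,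
    letI := stringStructure x
    letI := C.toStructure x
    letI := I.apply (Fin n)
    ∃ e : C.Gate ≃[circLang] I.Carrier (Fin n), ∀ g, (e g).1 = ν g

/-- A circuit family is first-order uniform if one first-order interpretation maps the structure of
every nonempty string to the circuit for its length, on that string as input. -/
def FOUniform (C : (n : ℕ) → Circuit n) : Prop :=
  ∃ I : Interpretation stringLang circLang, ∀ n, 0 < n → I.Describes (C n)

/-- The class FO-uniform `#AC⁰`: numbers of proof trees of first-order uniform circuit families of
polynomial size and constant depth. -/
def FOUniformSharpAC0 : Set (Word → ℕ) :=
  {f | ∃ C : (n : ℕ) → Circuit n, FOUniform C ∧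
    (∃ p : Polynomial ℕ, ∀ n, (C n).size ≤ p.eval n) ∧
    (∃ d : ℕ, ∀ n, (C n).DepthLE d) ∧
    ∀ w : Word, f w = (C w.1.length).numProofTrees w.1.get}

end CountAC

namespace CountAC
open FirstOrder Language

/-! Inclusion. A quantifier-free formula has finitely many terms and atoms. Every assignment
determines the values `y` of the terms, so the assignments are partitioned by these valuations. A
fixed `y` decides the truth of the formula, and the functions compatible with `y` can be chosen
independently at each argument tuple: where a term queries the tuple the value is forced, elsewhere
it is free. Hence the count is a sum over `y` of a product (`Flat.countAssignments_eq`). A circuit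
of constant depth and polynomial size computes it: an or-gate guesses `y`, the truth values of the
atoms and the size of the structure; and-gates range over the input bits predicted by the guess and
over the argument tuples; an or-gate ranges over the possible values at a tuple. The structure and
`y` determine the guessed truth values, so nothing is counted twice, and a guess that agrees with
the input forces the input to be an encoding, so other strings get the value 0.

Uniformity. The edges must be first-order definable from `≤` and `BIT`. The hard point is the
position of a bit in an encoding: it is a polynomial in elements of the universe, and intermediate
values can leave the universe. `NDef.poly_eq` defines equality of such polynomials by comparing
residues modulo all short numbers, which have O(log log N) bits. The residues come from recursions
whose whole history fits into one element (`NDef.history`), and they suffice because otherwise a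
large central binomial coefficient would divide a nonzero difference of polynomial size
(`eq_of_forall_mod_eq`). Small universes are treated by listing all cases.

Separation. The function N ^ ⌈N / 2⌉ is a product, over the even positions, of sums of N ones. It is
never 0, so if it were in `SharpSigma0`, then every string would be an encoding, and this forces
structures with n elements to have encodings of length n. If some function variable has positive
arity, one satisfying assignment yields at least n ^ (n - c) of them, since the truth of the formula
depends on at most c function values. If there is none, the number of assignments is bounded by a
fixed power of n. Both contradict n ^ ⌈n / 2⌉ for large n. -/

/-! ### Uniformly first-order definable relations -/

/-- `R` is defined by one first-order formula on the structures of all nonempty strings. -/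
def FODef {α : Type} (R : ∀ N : ℕ, (Fin N → Bool) → (α → Fin N) → Prop) : Prop :=
  ∃ φ : stringLang.Formula α, ∀ N, 0 < N → ∀ (x : Fin N → Bool) (v : α → Fin N),
    letI := stringStructure x
    φ.Realize v ↔ R N x v

/-- `R` is a numerical relation that is defined by one first-order formula on the structures of
all nonempty strings. -/
def NDef {α : Type} (R : ℕ → (α → ℕ) → Prop) : Prop :=
  FODef fun N _ (v : α → Fin N) => R N fun i => (v i : ℕ)

section closure

variable {α β : Type}

theorem FODef.congr {R R' : ∀ N : ℕ, (Fin N → Bool) → (α → Fin N) → Prop} (h : FODef R)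
    (H : ∀ N, 0 < N → ∀ x v, R N x v ↔ R' N x v) : FODef R' := by
  obtain ⟨φ, hφ⟩ := h
  exact ⟨φ, fun N hN x v => (hφ N hN x v).trans (H N hN x v)⟩

theorem FODef.trivial : FODef fun N (_ : Fin N → Bool) (_ : α → Fin N) => True :=
  ⟨⊤, fun N _ x v => by simp⟩

theorem FODef.not {R : ∀ N : ℕ, (Fin N → Bool) → (α → Fin N) → Prop} (h : FODef R) :
    FODef fun N x v => ¬ R N x v := by
  obtain ⟨φ, hφ⟩ := h
  refine ⟨∼φ, fun N hN x v => ?_⟩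
  let _ := stringStructure x
  rw [Formula.realize_not]
  exact not_congr (hφ N hN x v)

theorem FODef.and {R R' : ∀ N : ℕ, (Fin N → Bool) → (α → Fin N) → Prop} (h : FODef R)
    (h' : FODef R') : FODef fun N x v => R N x v ∧ R' N x v := by
  obtain ⟨φ, hφ⟩ := h
  obtain ⟨ψ, hψ⟩ := h'
  refine ⟨φ ⊓ ψ, fun N hN x v => ?_⟩
  let _ := stringStructure x
  rw [Formula.realize_inf]
  exact and_congr (hφ N hN x v) (hψ N hN x v)

theorem FODef.or {R R' : ∀ N : ℕ, (Fin N → Bool) → (α → Fin N) → Prop} (h : FODef R)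
    (h' : FODef R') : FODef fun N x v => R N x v ∨ R' N x v :=
  (h.not.and h'.not).not.congr fun _ _ _ _ => by tauto

theorem FODef.forall_finite {ι : Type} [Finite ι]
    {R : ι → ∀ N : ℕ, (Fin N → Bool) → (α → Fin N) → Prop} (h : ∀ i, FODef (R i)) :
    FODef fun N x v => ∀ i, R i N x v := by
  choose φ hφ using h
  refine ⟨BoundedFormula.iInf φ, fun N hN x v => ?_⟩
  let _ := stringStructure x
  rw [Formula.Realize, BoundedFormula.realize_iInf]
  exact forall_congr' fun i => hφ i N hN x v

theorem FODef.exists_finite {ι : Type} [Finite ι]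
    {R : ι → ∀ N : ℕ, (Fin N → Bool) → (α → Fin N) → Prop} (h : ∀ i, FODef (R i)) :
    FODef fun N x v => ∃ i, R i N x v :=
  (FODef.forall_finite fun i => (h i).not).not.congr fun _ _ _ _ => by simp

theorem FODef.relabel {R : ∀ N : ℕ, (Fin N → Bool) → (α → Fin N) → Prop} (h : FODef R)
    (g : α → β) : FODef fun N x (v : β → Fin N) => R N x fun i => v (g i) := by
  obtain ⟨φ, hφ⟩ := h
  refine ⟨φ.relabel g, fun N hN x v => ?_⟩
  let _ := stringStructure x
  rw [Formula.realize_relabel]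
  exact hφ N hN x _

theorem FODef.exists_tuple [Finite β] {R : ∀ N : ℕ, (Fin N → Bool) → (α ⊕ β → Fin N) → Prop}
    (h : FODef R) : FODef fun N x (v : α → Fin N) => ∃ u : β → Fin N, R N x (Sum.elim v u) := by
  obtain ⟨φ, hφ⟩ := h
  refine ⟨φ.iExs β, fun N hN x v => ?_⟩
  let _ := stringStructure x
  rw [Formula.realize_iExs]
  exact exists_congr fun u => hφ N hN x _

/-- The bit of the input at a position. -/
theorem FODef.input (i : α) : FODef fun N x (v : α → Fin N) => x (v i) = true := by
  let r : stringLang.Relations 1 := StringRel.S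
  refine ⟨r.formula₁ (Term.var i), fun N _ x v => ?_⟩
  let _ := stringStructure x
  exact Formula.realize_rel₁

theorem NDef.congr {R R' : ℕ → (α → ℕ) → Prop} (h : NDef R)
    (H : ∀ N, 0 < N → ∀ v, (∀ i, v i < N) → (R N v ↔ R' N v)) : NDef R' :=
  FODef.congr h fun N hN _ v => H N hN _ fun i => (v i).2

theorem NDef.trivial : NDef fun _ (_ : α → ℕ) => True := FODef.trivial

theorem NDef.not {R : ℕ → (α → ℕ) → Prop} (h : NDef R) : NDef fun N v => ¬ R N v :=
  FODef.not h

theorem NDef.falsum : NDef fun _ (_ : α → ℕ) => False :=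
  NDef.trivial.not.congr fun _ _ _ _ => by simp

theorem NDef.prop (p : Prop) : NDef fun _ (_ : α → ℕ) => p := by
  by_cases hp : p
  · exact NDef.trivial.congr fun _ _ _ _ => by simp [hp]
  · exact NDef.falsum.congr fun _ _ _ _ => by simp [hp]

theorem NDef.and {R R' : ℕ → (α → ℕ) → Prop} (h : NDef R) (h' : NDef R') :
    NDef fun N v => R N v ∧ R' N v := FODef.and h h'

theorem NDef.or {R R' : ℕ → (α → ℕ) → Prop} (h : NDef R) (h' : NDef R') :
    NDef fun N v => R N v ∨ R' N v := FODef.or h h'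

theorem NDef.imp {R R' : ℕ → (α → ℕ) → Prop} (h : NDef R) (h' : NDef R') :
    NDef fun N v => R N v → R' N v :=
  (h.not.or h').congr fun _ _ _ _ => by tauto

theorem NDef.iff {R R' : ℕ → (α → ℕ) → Prop} (h : NDef R) (h' : NDef R') :
    NDef fun N v => R N v ↔ R' N v :=
  ((h.imp h').and (h'.imp h)).congr fun _ _ _ _ => by tauto

theorem NDef.forall_finite {ι : Type} [Finite ι] {R : ι → ℕ → (α → ℕ) → Prop}
    (h : ∀ i, NDef (R i)) : NDef fun N v => ∀ i, R i N v :=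
  FODef.forall_finite h

theorem NDef.exists_finite {ι : Type} [Finite ι] {R : ι → ℕ → (α → ℕ) → Prop}
    (h : ∀ i, NDef (R i)) : NDef fun N v => ∃ i, R i N v :=
  FODef.exists_finite h

theorem NDef.relabel {R : ℕ → (α → ℕ) → Prop} (h : NDef R) (g : α → β) :
    NDef fun N (v : β → ℕ) => R N fun i => v (g i) :=
  FODef.relabel h g

/-- The fresh variable is `none`, so each nested quantifier adds one `some` to the older variables;
the bound `a < N` is what quantification over the universe means for numbers. -/
theorem NDef.ex {R : ℕ → (α → ℕ) → ℕ → Prop}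
    (h : NDef fun N (v : Option α → ℕ) => R N (fun i => v (some i)) (v none)) :
    NDef fun N v => ∃ a < N, R N v a := by
  refine FODef.congr (FODef.exists_tuple (β := Unit)
    (FODef.relabel h fun o : Option α => o.elim (Sum.inr ()) Sum.inl)) fun N _ x v => ?_
  constructor
  · rintro ⟨u, hu⟩
    exact ⟨u (), (u ()).2, hu⟩
  · rintro ⟨a, ha, h⟩
    exact ⟨fun _ => ⟨a, ha⟩, h⟩

theorem NDef.all {R : ℕ → (α → ℕ) → ℕ → Prop}
    (h : NDef fun N (v : Option α → ℕ) => R N (fun i => v (some i)) (v none)) :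
    NDef fun N v => ∀ a < N, R N v a :=
  (NDef.ex (R := fun N v a => ¬ R N v a) h.not).not.congr fun _ _ _ _ => by simp

theorem NDef.le (i j : α) : NDef fun _ v => v i ≤ v j := by
  let r : stringLang.Relations 2 := StringRel.le
  refine ⟨r.formula₂ (Term.var i) (Term.var j), fun N _ x v => ?_⟩
  let _ := stringStructure x
  exact Formula.realize_rel₂

theorem NDef.bit (i j : α) : NDef fun _ v => (v j).testBit (v i) = true := by
  let r : stringLang.Relations 2 := StringRel.bit
  refine ⟨r.formula₂ (Term.var i) (Term.var j), fun N _ x v => ?_⟩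
  let _ := stringStructure x
  exact Formula.realize_rel₂

theorem NDef.lt (i j : α) : NDef fun _ v => v i < v j :=
  (NDef.le j i).not.congr fun _ _ _ _ => by simp

theorem NDef.eq (i j : α) : NDef fun _ v => v i = v j :=
  ((NDef.le i j).and (NDef.le j i)).congr fun _ _ _ _ => le_antisymm_iff.symm

/-- The element `c + 1` is the one whose greatest smaller element is `c`. For `c ≥ N` the formula is
false everywhere, as it should be. -/
theorem NDef.const (c : ℕ) : ∀ {α : Type} (i : α), NDef fun _ v => v i = c := by
  induction c with
  | zero =>
    intro α i
    refine (NDef.all (R := fun N v a => v i ≤ a) (.le _ _)).congr fun N hN v hv => ?_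
    exact ⟨fun h => by simpa using h 0 hN, fun h a _ => by omega⟩
  | succ c ih =>
    intro α i
    refine (NDef.ex (R := fun N v a => a = c ∧ a < v i ∧ ∀ b < N, b < v i → b ≤ a)
      ((ih none).and ((NDef.lt none (some i)).and (NDef.all
        (R := fun N v b => b < v (some i) → b ≤ v none)
        ((NDef.lt none (some (some i))).imp (NDef.le _ _)))))).congr fun N hN v hv => ?_
    constructor
    · rintro ⟨a, ha, rfl, h1, h2⟩
      by_contra h
      have := h2 (a + 1) (by have := hv i; omega) (by omega)
      omega
    · intro h
      have := hv i
      exact ⟨c, by omega, rfl, by omega, fun b _ _ => by omega⟩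

/-- `N - 1` is the greatest element. -/
theorem NDef.max (i : α) : NDef fun N v => v i = N - 1 := by
  refine (NDef.all (R := fun N v a => a ≤ v i) (.le _ _)).congr fun N hN v hv => ?_
  exact ⟨fun h => by have := h (N - 1) (by omega); have := hv i; omega, fun h a _ => by omega⟩

/-- The cardinality `N` is not an element of the universe, so it is accessed through the greatest
element `N - 1`. -/
theorem NDef.card_eq (c : ℕ) : NDef fun N (_ : α → ℕ) => N = c := by
  refine (NDef.ex (R := fun N v a => a = N - 1 ∧ a + 1 = c)
    ((NDef.max none).and (?_ : NDef fun N v => v none + 1 = c))).congr fun N hN v hv => ?_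
  · cases c with
    | zero => exact NDef.falsum.congr fun _ _ _ _ => by simp
    | succ c => exact (NDef.const c none).congr fun _ _ _ _ => by simp
  · exact ⟨by rintro ⟨a, ha, rfl, h⟩; omega, fun h => ⟨N - 1, by omega, rfl, by omega⟩⟩

theorem NDef.card_lt (c : ℕ) : NDef fun N (_ : α → ℕ) => N < c :=
  (NDef.exists_finite fun i : Fin c => NDef.card_eq (i : ℕ)).congr fun N _ _ _ =>
    ⟨by rintro ⟨i, rfl⟩; exact i.2, fun h => ⟨⟨N, h⟩, rfl⟩⟩

/-- A relation that is definable for all large universes is definable. -/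
theorem NDef.of_eventually [Finite α] {R R' : ℕ → (α → ℕ) → Prop} (h : NDef R') (N₀ : ℕ)
    (H : ∀ N, N₀ ≤ N → 0 < N → ∀ v, (∀ i, v i < N) → (R' N v ↔ R N v)) : NDef R := by
  -- A universe of fixed size has finitely many tuples, so any relation on it is a finite
  -- disjunction of conjunctions of equations with constants.
  have small : ∀ c : ℕ, NDef fun N v => N = c ∧ R N v := by
    intro c
    refine (NDef.exists_finite (ι := {u : α → Fin c // R c fun i => (u i : ℕ)}) fun u =>
      (NDef.card_eq c).and (NDef.forall_finite fun i => NDef.const (u.1 i : ℕ) i)).congr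
        fun N hN v hv => ?_
    constructor
    · rintro ⟨u, rfl, h⟩
      refine ⟨rfl, ?_⟩
      have : v = fun i => (u.1 i : ℕ) := funext h
      rw [this]
      exact u.2
    · rintro ⟨rfl, h⟩
      exact ⟨⟨fun i => ⟨v i, hv i⟩, h⟩, rfl, fun i => rfl⟩
  refine (((NDef.card_lt N₀).not.and h).or
    (NDef.exists_finite fun c : Fin N₀ => small c)).congr fun N hN v hv => ?_
  constructor
  · rintro (⟨h1, h2⟩ | ⟨c, -, h⟩)
    · exact (H N (by omega) hN v hv).1 h2
    · exact h
  · intro h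
    rcases lt_or_ge N N₀ with h1 | h1
    · exact .inr ⟨⟨N, h1⟩, rfl, h⟩
    · exact .inl ⟨by omega, (H N h1 hN v hv).2 h⟩

end closure

/-! ### Addition and powers of two from `BIT` -/

/-- The carry into bit `i` in the addition of `x` and `y`. -/
theorem two_pow_le_mod_add_mod_iff (x y i : ℕ) : 2 ^ i ≤ x % 2 ^ i + y % 2 ^ i ↔
    ∃ j < i, x.testBit j = true ∧ y.testBit j = true ∧
      ∀ k < i, j < k → (x.testBit k = true ∨ y.testBit k = true) := by
  induction i with
  | zero => simp [Nat.mod_one]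
  | succ i ih =>
    have hx := Nat.mod_pow_succ (x := x) (b := 2) (k := i)
    have hy := Nat.mod_pow_succ (x := y) (b := 2) (k := i)
    have hx1 : x.testBit i = true ↔ x / 2 ^ i % 2 = 1 := by
      rw [Nat.testBit_eq_decide_div_mod_eq]; simp
    have hy1 : y.testBit i = true ↔ y / 2 ^ i % 2 = 1 := by
      rw [Nat.testBit_eq_decide_div_mod_eq]; simp
    have hxl := Nat.mod_lt x (Nat.two_pow_pos i)
    have hyl := Nat.mod_lt y (Nat.two_pow_pos i)
    -- A carry leaves bit `i` if both bits are 1, or if at least one is 1 and a carry enters.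
    have key : 2 ^ (i + 1) ≤ x % 2 ^ (i + 1) + y % 2 ^ (i + 1) ↔
        (x.testBit i = true ∧ y.testBit i = true) ∨
        ((x.testBit i = true ∨ y.testBit i = true) ∧ 2 ^ i ≤ x % 2 ^ i + y % 2 ^ i) := by
      rw [hx, hy, hx1, hy1, pow_succ]
      rcases Nat.mod_two_eq_zero_or_one (x / 2 ^ i) with h | h <;>
      rcases Nat.mod_two_eq_zero_or_one (y / 2 ^ i) with h' | h' <;>
      simp only [h, h'] <;> clear ih hx hy hx1 hy1 h h' <;>
      generalize x % 2 ^ i = a at * <;> generalize y % 2 ^ i = b at * <;>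
      generalize 2 ^ i = c at * <;> simp only [mul_zero, mul_one, add_zero,
        zero_ne_one, and_self, and_true, true_and, or_self, or_true, true_or, false_and, and_false,
        or_false, false_or, iff_true, iff_false, not_le] <;> omega
    rw [key, ih]
    constructor
    · rintro (⟨h1, h2⟩ | ⟨h, j, hj, h1, h2, h3⟩)
      · exact ⟨i, by omega, h1, h2, fun k _ _ => by omega⟩
      · refine ⟨j, by omega, h1, h2, fun k hk hjk => ?_⟩
        rcases Nat.lt_succ_iff_lt_or_eq.1 hk with hk | rfl
        · exact h3 k hk hjk
        · exact h
    · rintro ⟨j, hj, h1, h2, h3⟩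
      rcases Nat.lt_succ_iff_lt_or_eq.1 hj with hj | rfl
      · exact .inr ⟨h3 i (by omega) hj, j, hj, h1, h2, fun k hk => h3 k (by omega)⟩
      · exact .inl ⟨h1, h2⟩

/-- Carry lookahead: a bit of the sum is the exclusive or of the two bits and the carry, written as
nested equivalences. -/
theorem testBit_add_iff (x y i : ℕ) : (x + y).testBit i = true ↔
    ((x.testBit i = true ↔ y.testBit i = true) ↔ ∃ j < i, x.testBit j = true ∧
      y.testBit j = true ∧ ∀ k < i, j < k → (x.testBit k = true ∨ y.testBit k = true)) := by
  rw [← two_pow_le_mod_add_mod_iff]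
  simp only [Nat.testBit_eq_decide_div_mod_eq, decide_eq_true_eq]
  rw [Nat.add_div (Nat.two_pow_pos i)]
  generalize x / 2 ^ i = a
  generalize y / 2 ^ i = b
  split_ifs with h <;> simp only [h, iff_true, iff_false] <;> omega

theorem testBit_eq_false_of_lt {x N i : ℕ} (hx : x < N) (hi : N ≤ i) : x.testBit i = false :=
  Nat.testBit_lt_two_pow (hx.trans_le (hi.trans Nat.lt_two_pow_self.le))

theorem eq_of_forall_lt_testBit {x y N : ℕ} (hx : x < N) (hy : y < N)
    (h : ∀ i < N, x.testBit i = true ↔ y.testBit i = true) : x = y := by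
  refine Nat.eq_of_testBit_eq fun i => ?_
  rcases lt_or_ge i N with hi | hi
  · exact Bool.eq_iff_iff.2 (h i hi)
  · rw [testBit_eq_false_of_lt hx hi, testBit_eq_false_of_lt hy hi]

theorem two_mul_le_two_pow {N : ℕ} (hN : 0 < N) : 2 * N ≤ 2 ^ N := by
  obtain ⟨m, rfl⟩ : ∃ m, N = m + 1 := ⟨N - 1, by omega⟩
  have : m < 2 ^ m := Nat.lt_two_pow_self
  rw [pow_succ]
  omega

section

variable {α : Type}

/-- Comparing the bits at positions below `N` is enough: the sum is less than `2 * N ≤ 2 ^ N` and so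
has no bits beyond. -/
theorem NDef.add (i j k : α) : NDef fun _ v => v i + v j = v k := by
  refine (NDef.all (R := fun N v b => (v k).testBit b = true ↔
    (((v i).testBit b = true ↔ (v j).testBit b = true) ↔ ∃ c < N, c < b ∧
      ((v i).testBit c = true ∧ (v j).testBit c = true ∧
      ∀ d < N, d < b → c < d → ((v i).testBit d = true ∨ (v j).testBit d = true))))
    ((NDef.bit _ _).iff (((NDef.bit _ _).iff (NDef.bit _ _)).iff
      (NDef.ex (R := fun N v c => c < v none ∧ ((v (some i)).testBit c = true ∧
        (v (some j)).testBit c = true ∧ ∀ d < N, d < v none → c < d →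
          ((v (some i)).testBit d = true ∨ (v (some j)).testBit d = true)))
        ((NDef.lt none (some none)).and ((NDef.bit none (some (some i))).and
          ((NDef.bit none (some (some j))).and
          (NDef.all (R := fun N v d => d < v (some none) → v none < d →
            ((v (some (some i))).testBit d = true ∨ (v (some (some j))).testBit d = true))
            ((NDef.lt none (some (some none))).imp ((NDef.lt (some none) none).imp
              ((NDef.bit none (some (some (some i)))).or
                (NDef.bit none (some (some (some j))))))))))))))).congr
    fun N hN v hv => ?_
  have key : ∀ b < N, ((∃ c < N, c < b ∧ ((v i).testBit c = true ∧ (v j).testBit c = true ∧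
      ∀ d < N, d < b → c < d → ((v i).testBit d = true ∨ (v j).testBit d = true))) ↔
      ∃ c < b, (v i).testBit c = true ∧ (v j).testBit c = true ∧
      ∀ d < b, c < d → ((v i).testBit d = true ∨ (v j).testBit d = true)) := by
    intro b hb
    constructor
    · rintro ⟨c, _, h1, h2, h3, h4⟩
      exact ⟨c, h1, h2, h3, fun d hd => h4 d (by omega) hd⟩
    · rintro ⟨c, h1, h2, h3, h4⟩
      exact ⟨c, by omega, h1, h2, h3, fun d _ hd => h4 d hd⟩
  have h2 : (∀ b < N, ((v k).testBit b = true ↔ (v i + v j).testBit b = true)) ↔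
      v i + v j = v k := by
    constructor
    · intro h
      refine Nat.eq_of_testBit_eq fun b => ?_
      rcases lt_or_ge b N with hb | hb
      · exact (Bool.eq_iff_iff.2 (h b hb)).symm
      · rw [testBit_eq_false_of_lt (hv k) hb]
        refine Nat.testBit_lt_two_pow ?_
        calc v i + v j < 2 * N := by have := hv i; have := hv j; omega
          _ ≤ 2 ^ N := two_mul_le_two_pow hN
          _ ≤ 2 ^ b := Nat.pow_le_pow_right (by norm_num) hb
    · intro h b _
      rw [h]
  rw [← h2]
  refine forall₂_congr fun b hb => ?_
  rw [testBit_add_iff, key b hb]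

theorem NDef.two_pow (i j : α) : NDef fun _ v => v i = 2 ^ v j := by
  refine (NDef.all (R := fun N v t => (v i).testBit t = true ↔ t = v j)
    ((NDef.bit none (some i)).iff (.eq _ _))).congr fun N hN v hv => ?_
  constructor
  · intro h
    refine Nat.eq_of_testBit_eq fun t => ?_
    rw [Nat.testBit_two_pow, Bool.eq_iff_iff, decide_eq_true_eq]
    rcases lt_or_ge t N with ht | ht
    · exact (h t ht).trans eq_comm
    · rw [testBit_eq_false_of_lt (hv i) ht]
      have := hv j
      simp
      omega
  · intro h t _
    rw [h, Nat.testBit_two_pow, decide_eq_true_eq]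
    exact eq_comm

theorem testBit_log_two {n : ℕ} (h : n ≠ 0) : n.testBit (Nat.log 2 n) = true := by
  rw [← Nat.log2_eq_log_two]
  exact Nat.testBit_log2 h

theorem NDef.log (i j : α) : NDef fun _ v => v i = Nat.log 2 (v j) := by
  refine (((NDef.const 0 j).and (NDef.const 0 i)).or ((NDef.bit i j).and
    (NDef.all (R := fun N v t => v i < t → ¬ (v j).testBit t = true)
      ((NDef.lt (some i) none).imp (NDef.bit none (some j)).not)))).congr fun N hN v hv => ?_
  by_cases h0 : v j = 0
  · simp [h0]
  have hlog : Nat.log 2 (v j) < N :=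
    (Nat.log_lt_self 2 h0).trans (hv j)
  constructor
  · rintro (⟨h, -⟩ | ⟨h1, h2⟩)
    · exact absurd h h0
    · refine le_antisymm ?_ ?_
      · exact Nat.le_log_of_pow_le (by norm_num) (Nat.ge_two_pow_of_testBit h1)
      · by_contra h
        exact h2 _ hlog (by omega) (testBit_log_two h0)
  · intro h
    refine .inr ⟨h ▸ testBit_log_two h0, fun t _ h1 h2 => ?_⟩
    rw [h] at h1
    have := Nat.le_log_of_pow_le (b := 2) (by norm_num) (Nat.ge_two_pow_of_testBit h2)
    omega

theorem NDef.mul_two_pow (k j i : α) : NDef fun _ v => v k = v j * 2 ^ v i := by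
  -- The first conjunct excludes overflow: without it, bits shifted to positions outside the
  -- universe would be lost silently.
  refine ((NDef.all (R := fun N v s => (v j).testBit s = true → ∃ t < N, s + v i = t)
    ((NDef.bit none (some j)).imp (NDef.ex (R := fun N v t => v none + v (some i) = t)
      (NDef.add (some none) (some (some i)) none)))).and
    (NDef.all (R := fun N v t => (v k).testBit t = true ↔
      ∃ s < N, s + v i = t ∧ (v j).testBit s = true)
      ((NDef.bit none (some k)).iff (NDef.ex (R := fun N v s => s + v (some i) = v none ∧
        (v (some j)).testBit s = true) ((NDef.add none (some (some i)) (some none)).and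
          (NDef.bit none (some (some j)))))))).congr fun N hN v hv => ?_
  have hbit : ∀ t, (v j * 2 ^ v i).testBit t = true ↔ ∃ s, s + v i = t ∧
      (v j).testBit s = true := by
    intro t
    rw [Nat.testBit_mul_two_pow]
    constructor
    · intro h
      simp only [Bool.and_eq_true, decide_eq_true_eq] at h
      exact ⟨t - v i, by omega, h.2⟩
    · rintro ⟨s, rfl, h⟩
      simp [h]
  constructor
  · rintro ⟨h1, h2⟩
    refine Nat.eq_of_testBit_eq fun t => Bool.eq_iff_iff.2 ?_
    rw [hbit]
    constructor
    · intro h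
      have ht : t < N := by
        by_contra ht
        simp [testBit_eq_false_of_lt (hv k) (not_lt.1 ht)] at h
      obtain ⟨s, -, h⟩ := (h2 t ht).1 h
      exact ⟨s, h⟩
    · rintro ⟨s, rfl, h⟩
      have hs : s < N := by
        by_contra hs
        simp [testBit_eq_false_of_lt (hv j) (not_lt.1 hs)] at h
      obtain ⟨t, ht, rfl⟩ := h1 s hs h
      exact (h2 _ ht).2 ⟨s, hs, rfl, h⟩
  · intro h
    constructor
    · intro s _ hs
      refine ⟨s + v i, ?_, rfl⟩
      by_contra hN
      have := (hbit (s + v i)).2 ⟨s, rfl, hs⟩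
      rw [← h, testBit_eq_false_of_lt (hv k) (not_lt.1 hN)] at this
      simp at this
    · intro t ht
      rw [h, hbit]
      constructor
      · rintro ⟨s, h1, h2⟩
        exact ⟨s, by omega, h1, h2⟩
      · rintro ⟨s, -, h⟩
        exact ⟨s, h⟩

theorem NDef.div_two_pow (k j i : α) : NDef fun _ v => v k = v j / 2 ^ v i := by
  refine (NDef.all (R := fun N v t => (v k).testBit t = true ↔
    ∃ s < N, t + v i = s ∧ (v j).testBit s = true)
      ((NDef.bit none (some k)).iff (NDef.ex (R := fun N v s => v none + v (some i) = s ∧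
        (v (some j)).testBit s = true) ((NDef.add (some none) (some (some i)) none).and
          (NDef.bit none (some (some j))))))).congr fun N hN v hv => ?_
  have key : (∀ t < N, ((v k).testBit t = true ↔ (v j / 2 ^ v i).testBit t = true)) ↔
      v k = v j / 2 ^ v i :=
    ⟨eq_of_forall_lt_testBit (hv k) ((Nat.div_le_self _ _).trans_lt (hv j)),
      fun h t _ => by rw [h]⟩
  rw [← key]
  refine forall₂_congr fun t ht => ?_
  rw [Nat.testBit_div_two_pow]
  refine iff_congr Iff.rfl ⟨?_, fun h => ?_⟩
  · rintro ⟨s, hs, rfl, h⟩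
    exact h
  · refine ⟨t + v i, ?_, rfl, h⟩
    by_contra hs
    simp [testBit_eq_false_of_lt (hv j) (not_lt.1 hs)] at h

theorem NDef.mod_two_pow (k j i : α) : NDef fun _ v => v k = v j % 2 ^ v i := by
  refine (NDef.all (R := fun N v t => (v k).testBit t = true ↔
    t < v i ∧ (v j).testBit t = true) ((NDef.bit none (some k)).iff
      ((NDef.lt none (some i)).and (NDef.bit none (some j))))).congr fun N hN v hv => ?_
  have key : (∀ t < N, ((v k).testBit t = true ↔ (v j % 2 ^ v i).testBit t = true)) ↔
      v k = v j % 2 ^ v i :=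
    ⟨eq_of_forall_lt_testBit (hv k) ((Nat.mod_le _ _).trans_lt (hv j)),
      fun h t _ => by rw [h]⟩
  rw [← key]
  refine forall₂_congr fun t ht => ?_
  simp [Nat.testBit_mod_two_pow]

end

/-! ### Multiplication from `BIT` -/

/-- The number of bits that every number in `{0, …, N - 1}` may be given arbitrarily. -/
def bitLen (N : ℕ) : ℕ := Nat.log 2 (N - 1)

/-- The exponent of the length of the blocks into which numbers are divided. -/
def blockExp (N : ℕ) : ℕ := Nat.log 2 (Nat.log 2 (bitLen N)) + 3

/-- The length of the blocks into which numbers are divided. -/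
def blockLen (N : ℕ) : ℕ := 2 ^ blockExp N

/-- The `k`-th block of `H`. -/
def block (N k H : ℕ) : ℕ := H / 2 ^ (blockLen N * k) % 2 ^ blockLen N

/-- The universe is so large that the history of a computation with short numbers can be stored. -/
structure Large (N : ℕ) : Prop where
  sq_le : 2 * blockLen N * blockLen N ≤ bitLen N
  lt_pow : 2 * bitLen N * bitLen N < 2 ^ blockLen N
  two_le : 2 ≤ N

theorem Large.two_pow_lt {N : ℕ} (h : Large N) : 2 ^ bitLen N < N := by
  have := Nat.pow_log_le_self 2 (x := N - 1) (by have := h.two_le; omega)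
  have := h.two_le
  unfold bitLen
  omega

theorem le_two_pow_bitLen {N : ℕ} : N ≤ 2 ^ (bitLen N + 1) := by
  have := Nat.lt_pow_succ_log_self (b := 2) (by norm_num) (N - 1)
  unfold bitLen
  omega

theorem eight_le_blockLen (N : ℕ) : 8 ≤ blockLen N := by
  unfold blockLen blockExp
  rw [pow_add]
  have := Nat.two_pow_pos (Nat.log 2 (Nat.log 2 (bitLen N)))
  omega

theorem Large.add_lt {N : ℕ} (h : Large N) : 2 * blockLen N + 3 < bitLen N := by
  have h1 := eight_le_blockLen N
  have h2 := h.sq_le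
  nlinarith

theorem Large.pow_lt {N i : ℕ} (h : Large N) (hi : i ≤ 2 * blockLen N + 3) : 2 ^ i < N :=
  (Nat.pow_lt_pow_right (by norm_num) (hi.trans_lt h.add_lt)).trans h.two_pow_lt

theorem Large.bitLen_lt {N : ℕ} (h : Large N) : bitLen N < N :=
  Nat.lt_two_pow_self.trans h.two_pow_lt

theorem pow_bound {k : ℕ} (hk : 16 ≤ k) : 128 * k * k ≤ 2 ^ k := by
  induction k, hk using Nat.le_induction with
  | base => norm_num
  | succ k hk ih => rw [pow_succ]; nlinarith

/-- Let K = `bitLen N` and k = log₂ K. The block length l is a power of two with 4k < l ≤ 8k. Hence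
2l² ≤ 128k² ≤ 2 ^ k ≤ K by `pow_bound`, and 2K² < 2 ^ (2k + 3) ≤ 2 ^ l. -/
theorem exists_large (c : ℕ) : ∃ N₀, ∀ N, N₀ ≤ N → Large N ∧ c ≤ bitLen N := by
  obtain ⟨d, hd⟩ : ∃ d, d = 2 ^ 16 + c := ⟨_, rfl⟩
  refine ⟨2 ^ d + 1, fun N hN => ?_⟩
  have hK : d ≤ bitLen N := Nat.le_log_of_pow_le (by norm_num) (by omega)
  have hk : 16 ≤ Nat.log 2 (bitLen N) := by
    refine Nat.le_log_of_pow_le (by norm_num) ?_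
    omega
  have hK1 := Nat.pow_log_le_self 2 (x := bitLen N) (by omega)
  have hK2 := Nat.lt_pow_succ_log_self (b := 2) (by norm_num) (bitLen N)
  have hk1 := Nat.pow_log_le_self 2 (x := Nat.log 2 (bitLen N)) (by omega)
  have hk2 := Nat.lt_pow_succ_log_self (b := 2) (by norm_num) (Nat.log 2 (bitLen N))
  have hl : blockLen N = 8 * 2 ^ Nat.log 2 (Nat.log 2 (bitLen N)) := by
    unfold blockLen blockExp
    rw [pow_add]
    omega
  rw [pow_succ] at hk2
  suffices h : 2 * blockLen N * blockLen N ≤ bitLen N ∧ 2 * bitLen N * bitLen N < 2 ^ blockLen N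
      ∧ 2 ≤ N from ⟨⟨h.1, h.2.1, h.2.2⟩, by omega⟩
  generalize bitLen N = K at *
  generalize blockLen N = l at *
  generalize Nat.log 2 K = k at *
  generalize 2 ^ Nat.log 2 k = q at *
  have hp := pow_bound hk
  have hd0 : 2 ≤ d := by omega
  refine ⟨?_, ?_, ?_⟩
  · have : q * q ≤ k * k := Nat.mul_self_le_mul_self hk1
    subst hl
    linarith
  · have hK2' : K * K < 2 ^ (k + 1) * 2 ^ (k + 1) := Nat.mul_self_lt_mul_self hK2
    calc 2 * K * K < 2 * (2 ^ (k + 1)) * (2 ^ (k + 1)) := by linarith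
      _ = 2 ^ (2 * k + 3) := by ring
      _ ≤ 2 ^ l := Nat.pow_le_pow_right (by norm_num) (by omega)
  · have : d < 2 ^ d := Nat.lt_two_pow_self
    omega

/-! ### Definability of blocks of numbers -/

section

variable {α : Type}

/-- Substitution of the value of a definable function. -/
theorem NDef.subst {F : ℕ → (α → ℕ) → ℕ} {R : ℕ → (α → ℕ) → ℕ → Prop}
    (hF : NDef fun N (v : Option α → ℕ) => v none = F N fun i => v (some i))
    (hR : NDef fun N (v : Option α → ℕ) => R N (fun i => v (some i)) (v none))
    (h : ∀ N, 0 < N → ∀ v : α → ℕ, (∀ i, v i < N) → R N v (F N v) → F N v < N) :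
    NDef fun N v => R N v (F N v) :=
  (NDef.ex (R := fun N v a => a = F N v ∧ R N v a) (hF.and hR)).congr fun N hN v hv =>
    ⟨by rintro ⟨a, -, rfl, h⟩; exact h, fun hR => ⟨_, h N hN v hv hR, rfl, hR⟩⟩

theorem NDef.succ (i j : α) : NDef fun _ v => v i + 1 = v j := by
  refine ((NDef.lt i j).and (NDef.all (R := fun N v a => v i < a → v j ≤ a)
    ((NDef.lt (some i) none).imp (NDef.le _ _)))).congr fun N hN v hv => ?_
  constructor
  · rintro ⟨h1, h2⟩
    have := h2 (v i + 1) (by have := hv j; omega) (by omega)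
    omega
  · intro h
    exact ⟨by omega, fun a _ _ => by omega⟩

theorem NDef.eq_bitLen (i : α) : NDef fun N v => v i = bitLen N := by
  refine NDef.subst (F := fun N _ => N - 1) (R := fun N v a => v i = Nat.log 2 a) (.max _)
    (.log _ _) fun N hN _ _ _ => by omega

theorem NDef.eq_blockExp (i : α) : NDef fun N v => v i = blockExp N := by
  refine (NDef.ex (R := fun N v k => k = bitLen N ∧ ∃ a < N, a = Nat.log 2 k ∧ ∃ b < N,
    b = Nat.log 2 a ∧ ∃ c < N, c = 3 ∧ b + c = v i) ((NDef.eq_bitLen _).and (NDef.ex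
    (R := fun N v a => a = Nat.log 2 (v none) ∧ ∃ b < N, b = Nat.log 2 a ∧ ∃ c < N, c = 3 ∧
      b + c = v (some i)) ((NDef.log _ _).and (NDef.ex
    (R := fun N v b => b = Nat.log 2 (v none) ∧ ∃ c < N, c = 3 ∧ b + c = v (some (some i)))
    ((NDef.log _ _).and (NDef.ex
    (R := fun N v c => c = 3 ∧ v none + c = v (some (some (some i))))
    ((NDef.const _ _).and (NDef.add (some none) none (some (some (some (some i))))))))))))).congr
    fun N hN v hv => ?_
  unfold blockExp
  constructor
  · rintro ⟨k, _, rfl, a, _, rfl, b, _, rfl, c, _, rfl, h⟩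
    exact h.symm
  · intro h
    have h1 : bitLen N < N := by
      have := Nat.log_le_self 2 (N - 1)
      unfold bitLen
      omega
    have h2 := Nat.log_le_self 2 (bitLen N)
    have h3 := Nat.log_le_self 2 (Nat.log 2 (bitLen N))
    have := hv i
    exact ⟨_, h1, rfl, _, by omega, rfl, _, by omega, rfl, 3, by omega, rfl, h.symm⟩

theorem NDef.eq_blockLen (i : α) : NDef fun N v => v i = blockLen N :=
  NDef.subst (F := fun N _ => blockExp N) (R := fun N v a => v i = 2 ^ a) (.eq_blockExp _)
    (.two_pow _ _) fun N _ v hv h => by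
      have : blockExp N < 2 ^ blockExp N := Nat.lt_two_pow_self
      have := hv i
      omega

theorem NDef.lt_two_pow_blockLen [Finite α] (i : α) : NDef fun N v => v i < 2 ^ blockLen N := by
  obtain ⟨N₀, h⟩ := exists_large 0
  refine NDef.of_eventually (NDef.ex (R := fun N v a => a = blockLen N ∧
    ∃ b < N, b = 2 ^ a ∧ v i < b) ((NDef.eq_blockLen _).and (NDef.ex (R := fun N v b =>
      b = 2 ^ v none ∧ v (some i) < b) ((NDef.two_pow _ _).and (NDef.lt (some (some i)) none)))))
    N₀ fun N hN _ v hv => ?_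
  have hl : 2 ^ blockLen N < N := (h N hN).1.pow_lt (by omega)
  constructor
  · rintro ⟨a, _, rfl, b, _, rfl, h⟩
    exact h
  · intro h
    exact ⟨_, Nat.lt_two_pow_self.trans hl, rfl, _, hl, rfl, h⟩

/-- The block length is a power of two, so the position `blockLen N * v k` is obtained by a shift
and no multiplication is needed yet. The position must be an element of the universe, hence the
first conjunct. -/
theorem NDef.eq_block [Finite α] (p k H : α) :
    NDef fun N v => blockLen N * v k < N ∧ v p = block N (v k) (v H) := by
  obtain ⟨N₀, h⟩ := exists_large 0
  refine NDef.of_eventually (NDef.ex (R := fun N v e => e = blockExp N ∧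
    ∃ q < N, q = v k * 2 ^ e ∧ ∃ r < N, r = v H / 2 ^ q ∧ ∃ l < N, l = blockLen N ∧
      v p = r % 2 ^ l) ((NDef.eq_blockExp _).and (NDef.ex (R := fun N v q =>
      q = v (some k) * 2 ^ v none ∧ ∃ r < N, r = v (some H) / 2 ^ q ∧ ∃ l < N,
      l = blockLen N ∧ v (some p) = r % 2 ^ l)
      ((NDef.mul_two_pow none (some (some k)) (some none)).and (NDef.ex (R := fun N v r =>
      r = v (some (some H)) / 2 ^ v none ∧ ∃ l < N,
      l = blockLen N ∧ v (some (some p)) = r % 2 ^ l)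
      ((NDef.div_two_pow none (some (some (some H))) (some none)).and
      (NDef.ex (R := fun N v l => l = blockLen N ∧ v (some (some (some p))) =
        v none % 2 ^ l) ((NDef.eq_blockLen _).and
        (NDef.mod_two_pow (some (some (some (some p)))) (some none) none)))))))))
    N₀ fun N hN _ v hv => ?_
  have hl : 2 ^ blockLen N < N := (h N hN).1.pow_lt (by omega)
  have hl' : blockLen N < N := Nat.lt_two_pow_self.trans hl
  have he : blockExp N < blockLen N := Nat.lt_two_pow_self
  have hmul : v k * 2 ^ blockExp N = blockLen N * v k := mul_comm _ _
  constructor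
  · rintro ⟨e, _, rfl, q, hq, rfl, r, _, rfl, l, _, rfl, h⟩
    rw [hmul] at hq h
    exact ⟨hq, h⟩
  · rintro ⟨h1, h2⟩
    rw [← hmul] at h1
    refine ⟨_, by omega, rfl, _, h1, rfl, _, (Nat.div_le_self _ _).trans_lt (hv H), rfl,
      _, hl', rfl, ?_⟩
    rw [h2, hmul]
    rfl

end

/-! ### Storing a computation in the blocks of one number -/

theorem block_lt (N k H : ℕ) : block N k H < 2 ^ blockLen N :=
  Nat.mod_lt _ (Nat.two_pow_pos _)

/-- The numbers `s k` serve as the digits of `H` in base `2 ^ blockLen N`. -/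
theorem exists_blocks (N T : ℕ) : ∀ s : ℕ → ℕ, (∀ k < T, s k < 2 ^ blockLen N) →
    ∃ H < 2 ^ (blockLen N * T), ∀ k < T, block N k H = s k := by
  induction T with
  | zero => exact fun s _ => ⟨0, by simp, by simp⟩
  | succ T ih =>
    intro s hs
    obtain ⟨H, hH, h⟩ := ih (fun k => s (k + 1)) fun k hk => hs (k + 1) (by omega)
    have h0 := hs 0 (by omega)
    have hpos := Nat.two_pow_pos (blockLen N)
    refine ⟨s 0 + 2 ^ blockLen N * H, ?_, fun k hk => ?_⟩
    · rw [mul_add, pow_add, mul_one, mul_comm (2 ^ (blockLen N * T))]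
      calc s 0 + 2 ^ blockLen N * H < 2 ^ blockLen N * (H + 1) := by rw [mul_add]; omega
        _ ≤ _ := Nat.mul_le_mul_left _ hH
    · cases k with
      | zero => simp [block, Nat.mod_eq_of_lt h0]
      | succ k =>
        rw [← h k (by omega), block, block, mul_add, mul_one, add_comm (blockLen N * k), pow_add,
          ← Nat.div_div_eq_div_mul, Nat.add_mul_div_left _ _ hpos, Nat.div_eq_of_lt h0, zero_add]

/-- A sequence of short numbers that is computed by definable steps has a definable last
member: the sequence is stored in the blocks of one number. -/
theorem NDef.history {α : Type} [Finite α] {G : ℕ → (α → ℕ) → Prop}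
    {seq : ℕ → (α → ℕ) → ℕ → ℕ} {T : ℕ → ℕ} {Init : ℕ → (α → ℕ) → ℕ → Prop}
    {Step : ℕ → (α → ℕ) → ℕ → ℕ → ℕ → Prop} (N₀ : ℕ)
    (hT : ∀ {β : Type} [Finite β] (i : β), NDef fun N (v : β → ℕ) => v i = T N) (hG : NDef G)
    (hInit : NDef fun N (v : Option α → ℕ) => Init N (fun i => v (some i)) (v none))
    (hStep : NDef fun N (v : Option (Option (Option α)) → ℕ) =>
      Step N (fun i => v (some (some (some i)))) (v (some (some none))) (v (some none)) (v none))
    (hTN : ∀ N, N₀ ≤ N → blockLen N * T N ≤ bitLen N)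
    (hlt : ∀ N, N₀ ≤ N → ∀ v, (∀ i, v i < N) → G N v → ∀ k ≤ T N, seq N v k < 2 ^ blockLen N)
    (hInit' : ∀ N, N₀ ≤ N → ∀ v, (∀ i, v i < N) → G N v → ∀ a < N,
      (Init N v a ↔ a = seq N v (T N)))
    (hStep' : ∀ N, N₀ ≤ N → ∀ v, (∀ i, v i < N) → G N v → ∀ k < T N, ∀ a < N,
      (Step N v k (seq N v (k + 1)) a ↔ a = seq N v k)) :
    NDef fun N (v : Option α → ℕ) => G N (fun i => v (some i)) ∧
      v none = seq N (fun i => v (some i)) 0 := by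
  obtain ⟨N₁, hN₁⟩ := exists_large 0
  -- `V` says that `b` is the `k`-th member of the stored sequence. The member with index `t` is
  -- kept separately in `c`, so `H` has to hold only `t` blocks and stays below `2 ^ bitLen N < N`.
  -- The recursion runs downwards, from index `T N` to the result at index 0.
  let V : ℕ → ℕ → ℕ → ℕ → ℕ → ℕ → Prop := fun N t c H k b =>
    (k = t ∧ b = c) ∨ (k < t ∧ (blockLen N * k < N ∧ b = block N k H))
  have hV : ∀ {β : Type} [Finite β] (t c H k b : β), NDef fun N (v : β → ℕ) =>
      V N (v t) (v c) (v H) (v k) (v b) := fun t c H k b =>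
    ((NDef.eq k t).and (NDef.eq b c)).or ((NDef.lt k t).and (NDef.eq_block b k H))
  have hform : NDef fun N (v : Option α → ℕ) => G N (fun i => v (some i)) ∧ ∃ t < N, t = T N ∧
      ∃ c < N, Init N (fun i => v (some i)) c ∧ ∃ H < N,
      (∃ z < N, z = 0 ∧ V N t c H z (v none)) ∧ ∀ k < N, k < t → ∀ k' < N, k + 1 = k' → ∀ b < N,
      V N t c H k' b → ∀ a < N, V N t c H k a → Step N (fun i => v (some i)) k b a := by
    refine (hG.relabel some).and (NDef.ex ((hT _).and (NDef.ex (.and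
      (hInit.relabel (β := Option (Option (Option α)))
        fun o => o.elim none fun i => some (some (some i)))
      (NDef.ex (.and (NDef.ex ((NDef.const 0 _).and (hV (some (some (some none)))
        (some (some none)) (some none) none (some (some (some (some none)))))))
      (NDef.all ((NDef.lt none (some (some (some none)))).imp (NDef.all
        ((NDef.succ (some none) none).imp (NDef.all ((hV (some (some (some (some (some none)))))
          (some (some (some (some none)))) (some (some (some none))) (some none) none).imp
        (NDef.all ((hV (some (some (some (some (some (some none)))))) (some (some (some (some (some
          none))))) (some (some (some (some none)))) (some (some (some none))) none).imp
          (hStep.relabel (β := Option (Option (Option (Option (Option (Option (Option (Option α))))))))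
            fun o => o.elim none fun o => o.elim (some none) fun o => o.elim
              (some (some (some none))) fun i =>
                some (some (some (some (some (some (some (some i))))))))))))))))))))))
  refine NDef.of_eventually hform (N₀ + N₁) fun N hN hN0 w hw => ?_
  have hL := (hN₁ N (by omega)).1
  replace hTN := hTN N (by omega)
  replace hlt := hlt N (by omega) (fun i => w (some i)) fun i => hw _
  replace hInit' := hInit' N (by omega) (fun i => w (some i)) fun i => hw _
  replace hStep' := hStep' N (by omega) (fun i => w (some i)) fun i => hw _
  have hK := hL.bitLen_lt
  have h8 := eight_le_blockLen N
  have hTN' : T N ≤ bitLen N := by nlinarith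
  have hlN : 2 ^ blockLen N < N := hL.pow_lt (by omega)
  have hkN : ∀ k ≤ T N, blockLen N * k < N := fun k hk =>
    ((Nat.mul_le_mul_left _ hk).trans hTN).trans_lt hK
  refine and_congr_right fun hGv => ?_
  replace hlt := hlt hGv
  replace hInit' := hInit' hGv
  replace hStep' := hStep' hGv
  generalize seq N (fun i => w (some i)) = s at *
  constructor
  · rintro ⟨t, -, rfl, c, hc, hi, H, -, ⟨z, -, rfl, hz⟩, hstep⟩
    rw [hInit' c hc] at hi
    -- The number `H` is arbitrary here; the step condition forces its blocks to agree with the true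
    -- sequence, by induction downwards from `T N`.
    have key : ∀ d ≤ T N, ∀ b, V N (T N) c H (T N - d) b → b = s (T N - d) := by
      intro d
      induction d with
      | zero =>
        rintro - b (⟨-, rfl⟩ | ⟨h, -⟩)
        · exact hi
        · omega
      | succ d ih =>
        intro hd b hb
        obtain ⟨k, hk⟩ : ∃ k, k = T N - (d + 1) := ⟨_, rfl⟩
        have hk' : T N - d = k + 1 := by omega
        rw [hk'] at ih
        rw [← hk] at hb ⊢
        obtain ⟨b', hb'⟩ : ∃ b', V N (T N) c H (k + 1) b' := by
          rcases Nat.lt_or_ge (k + 1) (T N) with h | h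
          · exact ⟨_, .inr ⟨h, hkN _ h.le, rfl⟩⟩
          · exact ⟨c, .inl ⟨by omega, rfl⟩⟩
        have hbN : b < N := by
          rcases hb with ⟨-, rfl⟩ | ⟨-, -, rfl⟩
          · exact hc
          · exact (block_lt _ _ _).trans hlN
        have hb'' := ih (by omega) b' hb'
        have := hstep k (by omega) (by omega) (k + 1) (by omega) rfl b'
          (hb'' ▸ (hlt _ (by omega)).trans hlN) hb' b hbN hb
        rw [hb''] at this
        exact (hStep' k (by omega) b hbN).1 this
    have := key (T N) le_rfl (w none)
    rw [Nat.sub_self] at this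
    exact this hz
  · intro h0
    -- Conversely the true sequence is short, so it can be stored.
    obtain ⟨H, hH, hblk⟩ := exists_blocks N (T N) s fun k hk => hlt k hk.le
    have hHN : H < N :=
      hH.trans_le ((Nat.pow_le_pow_right (by norm_num) hTN).trans hL.two_pow_lt.le)
    have hVs : ∀ k ≤ T N, ∀ b, V N (T N) (s (T N)) H k b ↔ b = s k := by
      intro k hk b
      constructor
      · rintro (⟨rfl, h⟩ | ⟨h, -, h'⟩)
        · exact h
        · rw [h', hblk k h]
      · rintro rfl
        rcases hk.lt_or_eq with h | rfl
        · exact .inr ⟨h, hkN k hk, (hblk k h).symm⟩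
        · exact .inl ⟨rfl, rfl⟩
    have hsN := (hlt _ le_rfl).trans hlN
    refine ⟨_, by omega, rfl, _, hsN, (hInit' _ hsN).2 rfl, H, hHN,
      ⟨0, hN0, rfl, (hVs 0 (by omega) _).2 h0⟩, ?_⟩
    rintro k - hk k' - rfl b - hb a haN ha
    rw [hVs _ (by omega)] at hb ha
    rw [hb, hStep' k hk a haN]
    exact ha

/-! ### Products and remainders modulo short numbers -/

section

/-- The numbers `y`, `u`, `m` are short, and `u` is a residue modulo `m`. -/
def ShortMul (N y u m : ℕ) : Prop := y / 2 ^ blockLen N < 2 ^ blockLen N ∧ m < 2 ^ blockLen N ∧ u < m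

theorem NDef.shortMul {α : Type} [Finite α] (y u m : α) :
    NDef fun N v => ShortMul N (v y) (v u) (v m) := by
  refine .and ?_ ((NDef.lt_two_pow_blockLen m).and (NDef.lt u m))
  obtain ⟨N₀, h⟩ := exists_large 0
  refine NDef.of_eventually (NDef.ex (R := fun N v a => a = blockLen N ∧ ∃ b < N,
    b = v y / 2 ^ a ∧ b < 2 ^ blockLen N) ((NDef.eq_blockLen _).and (NDef.ex (R := fun N v b =>
      b = v (some y) / 2 ^ v none ∧ b < 2 ^ blockLen N)
      ((NDef.div_two_pow none (some (some y)) (some none)).and (NDef.lt_two_pow_blockLen _)))))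
    N₀ fun N hN _ v hv => ?_
  have hl : blockLen N < N := Nat.lt_two_pow_self.trans ((h N hN).1.pow_lt (by omega))
  constructor
  · rintro ⟨a, -, rfl, b, -, rfl, h⟩
    exact h
  · intro h
    exact ⟨_, hl, rfl, _, (Nat.div_le_self _ _).trans_lt (hv y), rfl, h⟩

theorem eq_mod_iff_of_lt_three_mul {a c m : ℕ} (hc : c < m + m + m) :
    a = c % m ↔ a < m ∧ (c = a ∨ c = a + m ∨ c = a + (m + m)) := by
  have hm : 0 < m := by omega
  constructor
  · rintro rfl
    refine ⟨Nat.mod_lt _ hm, ?_⟩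
    have h := Nat.mod_add_div c m
    have h3 : c / m < 3 := Nat.div_lt_of_lt_mul (by omega)
    generalize c / m = q at *
    interval_cases q <;> omega
  · rintro ⟨h, rfl | rfl | rfl⟩
    · exact (Nat.mod_eq_of_lt h).symm
    · rw [Nat.add_mod_right, Nat.mod_eq_of_lt h]
    · rw [← add_assoc, Nat.add_mod_right, Nat.add_mod_right, Nat.mod_eq_of_lt h]

/-- One step of the multiplication of `u` with a number modulo `m`. -/
theorem NDef.doubleAddMod {α : Type} [Finite α] (y u m k b a : α) :
    NDef fun N v => ∃ d < N, v b + v b = d ∧ ∃ c < N,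
      (((v y).testBit (v k) = true ∧ d + v u = c) ∨ (¬ (v y).testBit (v k) = true ∧ d = c)) ∧
      v a < v m ∧ (c = v a ∨ v a + v m = c ∨ ∃ g < N, v m + v m = g ∧ v a + g = c) := by
  refine NDef.ex (R := fun N v d => v b + v b = d ∧ ∃ c < N,
      (((v y).testBit (v k) = true ∧ d + v u = c) ∨ (¬ (v y).testBit (v k) = true ∧ d = c)) ∧
      v a < v m ∧ (c = v a ∨ v a + v m = c ∨ ∃ g < N, v m + v m = g ∧ v a + g = c))
    ((NDef.add (some b) (some b) none).and (NDef.ex (R := fun N v c =>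
      (((v (some y)).testBit (v (some k)) = true ∧ v none + v (some u) = c) ∨
        (¬ (v (some y)).testBit (v (some k)) = true ∧ v none = c)) ∧
      v (some a) < v (some m) ∧ (c = v (some a) ∨ v (some a) + v (some m) = c ∨
        ∃ g < N, v (some m) + v (some m) = g ∧ v (some a) + g = c))
      ((((NDef.bit (some (some k)) (some (some y))).and (NDef.add (some none) (some (some u)) none)).or
        ((NDef.bit (some (some k)) (some (some y))).not.and (NDef.eq (some none) none))).and
        ((NDef.lt (some (some a)) (some (some m))).and ((NDef.eq none (some (some a))).or
        ((NDef.add (some (some a)) (some (some m)) none).or (NDef.ex (R := fun N v g =>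
          v (some (some m)) + v (some (some m)) = g ∧ v (some (some a)) + g = v none)
          ((NDef.add (some (some (some m))) (some (some (some m))) none).and
            (NDef.add (some (some (some a))) none (some none))))))))))

/-- As `b` and `u` are below `m`, the number to be reduced is below `3 * m`, so at most two
subtractions of `m` are needed. All intermediate numbers stay below `2 ^ (blockLen N + 3) < N`. -/
theorem doubleAddMod_iff {N y u m k b a : ℕ} (hN : Large N) (h : ShortMul N y u m) (hb : b < m) :
    (∃ d < N, b + b = d ∧ ∃ c < N,
      ((y.testBit k = true ∧ d + u = c) ∨ (¬ y.testBit k = true ∧ d = c)) ∧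
      a < m ∧ (c = a ∨ a + m = c ∨ ∃ g < N, m + m = g ∧ a + g = c)) ↔
      a = (2 * b + if y.testBit k then u else 0) % m := by
  have hl : 2 ^ (blockLen N + 3) < N := hN.pow_lt (by omega)
  rw [pow_add] at hl
  have h1 := h.2.1
  have h2 := h.2.2
  rw [eq_mod_iff_of_lt_three_mul (by split_ifs <;> omega)]
  constructor
  · rintro ⟨d, hd, rfl, c, hc, hc', ha, h⟩
    refine ⟨ha, ?_⟩
    have : 2 * b + (if y.testBit k then u else 0) = c := by
      rcases hc' with ⟨hy, rfl⟩ | ⟨hy, rfl⟩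
      · rw [if_pos hy, two_mul]
      · rw [if_neg hy, two_mul, add_zero]
    rw [this]
    rcases h with h | h | ⟨g, -, rfl, h⟩
    · exact .inl h
    · exact .inr (.inl h.symm)
    · exact .inr (.inr h.symm)
  · rintro ⟨ha, h⟩
    refine ⟨b + b, by omega, rfl, 2 * b + if y.testBit k then u else 0, by split_ifs <;> omega,
      ?_, ha, ?_⟩
    · split_ifs with hy
      · exact .inl ⟨hy, by omega⟩
      · exact .inr ⟨hy, by omega⟩
    · rcases h with h | h | h
      · exact .inl h
      · exact .inr (.inl h.symm)
      · exact .inr (.inr ⟨m + m, by omega, rfl, h.symm⟩)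

theorem div_two_pow_eq (y k : ℕ) :
    y / 2 ^ k = 2 * (y / 2 ^ (k + 1)) + if y.testBit k then 1 else 0 := by
  rw [pow_succ, ← Nat.div_div_eq_div_mul]
  have : y.testBit k = decide (y / 2 ^ k % 2 = 1) := Nat.testBit_eq_decide_div_mod_eq
  rw [this]
  split_ifs with h <;> simp at h <;> omega

/-- Horner's scheme on the bits of `y`: the sequence is ⌊y / 2 ^ k⌋ * u modulo m. It starts with 0
at k = `2 * blockLen N`, because `y` has at most that many bits, and each step doubles and adds `u`
if bit `k` is 1. The history has `2 * blockLen N` blocks, which fit by `Large.sq_le`. -/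
theorem NDef.mulMod {α : Type} (y u m w : α) :
    NDef fun N v => ShortMul N (v y) (v u) (v m) ∧ v w = v y * v u % v m := by
  obtain ⟨N₀, hN₀⟩ := exists_large 0
  have key := NDef.history (α := Fin 3) (G := fun N v => ShortMul N (v 0) (v 1) (v 2))
    (seq := fun N v k => v 0 / 2 ^ k * v 1 % v 2) (T := fun N => 2 * blockLen N)
    (Init := fun N v a => a = 0) (Step := fun N v k b a => ∃ d < N, b + b = d ∧ ∃ c < N,
      (((v 0).testBit k = true ∧ d + v 1 = c) ∨ (¬ (v 0).testBit k = true ∧ d = c)) ∧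
      a < v 2 ∧ (c = a ∨ a + v 2 = c ∨ ∃ g < N, v 2 + v 2 = g ∧ a + g = c)) N₀
    ?_ (.shortMul _ _ _) (.const _ _)
    (NDef.doubleAddMod (some (some (some 0))) (some (some (some 1))) (some (some (some 2)))
      (some (some none)) (some none) none) ?_ ?_ ?_ ?_
  · refine (key.relabel fun o : Option (Fin 3) => o.elim w ![y, u, m]).congr fun N _ v _ => ?_
    simp
  · intro β _ i
    refine NDef.subst (F := fun N _ => blockLen N) (R := fun N v a => v i = 2 * a)
      (.eq_blockLen _) ((NDef.add none none (some i)).congr fun N _ v _ => ?_) fun N _ v hv h => ?_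
    · change v none + v none = v (some i) ↔ v (some i) = 2 * v none
      omega
    · have := hv i
      omega
  · intro N hN
    have := (hN₀ N hN).1.sq_le
    linarith
  · rintro N - v - hG k -
    exact (Nat.mod_lt _ (by have := hG.2.2; omega)).trans hG.2.1
  · intro N hN v hv hG a ha
    have : v 0 / 2 ^ (2 * blockLen N) = 0 := by
      rw [two_mul, pow_add, ← Nat.div_div_eq_div_mul]
      exact Nat.div_eq_of_lt hG.1
    simp [this]
  · intro N hN v hv hG k hk a ha
    rw [doubleAddMod_iff (hN₀ N hN).1 hG (Nat.mod_lt _ (by have := hG.2.2; omega)),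
      div_two_pow_eq (v 0) k, add_mul, mul_assoc, Nat.add_mod, Nat.mul_mod 2, Nat.mod_mod,
      ← Nat.mul_mod, ← Nat.add_mod]
    split_ifs <;> simp

/-- Long division of an arbitrary element `x`, one block at a time: the sequence is the remainder of
x / 2 ^ (blockLen N * k). A step shifts the remainder by one block, appends the next block of `x`
and reduces a number of at most `2 * blockLen N` bits. -/
theorem NDef.mod {α : Type} (x m r : α) :
    NDef fun N v => (1 < v m ∧ v m < 2 ^ blockLen N) ∧ v r = v x % v m := by
  obtain ⟨N₀, hN₀⟩ := exists_large 0
  have one : ∀ {β : Type} (i : β), NDef fun _ v => 1 < v i := fun i =>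
    ((NDef.const 0 i).or (NDef.const 1 i)).not.congr fun _ _ _ _ => by omega
  -- Multiplication by 1 in `NDef.mulMod` reduces a number with two blocks modulo `m`; the factor 1
  -- has to be a residue, which is why `1 < m` is required.
  let M : ℕ → ℕ → ℕ → ℕ → Prop := fun N y m a =>
    ∃ u < N, u = 1 ∧ (ShortMul N y u m ∧ a = y * u % m)
  have hM : ∀ {β : Type} (y m a : β), NDef fun N v => M N (v y) (v m) (v a) := fun y m a =>
    NDef.ex ((NDef.const 1 _).and (NDef.mulMod (some y) none (some m) (some a)))
  have hM' : ∀ {N y m a : ℕ}, 1 < N → (M N y m a ↔ ShortMul N y 1 m ∧ a = y % m) := by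
    intro N y m a hN
    constructor
    · rintro ⟨u, -, rfl, h, h'⟩
      exact ⟨h, by rw [h', mul_one]⟩
    · rintro ⟨h, h'⟩
      exact ⟨1, hN, rfl, h, by rw [h', mul_one]⟩
  have hT : ∀ {β : Type} [Finite β] (i : β), NDef fun N (v : β → ℕ) =>
      v i = bitLen N / blockLen N := by
    intro β _ i
    refine NDef.of_eventually (NDef.ex (R := fun N v a => a = bitLen N ∧ ∃ e < N, e = blockExp N ∧
      v i = a / 2 ^ e) ((NDef.eq_bitLen _).and (NDef.ex (R := fun N v e => e = blockExp N ∧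
      v (some i) = v none / 2 ^ e) ((NDef.eq_blockExp _).and (.div_two_pow _ _ _))))) N₀
      fun N hN _ v hv => ?_
    have hL := (hN₀ N hN).1
    have he : blockExp N < blockLen N := Nat.lt_two_pow_self
    have := hL.bitLen_lt
    have := hL.add_lt
    constructor
    · rintro ⟨a, -, rfl, e, -, rfl, h⟩
      exact h
    · intro h
      exact ⟨_, hL.bitLen_lt, rfl, _, by omega, rfl, h⟩
  have key := NDef.history (α := Fin 2) (G := fun N v => 1 < v 1 ∧ v 1 < 2 ^ blockLen N)
    (seq := fun N v k => v 0 / 2 ^ (blockLen N * k) % v 1) (T := fun N => bitLen N / blockLen N)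
    (Init := fun N v a => ∃ t < N, t = bitLen N / blockLen N ∧ ∃ y < N,
      (blockLen N * t < N ∧ y = block N t (v 0)) ∧ M N y (v 1) a)
    (Step := fun N v k b a => ∃ l < N, l = blockLen N ∧ ∃ c < N, c = b * 2 ^ l ∧ ∃ d < N,
      (blockLen N * k < N ∧ d = block N k (v 0)) ∧ ∃ y < N, c + d = y ∧ M N y (v 1) a) N₀
    hT ((one _).and (.lt_two_pow_blockLen _))
    (NDef.ex ((hT _).and (NDef.ex ((NDef.eq_block none (some none) (some (some (some 0)))).and
      (hM none (some (some (some 1))) (some (some none)))))))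
    (NDef.ex ((NDef.eq_blockLen _).and (NDef.ex ((NDef.mul_two_pow none (some (some (some none)))
      (some none)).and (NDef.ex ((NDef.eq_block none (some (some (some (some (some none)))))
      (some (some (some (some (some (some 0))))))).and (NDef.ex ((NDef.add (some (some none))
      (some none) none).and (hM none (some (some (some (some (some (some (some 1)))))))
      (some (some (some (some none)))))))))))))
    ?_ ?_ ?_ ?_
  · refine (key.relabel fun o : Option (Fin 2) => o.elim r ![x, m]).congr fun N _ v _ => ?_
    simp
  · intro N _
    exact Nat.mul_div_le _ _
  · rintro N - v - hG k -
    exact (Nat.mod_lt _ (by have := hG.1; omega)).trans hG.2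
  · intro N hN v hv hG a ha
    have hL := (hN₀ N hN).1
    have hbl := hL.bitLen_lt
    have h8 := eight_le_blockLen N
    have hlN : 2 ^ blockLen N < N := hL.pow_lt (by omega)
    obtain ⟨t, ht⟩ : ∃ t, t = bitLen N / blockLen N := ⟨_, rfl⟩
    have htl : blockLen N * t ≤ bitLen N := ht ▸ Nat.mul_div_le _ _
    have htl' : bitLen N + 1 ≤ blockLen N * t + blockLen N := by
      have := Nat.lt_mul_div_succ (bitLen N) (b := blockLen N) (by omega)
      rw [← ht, mul_add, mul_one] at this
      omega
    -- As x < 2 ^ (bitLen N + 1), block `t` contains all the remaining top bits of x, so truncation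
    -- to a block loses nothing.
    have hsmall : v 0 / 2 ^ (blockLen N * t) < 2 ^ blockLen N := by
      rw [Nat.div_lt_iff_lt_mul (Nat.two_pow_pos _), ← pow_add, add_comm]
      exact (hv 0).trans_le (le_two_pow_bitLen.trans (Nat.pow_le_pow_right (by norm_num) htl'))
    have hblk : block N t (v 0) = v 0 / 2 ^ (blockLen N * t) := Nat.mod_eq_of_lt hsmall
    have hS : ShortMul N (block N t (v 0)) 1 (v 1) :=
      ⟨(Nat.div_le_self _ _).trans_lt (block_lt _ _ _), hG.2, hG.1⟩
    constructor
    · rintro ⟨t', -, rfl, y, -, ⟨-, rfl⟩, h⟩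
      rw [hM' hL.two_le, ← ht] at h
      rw [h.2, hblk, ← ht]
    · intro h
      refine ⟨t, by nlinarith, ht, _, (block_lt _ _ _).trans hlN, ⟨by omega, rfl⟩,
        (hM' hL.two_le).2 ⟨hS, ?_⟩⟩
      rw [h, hblk, ← ht]
  · intro N hN v hv hG k hk a ha
    have hL := (hN₀ N hN).1
    have hlN : 2 ^ blockLen N < N := hL.pow_lt (by omega)
    have hlN' : blockLen N < N := Nat.lt_two_pow_self.trans hlN
    have hllN : 2 ^ (blockLen N + blockLen N) < N := hL.pow_lt (by omega)
    have hkN : blockLen N * k < N :=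
      ((Nat.mul_le_mul_left _ hk.le).trans (Nat.mul_div_le _ _)).trans_lt hL.bitLen_lt
    obtain ⟨q, hq⟩ : ∃ q, q = v 0 / 2 ^ (blockLen N * (k + 1)) := ⟨_, rfl⟩
    have hq' : v 0 / 2 ^ (blockLen N * k) = q * 2 ^ blockLen N + block N k (v 0) := by
      rw [hq, mul_add, mul_one, pow_add, ← Nat.div_div_eq_div_mul, mul_comm _ (2 ^ blockLen N)]
      exact (Nat.div_add_mod _ _).symm
    have hmod : (q % v 1 * 2 ^ blockLen N + block N k (v 0)) % v 1 =
        v 0 / 2 ^ (blockLen N * k) % v 1 := by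
      rw [hq', Nat.add_mod, Nat.mul_mod, Nat.mod_mod, ← Nat.mul_mod, ← Nat.add_mod]
    have hb : block N k (v 0) < 2 ^ blockLen N := block_lt _ _ _
    have hqm : q % v 1 < v 1 := Nat.mod_lt _ (by have := hG.1; omega)
    have hY : q % v 1 * 2 ^ blockLen N + block N k (v 0) < 2 ^ (blockLen N + blockLen N) := by
      rw [pow_add]
      calc _ < (q % v 1 + 1) * 2 ^ blockLen N := by rw [add_mul, one_mul]; omega
        _ ≤ _ := Nat.mul_le_mul_right _ (by have := hG.2; omega)
    rw [← hq, ← hmod]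
    constructor
    · rintro ⟨l, -, rfl, c, -, rfl, d, -, ⟨-, rfl⟩, y, -, rfl, h⟩
      exact ((hM' hL.two_le).1 h).2
    · intro h
      refine ⟨_, hlN', rfl, _, by omega, rfl, _, hb.trans hlN, ⟨hkN, rfl⟩, _, hY.trans hllN, rfl,
        (hM' hL.two_le).2 ⟨⟨?_, hG.2, hG.1⟩, h⟩⟩
      rw [Nat.div_lt_iff_lt_mul (Nat.two_pow_pos _), ← pow_add]
      exact hY

end

/-! ### Polynomial equations -/

/-- Polynomials in the elements and the cardinality of the universe. -/
inductive PolyFn {α : Type} : (ℕ → (α → ℕ) → ℕ) → Prop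
  | zero : PolyFn fun _ _ => 0
  | one : PolyFn fun _ _ => 1
  | card : PolyFn fun N _ => N
  | var (i : α) : PolyFn fun _ v => v i
  | add {f g} (hf : PolyFn f) (hg : PolyFn g) : PolyFn fun N v => f N v + g N v
  | mul {f g} (hf : PolyFn f) (hg : PolyFn g) : PolyFn fun N v => f N v * g N v

namespace PolyFn

variable {α : Type} {f g : ℕ → (α → ℕ) → ℕ}

theorem const (c : ℕ) : PolyFn fun _ (_ : α → ℕ) => c := by
  induction c with
  | zero => exact .zero
  | succ c ih => exact ih.add .one

theorem pow (hf : PolyFn f) (e : ℕ) : PolyFn fun N v => f N v ^ e := by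
  induction e with
  | zero => exact .one
  | succ e ih => exact ih.mul hf

theorem sum {ι : Type} (s : Finset ι) {f : ι → ℕ → (α → ℕ) → ℕ} (hf : ∀ i, PolyFn (f i)) :
    PolyFn fun N v => ∑ i ∈ s, f i N v := by
  classical
  induction s using Finset.induction_on with
  | empty => exact .zero
  | insert i s hi ih => simpa only [Finset.sum_insert hi] using (hf i).add ih

theorem le_pow (hf : PolyFn f) : ∃ d, ∀ N, 2 ≤ N → ∀ v, (∀ i, v i < N) → f N v ≤ N ^ d := by
  induction hf with
  | zero => exact ⟨0, fun N _ v _ => by simp⟩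
  | one => exact ⟨0, fun N _ v _ => by simp⟩
  | card => exact ⟨1, fun N _ v _ => by simp⟩
  | var i => exact ⟨1, fun N _ v hv => by simpa using (hv i).le⟩
  | add _ _ ihf ihg =>
    obtain ⟨d, hd⟩ := ihf
    obtain ⟨e, he⟩ := ihg
    refine ⟨d + e + 1, fun N hN v hv => ?_⟩
    have h1 := hd N hN v hv
    have h2 := he N hN v hv
    have h3 : N ^ d ≤ N ^ (d + e) := Nat.pow_le_pow_right (by omega) (by omega)
    have h4 : N ^ e ≤ N ^ (d + e) := Nat.pow_le_pow_right (by omega) (by omega)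
    rw [pow_succ]
    nlinarith
  | mul _ _ ihf ihg =>
    obtain ⟨d, hd⟩ := ihf
    obtain ⟨e, he⟩ := ihg
    refine ⟨d + e, fun N hN v hv => ?_⟩
    rw [pow_add]
    exact Nat.mul_le_mul (hd N hN v hv) (he N hN v hv)

theorem ndef_add_mod {γ : Type} [Finite γ] {f g : ℕ → (γ → ℕ) → ℕ} (m r : γ)
    (hf : NDef fun N (v : Option γ → ℕ) =>
      (1 < v (some m) ∧ v (some m) < 2 ^ blockLen N) ∧
        v none = f N (fun i => v (some i)) % v (some m))
    (hg : NDef fun N (v : Option γ → ℕ) =>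
      (1 < v (some m) ∧ v (some m) < 2 ^ blockLen N) ∧
        v none = g N (fun i => v (some i)) % v (some m)) :
    NDef fun N v => (1 < v m ∧ v m < 2 ^ blockLen N) ∧ v r = (f N v + g N v) % v m := by
  obtain ⟨N₀, hN₀⟩ := exists_large 0
  refine NDef.of_eventually (NDef.ex (R := fun N v a => ((1 < v m ∧ v m < 2 ^ blockLen N) ∧
    a = f N v % v m) ∧ ∃ b < N, ((1 < v m ∧ v m < 2 ^ blockLen N) ∧ b = g N v % v m) ∧
    ∃ c < N, a + b = c ∧ v r < v m ∧ (c = v r ∨ v r + v m = c)) (hf.and (NDef.ex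
    (R := fun N v b => ((1 < v (some m) ∧ v (some m) < 2 ^ blockLen N) ∧
      b = g N (fun i => v (some i)) % v (some m)) ∧
      ∃ c < N, v none + b = c ∧ v (some r) < v (some m) ∧
        (c = v (some r) ∨ v (some r) + v (some m) = c))
    ((hg.relabel fun o => o.elim none fun i => some (some i)).and (NDef.ex
    (R := fun N v c => v (some none) + v none = c ∧ v (some (some r)) < v (some (some m)) ∧
        (c = v (some (some r)) ∨ v (some (some r)) + v (some (some m)) = c))
    ((NDef.add (some (some none)) (some none) none).and
      ((NDef.lt (some (some (some r))) (some (some (some m)))).and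
      ((NDef.eq none (some (some (some r)))).or
        (NDef.add (some (some (some r))) (some (some (some m))) none))))))))) N₀
      fun N hN _ v hv => ?_
  have hl : 2 ^ (blockLen N + 1) < N := (hN₀ N hN).1.pow_lt (by omega)
  rw [pow_succ] at hl
  constructor
  · rintro ⟨a, -, ⟨hG, rfl⟩, b, -, ⟨-, rfl⟩, c, -, rfl, h1, h2⟩
    refine ⟨hG, ?_⟩
    rw [Nat.add_mod]
    rcases h2 with h | h
    · rw [h, Nat.mod_eq_of_lt h1]
    · rw [← h, Nat.add_mod_right, Nat.mod_eq_of_lt h1]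
  · rintro ⟨hG, h⟩
    have hm : 0 < v m := by omega
    have h1 := Nat.mod_lt (f N v) hm
    have h2 := Nat.mod_lt (g N v) hm
    refine ⟨_, by omega, ⟨hG, rfl⟩, _, by omega, ⟨hG, rfl⟩, _, by omega, rfl, ?_⟩
    rw [Nat.add_mod] at h
    generalize f N v % v m = a at *
    generalize g N v % v m = b at *
    rcases Nat.lt_or_ge (a + b) (v m) with h3 | h3
    · rw [Nat.mod_eq_of_lt h3] at h
      omega
    · rw [Nat.mod_eq_sub_mod h3, Nat.mod_eq_of_lt (by omega)] at h
      omega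

/-- The value of the polynomial may be far outside the universe, but its residue modulo a short
number is an element and can be computed along the construction of the polynomial. -/
theorem ndef_mod (hf : PolyFn f) : ∀ {γ : Type} [Finite γ] (s : α → γ) (m r : γ),
    NDef fun N v => (1 < v m ∧ v m < 2 ^ blockLen N) ∧ v r = f N (fun i => v (s i)) % v m := by
  have hG : ∀ {γ : Type} [Finite γ] (m : γ), NDef fun N v => 1 < v m ∧ v m < 2 ^ blockLen N :=
    fun m => .and (((NDef.const 0 m).or (NDef.const 1 m)).not.congr fun _ _ _ _ => by omega)
      (.lt_two_pow_blockLen m)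
  have hone : ∀ {γ : Type} [Finite γ] (m r : γ), NDef fun N v =>
      (1 < v m ∧ v m < 2 ^ blockLen N) ∧ v r = 1 % v m := fun m r =>
    ((hG m).and (NDef.const 1 r)).congr fun N _ v _ =>
      and_congr_right fun h => by rw [Nat.mod_eq_of_lt h.1]
  induction hf with
  | zero =>
    intro γ _ s m r
    exact ((hG m).and (NDef.const 0 r)).congr fun N _ v _ => by simp
  | one => exact fun _ => hone
  | card =>
    intro γ _ s m r
    -- `N` is not an element, so it is reduced as the sum of the greatest element `N - 1` and 1.
    refine (ndef_add_mod (f := fun N _ => N - 1) (g := fun _ _ => 1) m r ?_ (hone _ _)).congr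
      fun N hN v _ => by simp [Nat.sub_add_cancel hN]
    exact NDef.subst (F := fun N _ => N - 1) (R := fun N (v : Option _ → ℕ) a =>
      (1 < v (some m) ∧ v (some m) < 2 ^ blockLen N) ∧ v none = a % v (some m)) (.max _)
      (.mod none (some (some m)) (some none)) fun N hN _ _ _ => by omega
  | var i => exact fun s m r => .mod (s i) m r
  | add _ _ ihf ihg =>
    intro γ _ s m r
    exact ndef_add_mod m r (ihf (fun i => some (s i)) _ _) (ihg (fun i => some (s i)) _ _)
  | @mul f g _ _ ihf ihg =>
    intro γ _ s m r
    refine (NDef.ex (R := fun N v a => ((1 < v m ∧ v m < 2 ^ blockLen N) ∧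
      a = f N (fun i => v (s i)) % v m) ∧ ∃ b < N, ((1 < v m ∧ v m < 2 ^ blockLen N) ∧
        b = g N (fun i => v (s i)) % v m) ∧ (ShortMul N a b (v m) ∧ v r = a * b % v m))
      ((ihf (fun i => some (s i)) (some m) none).and (NDef.ex
      (R := fun N v b => ((1 < v (some m) ∧ v (some m) < 2 ^ blockLen N) ∧
        b = g N (fun i => v (some (s i))) % v (some m)) ∧
        (ShortMul N (v none) b (v (some m)) ∧ v (some r) = v none * b % v (some m)))
      ((ihg (fun i => some (some (s i))) (some (some m)) none).and
        (NDef.mulMod (some none) none (some (some m)) (some (some r))))))).congr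
      fun N hN v hv => ?_
    constructor
    · rintro ⟨a, -, ⟨hG, rfl⟩, b, -, ⟨-, rfl⟩, -, h⟩
      exact ⟨hG, by rw [h, ← Nat.mul_mod]⟩
    · rintro ⟨hG, h⟩
      have hm : 0 < v m := by omega
      have h1 := Nat.mod_lt (f N fun i => v (s i)) hm
      have h2 := Nat.mod_lt (g N fun i => v (s i)) hm
      have := hv m
      exact ⟨_, h1.trans (hv m), ⟨hG, rfl⟩, _, h2.trans (hv m), ⟨hG, rfl⟩,
        ⟨(Nat.div_le_self _ _).trans_lt (h1.trans hG.2), hG.2, h2⟩, by rw [h, ← Nat.mul_mod]⟩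

end PolyFn

/-- Every prime power that exactly divides the binomial coefficient of `2 * n` over `n` is at most
`2 * n`, so it is one of the divisors `m` of `D`. -/
theorem centralBinom_dvd {n D : ℕ} (hD : D ≠ 0) (h : ∀ m, 1 < m → m ≤ 2 * n → m ∣ D) :
    n.centralBinom ∣ D := by
  rcases Nat.eq_zero_or_pos n with rfl | hn
  · simp
  rw [← Nat.factorization_prime_le_iff_dvd (Nat.centralBinom_ne_zero n) hD]
  intro p hp
  rw [← hp.pow_dvd_iff_le_factorization hD]
  rcases Nat.eq_zero_or_pos (n.centralBinom.factorization p) with h0 | h0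
  · simp [h0]
  · exact h _ (Nat.one_lt_pow h0.ne' hp.one_lt) (Nat.pow_factorization_choose_le (by omega))

/-- Let K = `bitLen N`. All numbers up to 2K² are admissible moduli, so a nonzero difference is
divisible by the central binomial coefficient of K², which exceeds 4 ^ K² / K² > 2 ^ K². But the
difference is at most N ^ d ≤ 2 ^ ((K + 1) d) ≤ 2 ^ K². -/
theorem eq_of_forall_mod_eq {N a b d : ℕ} (hN : Large N) (hd : 2 * d + 4 ≤ bitLen N)
    (ha : a ≤ N ^ d) (hb : b ≤ N ^ d)
    (h : ∀ m, 1 < m → m < 2 ^ blockLen N → a % m = b % m) : a = b := by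
  wlog hab : a ≤ b
  · exact (this hN hd hb ha (fun m h1 h2 => (h m h1 h2).symm) (le_of_not_ge hab)).symm
  by_contra hne
  have hD : b - a ≠ 0 := by omega
  obtain ⟨K, hK⟩ : ∃ K, K = bitLen N := ⟨_, rfl⟩
  have h1 := hN.lt_pow
  have hle : N ≤ 2 ^ (bitLen N + 1) := le_two_pow_bitLen
  rw [← hK] at h1 hle hd
  have hdvd := centralBinom_dvd (n := K * K) hD fun m h1m h2m =>
    (Nat.modEq_iff_dvd' hab).1 (h m h1m (by linarith))
  have h2 := Nat.le_of_dvd (by omega) hdvd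
  have h3 := Nat.four_pow_lt_mul_centralBinom (K * K) (by nlinarith)
  have h4 : N ^ d ≤ 2 ^ ((K + 1) * d) := by
    rw [pow_mul]
    exact Nat.pow_le_pow_left hle d
  have h5 : K * K < 2 ^ (K * K) := Nat.lt_two_pow_self
  have h6 : (K + 1) * d ≤ K * K := by nlinarith
  have h7 : 2 ^ ((K + 1) * d) ≤ 2 ^ (K * K) := Nat.pow_le_pow_right (by norm_num) h6
  have h8 : (4 : ℕ) ^ (K * K) = 2 ^ (K * K) * 2 ^ (K * K) := by
    rw [← mul_pow]
    norm_num
  have h9 : (K * K).centralBinom ≤ 2 ^ (K * K) := by omega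
  have h10 := Nat.mul_le_mul h5.le h9
  omega

/-- Both sides are at most a fixed power of `N`, so for large `N` they are equal once their residues
modulo all short numbers agree. This replaces a definition of multiplication and covers products
that leave the universe. -/
theorem NDef.poly_eq {α : Type} [Finite α] {f g : ℕ → (α → ℕ) → ℕ} (hf : PolyFn f)
    (hg : PolyFn g) : NDef fun N v => f N v = g N v := by
  obtain ⟨d, hd⟩ := hf.le_pow
  obtain ⟨e, he⟩ := hg.le_pow
  obtain ⟨N₀, hN₀⟩ := exists_large (2 * (d + e) + 4)
  refine NDef.of_eventually (NDef.all (R := fun N v m => ∀ r < N,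
    ((1 < m ∧ m < 2 ^ blockLen N) ∧ r = f N v % m) → ((1 < m ∧ m < 2 ^ blockLen N) ∧
      r = g N v % m)) (NDef.all (R := fun N v r =>
    ((1 < v none ∧ v none < 2 ^ blockLen N) ∧ r = f N (fun i => v (some i)) % v none) →
      ((1 < v none ∧ v none < 2 ^ blockLen N) ∧ r = g N (fun i => v (some i)) % v none))
    ((hf.ndef_mod (fun i => some (some i)) (some none) none).imp
    (hg.ndef_mod (fun i => some (some i)) (some none) none)))) N₀ fun N hN _ v hv => ?_
  obtain ⟨hL, hK⟩ := hN₀ N hN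
  have hlN : 2 ^ blockLen N < N := hL.pow_lt (by omega)
  constructor
  · intro h
    refine eq_of_forall_mod_eq (d := d + e) hL hK ?_ ?_ fun m h1 h2 => ?_
    · exact (hd N hL.two_le v hv).trans
        (Nat.pow_le_pow_right (by have := hL.two_le; omega) (by omega))
    · exact (he N hL.two_le v hv).trans
        (Nat.pow_le_pow_right (by have := hL.two_le; omega) (by omega))
    · exact (h m (h2.trans hlN) _ ((Nat.mod_lt _ (by omega)).trans (h2.trans hlN))
        ⟨⟨h1, h2⟩, rfl⟩).2
  · rintro h m - r - ⟨h1, h2⟩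
    exact ⟨h1, by rw [h2, h]⟩

/-- The length of the binary representation of a number below `v j + 1`. -/
theorem NDef.clog {α : Type} (i j : α) : NDef fun _ v => v i = Nat.clog 2 (v j + 1) := by
  refine (((NDef.const 0 j).and (NDef.const 0 i)).or ((NDef.const 0 j).not.and
    (NDef.ex (R := fun N v l => l = Nat.log 2 (v j) ∧ l + 1 = v i)
      ((NDef.log _ _).and (.succ none (some i)))))).congr fun N hN v hv => ?_
  by_cases h0 : v j = 0
  · simp [h0]
  have key : Nat.clog 2 (v j + 1) = Nat.log 2 (v j) + 1 := by
    refine le_antisymm ?_ ?_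
    · rw [Nat.clog_le_iff_le_pow (by norm_num)]
      exact Nat.lt_pow_succ_log_self (by norm_num) _
    · rw [Nat.succ_le_iff, Nat.lt_clog_iff_pow_lt (by norm_num)]
      exact Nat.lt_succ_of_le (Nat.pow_log_le_self 2 h0)
  rw [key]
  constructor
  · rintro (⟨h, -⟩ | ⟨-, l, -, rfl, h⟩)
    · exact absurd h h0
    · exact h.symm
  · intro h
    exact .inr ⟨h0, _, (Nat.log_lt_self 2 h0).trans (hv j), rfl, h.symm⟩

/-! ### Counting proof trees -/

section trees

variable {n : ℕ} (C : Circuit n) (x : Fin n → Bool)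

/-- The proof trees below an and-gate. -/
def ProofTree.andEquiv {g : C.Gate} (hg : C.label g = .and) :
    ProofTree C x g ≃ ((h : {h // C.child g h}) → ProofTree C x h.1) where
  toFun t := match t with
    | .leaf _ h => by rw [hg] at h; exact h.elim
    | .and _ _ t => fun h => t h.1 h.2
    | .or _ h _ _ _ => by rw [hg] at h; cases h
  invFun t := .and g hg fun h hh => t ⟨h, hh⟩
  left_inv t := by
    cases t with
    | leaf _ h => rw [hg] at h; exact h.elim
    | and _ _ t => rfl
    | or _ h _ _ _ => rw [hg] at h; cases h
  right_inv t := rfl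

/-- The proof trees below an or-gate. -/
def ProofTree.orEquiv {g : C.Gate} (hg : C.label g = .or) :
    ProofTree C x g ≃ (h : {h // C.child g h}) × ProofTree C x h.1 where
  toFun t := match t with
    | .leaf _ h => by rw [hg] at h; exact h.elim
    | .and _ h _ => by rw [hg] at h; cases h
    | .or _ _ h hh t => ⟨⟨h, hh⟩, t⟩
  invFun t := .or g hg t.1.1 t.1.2 t.2
  left_inv t := by
    cases t with
    | leaf _ h => rw [hg] at h; exact h.elim
    | and _ h _ => rw [hg] at h; cases h
    | or _ _ h hh t => rfl
  right_inv t := rfl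

/-- The proof trees below an input gate. -/
def ProofTree.inputEquiv {g : C.Gate} (hg : (C.label g).IsInput) :
    ProofTree C x g ≃ PLift ((C.label g).IsTrue x) where
  toFun t := match t with
    | .leaf _ h => ⟨h⟩
    | .and _ h _ => by rw [h] at hg; exact hg.elim
    | .or _ h _ _ _ => by rw [h] at hg; exact hg.elim
  invFun h := .leaf g h.down
  left_inv t := by
    cases t with
    | leaf _ h => rfl
    | and _ h _ => rw [h] at hg; exact hg.elim
    | or _ h _ _ _ => rw [h] at hg; exact hg.elim
  right_inv t := rfl

theorem Label.cases (l : Label n) : l = .and ∨ l = .or ∨ l.IsInput := by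
  cases l <;> simp [Label.IsInput]

theorem Circuit.wellFounded : WellFounded fun h g => C.child g h := by
  have := C.finite
  let r : C.Gate → C.Gate → Prop := fun h g => Relation.TransGen C.child g h
  have : IsTrans C.Gate r := ⟨fun _ _ _ h1 h2 => h2.trans h1⟩
  have : Std.Irrefl r := ⟨fun g => C.acyclic g⟩
  exact Subrelation.wf (r := r) (fun h => .single h) (Finite.wellFounded_of_trans_of_irrefl r)

instance ProofTree.finite (g : C.Gate) : Finite (ProofTree C x g) := by
  have := C.finite
  induction g using C.wellFounded.induction with
  | _ g ih =>
    have : ∀ h : {h // C.child g h}, Finite (ProofTree C x h.1) := fun h => ih h.1 h.2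
    rcases (C.label g).cases with hg | hg | hg
    · exact .of_equiv _ (ProofTree.andEquiv C x hg).symm
    · exact .of_equiv _ (ProofTree.orEquiv C x hg).symm
    · exact .of_equiv _ (ProofTree.inputEquiv C x hg).symm

open Classical in
theorem card_proofTree_and [Fintype C.Gate] {g : C.Gate} (hg : C.label g = .and) :
    Nat.card (ProofTree C x g) =
      ∏ h : C.Gate, if C.child g h then Nat.card (ProofTree C x h) else 1 := by
  rw [Nat.card_congr (ProofTree.andEquiv C x hg), Nat.card_pi, ← Finset.prod_filter,
    ← Finset.prod_subtype_eq_prod_filter]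
  refine Finset.prod_equiv (Equiv.subtypeEquivRight fun h => by simp) (by simp) fun h _ => rfl

open Classical in
theorem card_proofTree_or [Fintype C.Gate] {g : C.Gate} (hg : C.label g = .or) :
    Nat.card (ProofTree C x g) =
      ∑ h : C.Gate, if C.child g h then Nat.card (ProofTree C x h) else 0 := by
  rw [Nat.card_congr (ProofTree.orEquiv C x hg), Nat.card_sigma, ← Finset.sum_filter,
    ← Finset.sum_subtype_eq_sum_filter]
  refine Finset.sum_equiv (Equiv.subtypeEquivRight fun h => by simp) (by simp) fun h _ => rfl

open Classical in
theorem card_proofTree_input {g : C.Gate} (hg : (C.label g).IsInput) :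
    Nat.card (ProofTree C x g) = if (C.label g).IsTrue x then 1 else 0 := by
  rw [Nat.card_congr (ProofTree.inputEquiv C x hg)]
  split_ifs with h
  · have : Unique (PLift ((C.label g).IsTrue x)) := ⟨⟨⟨h⟩⟩, fun _ => rfl⟩
    exact Nat.card_unique
  · have : IsEmpty (PLift ((C.label g).IsTrue x)) := ⟨fun t => h t.down⟩
    exact Nat.card_of_isEmpty

/-- The hypothesis `hc` says that the image of `i` is closed under children, so no proof tree below
`i g` leaves the copy of `C`; gates outside contribute neutral terms to the sums and products. -/
theorem card_proofTree_embedding {C D : Circuit n} (i : C.Gate → D.Gate)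
    (hi : Function.Injective i) (hl : ∀ g, D.label (i g) = C.label g)
    (hc : ∀ g h, D.child (i g) h ↔ ∃ h', i h' = h ∧ C.child g h') (g : C.Gate) :
    Nat.card (ProofTree D x (i g)) = Nat.card (ProofTree C x g) := by
  classical
  have := C.finite
  have := D.finite
  have := Fintype.ofFinite C.Gate
  have := Fintype.ofFinite D.Gate
  have hc' : ∀ g h, D.child (i g) (i h) ↔ C.child g h := fun g h =>
    (hc g (i h)).trans ⟨by rintro ⟨h', he, hh⟩; exact hi he ▸ hh, fun hh => ⟨h, rfl, hh⟩⟩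
  have hn : ∀ g, ∀ h ∉ Set.range i, ¬ D.child (i g) h := by
    intro g h hh hch
    obtain ⟨h', rfl, -⟩ := (hc g h).1 hch
    exact hh ⟨h', rfl⟩
  induction g using C.wellFounded.induction with
  | _ g ih =>
    rcases (C.label g).cases with hg | hg | hg
    · rw [card_proofTree_and C x hg, card_proofTree_and D x ((hl g).trans hg)]
      refine (Fintype.prod_of_injective i hi _ _ (fun h hh => if_neg (hn g h hh)) fun h => ?_).symm
      simp only [hc']
      split_ifs with hh
      · exact (ih h hh).symm
      · rfl
    · rw [card_proofTree_or C x hg, card_proofTree_or D x ((hl g).trans hg)]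
      refine (Fintype.sum_of_injective i hi _ _ (fun h hh => if_neg (hn g h hh)) fun h => ?_).symm
      simp only [hc']
      split_ifs with hh
      · exact (ih h hh).symm
      · rfl
    · rw [card_proofTree_input C x hg, card_proofTree_input D x (by rwa [hl g]), hl g]

end trees

/-! ### Uniform descriptions of circuits -/

/-- Labels of the gates of a kind, where a gate is given by a tuple with the index set `J`. -/
inductive KindLabel (J : Type) : Type
  | and : KindLabel J
  | or : KindLabel J
  | one : KindLabel J
  | lit (j : J) (positive : Bool) : KindLabel J

/-- The label of a gate. -/
def KindLabel.toLabel {J : Type} {N : ℕ} (v : J → Fin N) : KindLabel J → Label N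
  | and => .and
  | or => .or
  | one => .const true
  | lit j b => .lit (v j) b

/-- A description of circuits for all universes `{0, …, N - 1}`: there are finitely many kinds of
gates, the gates of a kind are tuples, and edges are definable. The kind `root` has gates that are
given by tuples with the index set `α`. -/
structure Scheme (α : Type) where
  Kind : Type
  J : Kind → Type
  label : ∀ q, KindLabel (J q)
  child : ∀ q q', ℕ → (J q ⊕ J q' → ℕ) → Prop
  rank : Kind → ℕ
  root : Kind
  rootEquiv : α ≃ J root
  finite_kind : Finite Kind
  finite_index : ∀ q, Finite (J q)
  child_def : ∀ q q', NDef (child q q')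
  rank_lt : ∀ q q' N v, child q q' N v → rank q' < rank q
  input : ∀ q q' N v, child q q' N v → label q = .and ∨ label q = .or

namespace Scheme

variable {α : Type} (S : Scheme α) {N : ℕ}

/-- The gates of the circuit for the universe `{0, …, N - 1}`. -/
def Gate (N : ℕ) : Type := (q : S.Kind) × (S.J q → Fin N)

instance : Finite (S.Gate N) := by
  have := S.finite_kind
  have := S.finite_index
  exact inferInstanceAs (Finite ((q : S.Kind) × (S.J q → Fin N)))

/-- The edges of the circuit for the universe `{0, …, N - 1}`. -/
def edge (g h : S.Gate N) : Prop :=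
  S.child g.1 h.1 N (Sum.elim (fun j => (g.2 j : ℕ)) fun j => (h.2 j : ℕ))

theorem rank_lt_of_edge {g h : S.Gate N} (e : S.edge g h) : S.rank h.1 < S.rank g.1 :=
  S.rank_lt _ _ _ _ e

theorem rank_lt_of_transGen {g h : S.Gate N} (e : Relation.TransGen S.edge g h) :
    S.rank h.1 < S.rank g.1 := by
  induction e with
  | single e => exact S.rank_lt_of_edge e
  | tail _ e ih => exact (S.rank_lt_of_edge e).trans ih

/-- The circuit for the universe `{0, …, N - 1}` with the output `o`. -/
def circuit (o : S.Gate N) : Circuit N where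
  Gate := S.Gate N
  finite := inferInstance
  label g := (S.label g.1).toLabel g.2
  child := S.edge
  output := o
  acyclic g e := (S.rank_lt_of_transGen e).false
  input_no_child g h hg e := by
    rcases S.input _ _ _ _ e with h | h <;> rw [h] at hg <;> exact hg

/-- The gate of the root kind that is given by `v`. -/
def rootGate (v : α → Fin N) : S.Gate N := ⟨S.root, fun j => v (S.rootEquiv.symm j)⟩

/-- The number of proof trees below a gate of the root kind. -/
noncomputable def count (x : Fin N → Bool) (v : α → Fin N) : ℕ :=
  (S.circuit (S.rootGate v)).numProofTrees x

theorem depthLE (o : S.Gate N) : (S.circuit o).DepthLE (S.rank o.1) := by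
  intro l hl
  have key : ∀ (l : List (S.Gate N)) (g : S.Gate N), List.IsChain S.edge (g :: l) →
      l.length ≤ S.rank g.1 := by
    intro l
    induction l with
    | nil => simp
    | cons h l ih =>
      intro g hg
      rw [List.isChain_cons_cons] at hg
      have := S.rank_lt_of_edge hg.1
      have := ih h hg.2
      simp
      omega
  exact key l o hl

end Scheme

/-- `F N x v` is the number of proof trees below a gate of uniformly described circuits. -/
def Realizable {α : Type} (F : ∀ N : ℕ, (Fin N → Bool) → (α → Fin N) → ℕ) : Prop :=
  ∃ S : Scheme α, ∀ N x v, S.count x v = F N x v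

section

variable {α : Type}

/-- A single kind of input gates. -/
def Scheme.single (α : Type) [Finite α] (l : KindLabel α) : Scheme α where
  Kind := Unit
  J _ := α
  label _ := l
  child _ _ _ _ := False
  rank _ := 0
  root := ()
  rootEquiv := .refl α
  finite_kind := inferInstance
  finite_index _ := inferInstance
  child_def _ _ := .falsum
  rank_lt _ _ _ _ h := h.elim
  input _ _ _ _ h := h.elim

theorem Realizable.one [Finite α] : Realizable fun N _ (_ : α → Fin N) => 1 := by
  refine ⟨.single α .one, fun N x v => ?_⟩
  exact (card_proofTree_input _ x (by trivial)).trans (if_pos rfl)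

theorem Realizable.lit [Finite α] (j : α) (b : Bool) :
    Realizable fun N x (v : α → Fin N) => if x (v j) = b then 1 else 0 := by
  refine ⟨.single α (.lit j b), fun N x v => ?_⟩
  refine (card_proofTree_input _ x (by trivial)).trans ?_
  congr

/-! ### Placing a new kind of gate on top of several descriptions -/

section combine

variable {Z : Type} {γ : Z → Type} (S : ∀ z, Scheme (γ z)) (R : ∀ z, ℕ → (α ⊕ γ z → ℕ) → Prop)

/-- The index sets of the gates of a combined description. -/
def Scheme.CombineJ (α : Type) : Option ((z : Z) × (S z).Kind) → Type
  | none => α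
  | some q => (S q.1).J q.2

/-- The edges of a combined description. -/
inductive Scheme.CombineChild (N : ℕ) : (q q' : Option ((z : Z) × (S z).Kind)) →
    (Scheme.CombineJ S α q ⊕ Scheme.CombineJ S α q' → ℕ) → Prop
  | root (z : Z) (v : α ⊕ (S z).J (S z).root → ℕ)
      (h : R z N fun i => v (i.map id (S z).rootEquiv)) :
      CombineChild N none (some ⟨z, (S z).root⟩) v
  | inner (z : Z) (q q' : (S z).Kind) (v : (S z).J q ⊕ (S z).J q' → ℕ)
      (h : (S z).child q q' N v) : CombineChild N (some ⟨z, q⟩) (some ⟨z, q'⟩) v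

/-- New gates above the root gates of finitely many descriptions. -/
def Scheme.combine [Finite α] [Finite Z]
    (l : KindLabel α) (hl : l = .and ∨ l = .or)
    (hR : ∀ z, NDef (R z)) (r : ℕ) (hr : ∀ z, (S z).rank (S z).root < r) : Scheme α where
  Kind := Option ((z : Z) × (S z).Kind)
  J := Scheme.CombineJ S α
  label q := match q with
    | none => l
    | some q => (S q.1).label q.2
  child q q' N v := Scheme.CombineChild S R N q q' v
  rank q := match q with
    | none => r
    | some q => (S q.1).rank q.2
  root := none
  rootEquiv := .refl α
  finite_kind := by
    have := fun z => (S z).finite_kind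
    infer_instance
  finite_index q := match q with
    | none => inferInstanceAs (Finite α)
    | some q => (S q.1).finite_index q.2
  child_def q q' := by
    rcases q with - | ⟨z, q⟩ <;> rcases q' with - | ⟨z', q'⟩
    · exact NDef.falsum.congr fun N _ v _ => ⟨False.elim, by rintro ⟨⟩⟩
    · by_cases h : (S z').root = q'
      · subst h
        exact ((hR z').relabel (Sum.map id (S z').rootEquiv)).congr
          fun N _ v _ => ⟨CombineChild.root z' v, fun h => by cases h; assumption⟩
      · exact NDef.falsum.congr fun N _ v _ => ⟨False.elim, fun h' => h (by cases h'; rfl)⟩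
    · exact NDef.falsum.congr fun N _ v _ => ⟨False.elim, by rintro ⟨⟩⟩
    · by_cases h : z = z'
      · subst h
        exact ((S z).child_def q q').congr
          fun N _ v _ => ⟨CombineChild.inner z q q' v, fun h => by cases h; assumption⟩
      · exact NDef.falsum.congr fun N _ v _ => ⟨False.elim, fun h' => h (by cases h'; rfl)⟩
  rank_lt q q' N v h := by
    cases h with
    | root z v h => exact hr z
    | inner z q q' v h => exact (S z).rank_lt _ _ _ _ h
  input q q' N v h := by
    cases h with
    | root z v h => exact hl
    | inner z q q' v h => exact (S z).input _ _ _ _ h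

variable [Finite α] [Finite Z] {l : KindLabel α} (hl : l = .and ∨ l = .or)
  (hR : ∀ z, NDef (R z)) {r : ℕ} (hr : ∀ z, (S z).rank (S z).root < r)

/-- The gates of the summand `z` have children only in the same summand, so the old circuit is
embedded and its counts are unchanged. -/
theorem Scheme.card_combine_inner {N : ℕ} (x : Fin N → Bool)
    (o : (Scheme.combine S R l hl hR r hr).Gate N) (z : Z) (u : γ z → Fin N) :
    Nat.card (ProofTree ((Scheme.combine S R l hl hR r hr).circuit o) x
      ⟨some ⟨z, (S z).root⟩, ((S z).rootGate u).2⟩) = (S z).count x u := by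
  let i : (S z).Gate N → (Scheme.combine S R l hl hR r hr).Gate N :=
    fun g => ⟨some ⟨z, g.1⟩, g.2⟩
  refine card_proofTree_embedding x (C := (S z).circuit ((S z).rootGate u))
    (D := (Scheme.combine S R l hl hR r hr).circuit o) i ?_ (fun g => rfl) ?_ ((S z).rootGate u)
  · rintro ⟨q, v⟩ ⟨q', v'⟩ h
    cases h
    rfl
  · rintro ⟨q, v⟩ ⟨q', v'⟩
    constructor
    · intro h
      change Scheme.CombineChild S R N _ _ _ at h
      rcases q' with - | ⟨z', q'⟩
      · cases h
      · have hz : z = z' := by cases h; rfl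
        subst hz
        refine ⟨⟨q', v'⟩, rfl, ?_⟩
        change (S z).child _ _ _ _
        generalize hw : Sum.elim _ _ = w at h
        cases h with
        | inner _ _ _ _ h =>
          rw [← hw] at h
          exact h
    · rintro ⟨⟨q'', v''⟩, h, h'⟩
      cases h
      exact Scheme.CombineChild.inner z q q'' _ h'

/-- The gates below a gate of the new kind. -/
def Scheme.combineGate {N : ℕ} (p : (z : Z) × (γ z → Fin N)) :
    (Scheme.combine S R l hl hR r hr).Gate N :=
  ⟨some ⟨p.1, (S p.1).root⟩, ((S p.1).rootGate p.2).2⟩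

theorem Scheme.combineGate_injective {N : ℕ} :
    Function.Injective (Scheme.combineGate S R hl hR hr (N := N)) := by
  rintro ⟨z, u⟩ ⟨z', u'⟩ h
  have hz : z = z' := by
    have := congrArg Sigma.fst h
    exact congrArg (fun q => q.elim z fun q => q.1) this
  subst hz
  have h2 : ((S z).rootGate u).2 = ((S z).rootGate u').2 := by
    have := (Sigma.mk.inj h).2
    exact eq_of_heq this
  congr
  funext c
  have := congrFun h2 ((S z).rootEquiv c)
  simpa [Scheme.rootGate] using this

/-- The children of a new gate are old root gates: each is given by a description `z` and a
parameter tuple that `R z` relates to `v`. -/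
theorem Scheme.combine_edge {N : ℕ} (v : α → Fin N) (g : (Scheme.combine S R l hl hR r hr).Gate N) :
    (Scheme.combine S R l hl hR r hr).edge ((Scheme.combine S R l hl hR r hr).rootGate v) g ↔
      ∃ p : (z : Z) × (γ z → Fin N), Scheme.combineGate S R hl hR hr p = g ∧
        R p.1 N fun i => (Sum.elim v p.2 i : Fin N) := by
  rcases g with ⟨q, w⟩
  constructor
  · intro h
    change Scheme.CombineChild S R N none q _ at h
    rcases q with - | ⟨z, q⟩
    · cases h
    · have hq : (S z).root = q := by cases h; rfl
      subst hq
      refine ⟨⟨z, fun c => w ((S z).rootEquiv c)⟩, ?_, ?_⟩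
      · simp only [Scheme.combineGate, Scheme.rootGate, Equiv.apply_symm_apply]
        rfl
      · generalize hw : Sum.elim _ _ = y at h
        cases h with
        | root _ _ h =>
          refine (congrArg (R z N) ?_).mpr h
          ext (a | c) <;> rw [← hw] <;> rfl
  · rintro ⟨⟨z, u⟩, h, hR⟩
    cases h
    refine Scheme.CombineChild.root z _ ?_
    convert hR using 1
    ext (a | c)
    · rfl
    · change ((u ((S z).rootEquiv.symm ((S z).rootEquiv c)) : Fin N) : ℕ) = _
      simp

end combine

section rules

variable {Z : Type} {γ : Z → Type}
  {R : ∀ z, ℕ → (α ⊕ γ z → ℕ) → Prop} {F : ∀ z, ∀ N : ℕ, (Fin N → Bool) → (γ z → Fin N) → ℕ}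

theorem exists_rank_lt [Fintype Z] {γ : Z → Type} (S : ∀ z, Scheme (γ z)) :
    ∃ r, ∀ z, (S z).rank (S z).root < r :=
  ⟨∑ z, (S z).rank (S z).root + 1, fun z => Nat.lt_succ_of_le
    (Finset.single_le_sum (f := fun z => (S z).rank (S z).root) (fun _ _ => Nat.zero_le _)
      (Finset.mem_univ z))⟩

theorem Realizable.sum_general [Finite α] [Finite Z]
    [∀ N, Fintype ((z : Z) × (γ z → Fin N))] [∀ z N w, Decidable (R z N w)] (hR : ∀ z, NDef (R z)) (hF : ∀ z, Realizable (F z)) :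
    Realizable fun N x (v : α → Fin N) => ∑ p : (z : Z) × (γ z → Fin N),
      if R p.1 N (fun i => (Sum.elim v p.2 i : Fin N)) then F p.1 N x p.2 else 0 := by
  classical
  choose S hS using hF
  have := Fintype.ofFinite Z
  obtain ⟨r, hr⟩ := exists_rank_lt S
  refine ⟨.combine S R .or (.inr rfl) hR r hr, fun N x v => ?_⟩
  have := Fintype.ofFinite ((Scheme.combine S R .or (.inr rfl) hR r hr).Gate N)
  refine (@card_proofTree_or N _ x this _ rfl).trans ?_
  refine (Fintype.sum_of_injective _ (Scheme.combineGate_injective S R _ hR hr) _ _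
    (fun g hg => if_neg fun h => ?_) fun p => ?_).symm
  · obtain ⟨p, hp, -⟩ := (Scheme.combine_edge S R _ hR hr v g).1 h
    exact hg ⟨p, hp⟩
  · have h : ((Scheme.combine S R .or (.inr rfl) hR r hr).edge
        ((Scheme.combine S R .or (.inr rfl) hR r hr).rootGate v)
        (Scheme.combineGate S R (.inr rfl) hR hr p)) ↔
        R p.1 N fun i => (Sum.elim v p.2 i : Fin N) :=
      (Scheme.combine_edge S R _ hR hr v _).trans
        ⟨fun ⟨p', h1, h2⟩ => Scheme.combineGate_injective S R _ hR hr h1 ▸ h2,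
          fun h => ⟨p, rfl, h⟩⟩
    rw [← hS p.1, ← Scheme.card_combine_inner S R (.inr rfl) hR hr x _ p.1 p.2]
    exact if_congr h.symm rfl rfl

theorem Realizable.prod_general [Finite α] [Finite Z]
    [∀ N, Fintype ((z : Z) × (γ z → Fin N))] [∀ z N w, Decidable (R z N w)] (hR : ∀ z, NDef (R z)) (hF : ∀ z, Realizable (F z)) :
    Realizable fun N x (v : α → Fin N) => ∏ p : (z : Z) × (γ z → Fin N),
      if R p.1 N (fun i => (Sum.elim v p.2 i : Fin N)) then F p.1 N x p.2 else 1 := by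
  classical
  choose S hS using hF
  have := Fintype.ofFinite Z
  obtain ⟨r, hr⟩ := exists_rank_lt S
  refine ⟨.combine S R .and (.inl rfl) hR r hr, fun N x v => ?_⟩
  have := Fintype.ofFinite ((Scheme.combine S R .and (.inl rfl) hR r hr).Gate N)
  refine (@card_proofTree_and N _ x this _ rfl).trans ?_
  refine (Fintype.prod_of_injective _ (Scheme.combineGate_injective S R _ hR hr) _ _
    (fun g hg => if_neg fun h => ?_) fun p => ?_).symm
  · obtain ⟨p, hp, -⟩ := (Scheme.combine_edge S R _ hR hr v g).1 h
    exact hg ⟨p, hp⟩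
  · have h : ((Scheme.combine S R .and (.inl rfl) hR r hr).edge
        ((Scheme.combine S R .and (.inl rfl) hR r hr).rootGate v)
        (Scheme.combineGate S R (.inl rfl) hR hr p)) ↔
        R p.1 N fun i => (Sum.elim v p.2 i : Fin N) :=
      (Scheme.combine_edge S R _ hR hr v _).trans
        ⟨fun ⟨p', h1, h2⟩ => Scheme.combineGate_injective S R _ hR hr h1 ▸ h2,
          fun h => ⟨p, rfl, h⟩⟩
    rw [← hS p.1, ← Scheme.card_combine_inner S R (.inl rfl) hR hr x _ p.1 p.2]
    exact if_congr h.symm rfl rfl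

end rules

end

/-! ### Sums and products of realizable functions -/

section rules

variable {α : Type} {Z : Type} [Fintype Z]

theorem Realizable.congr {F G : ∀ N : ℕ, (Fin N → Bool) → (α → Fin N) → ℕ} (h : Realizable F)
    (H : ∀ N x v, F N x v = G N x v) : Realizable G := by
  obtain ⟨S, hS⟩ := h
  exact ⟨S, fun N x v => (hS N x v).trans (H N x v)⟩

/-- In each description the only child of the gate for `v` is the root gate for the same tuple. -/
theorem Realizable.prod_finite [Finite α] {F : Z → ∀ N : ℕ, (Fin N → Bool) → (α → Fin N) → ℕ}
    (hF : ∀ z, Realizable (F z)) : Realizable fun N x v => ∏ z, F z N x v := by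
  classical
  have := Fintype.ofFinite α
  refine (Realizable.prod_general (γ := fun _ => α) (R := fun _ _ w => ∀ a, w (.inl a) = w (.inr a))
    (fun z => .forall_finite fun a => .eq _ _) hF).congr fun N x v => ?_
  rw [Fintype.prod_sigma]
  refine Finset.prod_congr rfl fun z _ => ?_
  have : ∀ u : α → Fin N, (∀ a, ((Sum.elim v u (.inl a) : Fin N) : ℕ) =
      (Sum.elim v u (.inr a) : Fin N)) ↔ v = u := by
    intro u
    simp [funext_iff, Fin.ext_iff]
  simp only [this, Finset.prod_ite_eq, Finset.mem_univ, if_true]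

variable [Finite α] {β : Z → Type} [∀ z, Finite (β z)] [∀ z N, Fintype (β z → Fin N)] {R : ∀ z, ℕ → (α ⊕ β z → ℕ) → Prop}
  {F : ∀ z, ∀ N : ℕ, (Fin N → Bool) → (α ⊕ β z → Fin N) → ℕ} [∀ z N w, Decidable (R z N w)]

/-- A child carries the parent's parameters `v` as well as the new ones `u`, so that its count may
depend on both; the edge relation demands that `v` be copied correctly. -/
theorem Realizable.sum (hR : ∀ z, NDef (R z)) (hF : ∀ z, Realizable (F z)) :
    Realizable fun N x (v : α → Fin N) => ∑ z, ∑ u : β z → Fin N,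
      if R z N (fun i => (Sum.elim v u i : Fin N)) then F z N x (Sum.elim v u) else 0 := by
  classical
  have := Fintype.ofFinite α
  have := fun z => Fintype.ofFinite (β z)
  refine (Realizable.sum_general (γ := fun z => α ⊕ β z)
    (R := fun z N w => (∀ a, w (.inl a) = w (.inr (.inl a))) ∧ R z N fun i => w (.inr i))
    (fun z => .and (.forall_finite fun a => .eq _ _) ((hR z).relabel _)) hF).congr
      fun N x v => ?_
  rw [Fintype.sum_sigma]
  refine Finset.sum_congr rfl fun z _ => (Fintype.sum_of_injective (fun u => Sum.elim v u) ?_ _ _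
    (fun w hw => if_neg fun h => hw ?_) fun u => ?_).symm
  · exact fun u u' h => funext fun i => congrFun h (.inr i)
  · refine ⟨fun i => w (.inr i), ?_⟩
    ext (a | i)
    · exact h.1 a
    · rfl
  · exact if_congr ⟨fun h => ⟨fun _ => rfl, h⟩, fun h => h.2⟩ rfl rfl

theorem Realizable.prod (hR : ∀ z, NDef (R z)) (hF : ∀ z, Realizable (F z)) :
    Realizable fun N x (v : α → Fin N) => ∏ z, ∏ u : β z → Fin N,
      if R z N (fun i => (Sum.elim v u i : Fin N)) then F z N x (Sum.elim v u) else 1 := by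
  classical
  have := Fintype.ofFinite α
  have := fun z => Fintype.ofFinite (β z)
  refine (Realizable.prod_general (γ := fun z => α ⊕ β z)
    (R := fun z N w => (∀ a, w (.inl a) = w (.inr (.inl a))) ∧ R z N fun i => w (.inr i))
    (fun z => .and (.forall_finite fun a => .eq _ _) ((hR z).relabel _)) hF).congr
      fun N x v => ?_
  rw [Fintype.prod_sigma]
  refine Finset.prod_congr rfl fun z _ => (Fintype.prod_of_injective (fun u => Sum.elim v u) ?_ _ _
    (fun w hw => if_neg fun h => hw ?_) fun u => ?_).symm
  · exact fun u u' h => funext fun i => congrFun h (.inr i)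
  · refine ⟨fun i => w (.inr i), ?_⟩
    ext (a | i)
    · exact h.1 a
    · rfl
  · exact if_congr ⟨fun h => ⟨fun _ => rfl, h⟩, fun h => h.2⟩ rfl rfl

end rules

/-! ### Uniformity -/

theorem Interpretation.describes_of_bijection (I : Interpretation stringLang circLang) {N : ℕ}
    (C : Circuit N) (ν : C.Gate → Fin I.dim → Fin N) (hinj : Function.Injective ν)
    (huniv : ∀ (x : Fin N → Bool) (t : Fin I.dim → Fin N),
      letI := stringStructure x
      I.univ.Realize t ↔ ∃ g, ν g = t)
    (hrel : ∀ (x : Fin N → Bool) (a : ℕ) (r : circLang.Relations a) (g : Fin a → C.Gate),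
      letI := stringStructure x
      (I.rel r).Realize (fun p => ν (g p.1) p.2) ↔
        @Structure.RelMap _ _ (C.toStructure x) a r g) : I.Describes C := by
  refine ⟨ν, fun x => ?_⟩
  let _ := stringStructure x
  let _ := C.toStructure x
  let _ := I.apply (Fin N)
  let e : C.Gate ≃ I.Carrier (Fin N) := Equiv.ofBijective
    (fun g => ⟨ν g, (huniv x _).2 ⟨g, rfl⟩⟩) ⟨fun g h hgh => hinj (congrArg Subtype.val hgh),
      fun t => by
        obtain ⟨g, hg⟩ := (huniv x _).1 t.2
        exact ⟨g, Subtype.ext hg⟩⟩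
  exact ⟨{ e with
    map_fun' := fun f _ => isEmptyElim f
    map_rel' := fun r g => hrel x _ r g }, fun g => rfl⟩

/-- A circuit with one gate, on one input bit, that is true iff `b` is true for the bit. -/
def singleLabel (b : Bool → Bool) : Label 1 :=
  if b true = b false then .const (b true) else .lit 0 (b true)

theorem singleLabel_isInput (b : Bool → Bool) : (singleLabel b).IsInput := by
  unfold singleLabel
  split_ifs <;> trivial

theorem singleLabel_isTrue (b : Bool → Bool) (x : Fin 1 → Bool) :
    (singleLabel b).IsTrue x ↔ b (x 0) = true := by
  unfold singleLabel
  cases h1 : b true <;> cases h2 : b false <;> cases h3 : x 0 <;> simp [Label.IsTrue, h1, h2, h3]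

/-- A circuit with one gate. -/
def oneGateCircuit {N : ℕ} (l : Label N) : Circuit N where
  Gate := Unit
  finite := inferInstance
  label _ := l
  child _ _ := False
  output := ()
  acyclic g h := by
    cases h with
    | single h => exact h
    | tail _ h => exact h
  input_no_child _ _ _ h := h

theorem oneGateCircuit_depthLE {N : ℕ} (l : Label N) (d : ℕ) : (oneGateCircuit l).DepthLE d := by
  rintro (- | ⟨g, L⟩) hL
  · exact Nat.zero_le _
  · rw [List.isChain_cons_cons] at hL
    exact hL.1.elim

theorem oneGateCircuit_size_le {N : ℕ} (l : Label N) : (oneGateCircuit l).size ≤ 1 := by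
  have := (oneGateCircuit l).finite
  exact (Finite.card_subtype_le _).trans (le_of_eq (Nat.card_unique (α := Unit)))

/-! ### Representing gates by tuples of elements -/

namespace Scheme

variable {α : Type} (S : Scheme α)

/-- The index set of the tuples that represent gates. -/
def Index : Type := S.Kind ⊕ ((q : S.Kind) × S.J q)

instance : Finite S.Index := by
  have := S.finite_kind
  have := S.finite_index
  exact inferInstanceAs (Finite (S.Kind ⊕ ((q : S.Kind) × S.J q)))

open Classical in
/-- The tuple represents a gate of the kind `q`. -/
def Code (q : S.Kind) (t : S.Index → ℕ) : Prop :=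
  (∀ q', t (.inl q') = if q' = q then 1 else 0) ∧ ∀ p : (q : S.Kind) × S.J q, p.1 ≠ q → t (.inr p) = 0

theorem Code.def (q : S.Kind) : NDef fun _ t => S.Code q t := by
  have := S.finite_kind
  have := S.finite_index
  exact .and (.forall_finite fun q' => .const _ _)
    (.forall_finite fun p => (NDef.prop _).imp (.const _ _))

variable {S} in
theorem Code.unique {q q' : S.Kind} {t : S.Index → ℕ} (h : S.Code q t) (h' : S.Code q' t) :
    q' = q := by
  by_contra hne
  have h1 := h.1 q'
  have h2 := h'.1 q'
  rw [if_neg hne] at h1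
  rw [if_pos rfl] at h2
  omega

open Classical in
/-- The tuple that represents a gate. -/
noncomputable def encode {N : ℕ} (hN : 2 ≤ N) (g : S.Gate N) : S.Index → Fin N :=
  Sum.elim (fun q => if q = g.1 then ⟨1, hN⟩ else ⟨0, by omega⟩)
    fun p => if h : p.1 = g.1 then g.2 (h ▸ p.2) else ⟨0, by omega⟩

variable {N : ℕ} (hN : 2 ≤ N)

theorem encode_inr (g : S.Gate N) (j : S.J g.1) : S.encode hN g (.inr ⟨g.1, j⟩) = g.2 j := by
  simp [encode]

theorem code_encode (g : S.Gate N) : S.Code g.1 fun i => S.encode hN g i := by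
  refine ⟨fun q => ?_, fun p hp => ?_⟩
  · simp only [encode, Sum.elim_inl]
    split_ifs <;> rfl
  · simp [encode, hp]

/-- The kind of a gate is marked by a single 1 among zeros, which needs two distinct elements, and
each kind has its own coordinates for its parameters. -/
theorem encode_injective : Function.Injective (S.encode hN) := by
  intro g g' h
  have hq : g'.1 = g.1 := (S.code_encode hN g).unique (h ▸ S.code_encode hN g')
  obtain ⟨q, v⟩ := g
  obtain ⟨q', v'⟩ := g'
  dsimp at hq
  subst hq
  have : v = v' := by
    funext j
    have h1 := S.encode_inr hN ⟨q', v⟩ j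
    have h2 := S.encode_inr hN ⟨q', v'⟩ j
    rw [h] at h1
    exact h1.symm.trans h2
  rw [this]

theorem exists_encode {q : S.Kind} {t : S.Index → Fin N} (ht : S.Code q fun i => t i) :
    ∃ g, S.encode hN g = t := by
  refine ⟨⟨q, fun j => t (.inr ⟨q, j⟩)⟩, ?_⟩
  have h := S.code_encode hN ⟨q, fun j => t (.inr ⟨q, j⟩)⟩
  funext i
  rcases i with q' | ⟨q', j⟩
  · exact Fin.ext ((h.1 q').trans (ht.1 q').symm)
  · by_cases hq : q' = q
    · subst hq
      exact S.encode_inr hN ⟨q', fun j => t (.inr ⟨q', j⟩)⟩ j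
    · exact Fin.ext ((h.2 ⟨q', j⟩ hq).trans (ht.2 ⟨q', j⟩ hq).symm)

/-- The relations of the circuits in terms of tuples; the universe with one element is a special
case, where `b` determines the value of the only gate. -/
def tupleRel (b : Bool → Bool) : {a : ℕ} → CircRel a → (N : ℕ) → (Fin N → Bool) →
    (Fin a × S.Index → Fin N) → Prop
  | _, .E, N, _, t => N ≠ 1 ∧ ∃ q q', S.Code q (fun i => t (0, i)) ∧ S.Code q' (fun i => t (1, i)) ∧
      S.child q q' N (Sum.elim (fun j => (t (0, .inr ⟨q, j⟩) : ℕ)) fun j => t (1, .inr ⟨q', j⟩))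
  | _, .andGate, N, _, t => N ≠ 1 ∧ ∃ q, S.Code q (fun i => t (0, i)) ∧ S.label q = .and
  | _, .orGate, N, _, t => N ≠ 1 ∧ ∃ q, S.Code q (fun i => t (0, i)) ∧ S.label q = .or
  | _, .B, N, x, t => (N = 1 ∧ b (x (t (0, .inl S.root))) = true) ∨ (N ≠ 1 ∧
      ∃ q, S.Code q (fun i => t (0, i)) ∧ (S.label q = .one ∨
        ∃ j v, S.label q = .lit j v ∧ x (t (0, .inr ⟨q, j⟩)) = v))
  | _, .root, N, _, t => N = 1 ∨ S.Code S.root fun i => t (0, i)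

theorem _root_.CountAC.FODef.input_eq {β : Type} (i : β) (b : Bool) :
    FODef fun N x (v : β → Fin N) => x (v i) = b := by
  cases b
  · exact (FODef.input i).not.congr fun _ _ _ _ => by simp
  · exact FODef.input i

theorem _root_.CountAC.FODef.input_apply {β : Type} (i : β) (b : Bool → Bool) :
    FODef fun N x (v : β → Fin N) => b (x (v i)) = true :=
  (FODef.exists_finite fun c : {c : Bool // b c = true} => FODef.input_eq i c.1).congr
    fun _ _ x v => ⟨by rintro ⟨c, h⟩; rw [h]; exact c.2, fun h => ⟨⟨_, h⟩, rfl⟩⟩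

theorem tupleRel_def (b : Bool → Bool) {a : ℕ} (r : CircRel a) : FODef (S.tupleRel b r) := by
  have := S.finite_kind
  have := S.finite_index
  have card : ∀ {β : Type}, NDef fun N (_ : β → ℕ) => N ≠ 1 := (NDef.card_eq 1).not
  have code : ∀ {β : Type} (s : S.Index → β) q, NDef fun N (v : β → ℕ) => S.Code q fun i => v (s i) :=
    fun s q => (Code.def S q).relabel s
  cases r with
  | E =>
    refine FODef.and card (.exists_finite fun q => .exists_finite fun q' => FODef.and
      (code (fun i => ((0 : Fin 2), i)) q) (FODef.and (code (fun i => ((1 : Fin 2), i)) q') ?_))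
    refine FODef.congr ((S.child_def q q').relabel (Sum.elim (fun j => ((0 : Fin 2), Sum.inr ⟨q, j⟩))
      fun j => ((1 : Fin 2), Sum.inr ⟨q', j⟩))) fun N _ _ v => ?_
    refine iff_of_eq (congrArg _ ?_)
    ext (j | j) <;> rfl
  | andGate =>
    exact NDef.and card (.exists_finite fun q => (code (fun i => ((0 : Fin 1), i)) q).and (.prop _))
  | orGate =>
    exact NDef.and card (.exists_finite fun q => (code (fun i => ((0 : Fin 1), i)) q).and (.prop _))
  | B =>
    refine FODef.or (FODef.and (NDef.card_eq 1) (FODef.input_apply _ b)) (FODef.and card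
      (.exists_finite fun q => FODef.and (code (fun i => ((0 : Fin 1), i)) q)
        (FODef.or (NDef.prop _) (.exists_finite fun j => .exists_finite fun v =>
          FODef.and (NDef.prop _) (FODef.input_eq _ v)))))
  | root => exact NDef.or (NDef.card_eq 1) (code (fun i => ((0 : Fin 1), i)) S.root)

variable [IsEmpty α] (b : Bool → Bool)

/-- The uniform circuit family of a description. -/
def family : (N : ℕ) → Circuit N
  | 0 => oneGateCircuit (.const true)
  | 1 => oneGateCircuit (singleLabel b)
  | _ + 2 => S.circuit (S.rootGate isEmptyElim)

theorem toLabel_isTrue {J : Type} (v : J → Fin N) (x : Fin N → Bool) (l : KindLabel J) :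
    (l.toLabel v).IsTrue x ↔ l = .one ∨ ∃ j c, l = .lit j c ∧ x (v j) = c := by
  cases l with
  | lit j c =>
    simp only [KindLabel.toLabel, Label.IsTrue, reduceCtorEq, KindLabel.lit.injEq, false_or]
    exact ⟨fun h => ⟨j, c, ⟨rfl, rfl⟩, h⟩, by rintro ⟨j, c, ⟨rfl, rfl⟩, h⟩; exact h⟩
  | _ => simp [KindLabel.toLabel, Label.IsTrue]

theorem tupleRel_encode (o : S.Gate N) (ho : o = S.rootGate isEmptyElim) (x : Fin N → Bool) (a : ℕ)
    (r : circLang.Relations a) (g : Fin a → S.Gate N) :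
    S.tupleRel b r N x (fun p => S.encode hN (g p.1) p.2) ↔
      @Structure.RelMap _ _ ((S.circuit o).toStructure x) a r g := by
  have hN1 : N ≠ 1 := by omega
  have hcode : ∀ (g : S.Gate N) (P : S.Kind → Prop),
      (∃ q, S.Code q (fun i => S.encode hN g i) ∧ P q) ↔ P g.1 := fun g P =>
    ⟨fun ⟨q, h, hP⟩ => (S.code_encode hN g).unique h ▸ hP, fun h => ⟨_, S.code_encode hN g, h⟩⟩
  cases r with
  | E =>
    change (N ≠ 1 ∧ _) ↔ S.edge (g 0) (g 1)
    have : ∀ P : S.Kind → S.Kind → Prop, (∃ q q', S.Code q (fun i => S.encode hN (g 0) i) ∧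
        S.Code q' (fun i => S.encode hN (g 1) i) ∧ P q q') ↔ P (g 0).1 (g 1).1 := by
      intro P
      simp only [← and_assoc]
      constructor
      · rintro ⟨q, q', ⟨h, h'⟩, hP⟩
        rwa [(S.code_encode hN (g 0)).unique h, (S.code_encode hN (g 1)).unique h'] at hP
      · exact fun h => ⟨_, _, ⟨S.code_encode hN _, S.code_encode hN _⟩, h⟩
    rw [this]
    simp only [encode_inr, ne_eq, hN1, not_false_eq_true, true_and]
    rfl
  | andGate =>
    change (N ≠ 1 ∧ _) ↔ (S.label (g 0).1).toLabel (g 0).2 = .and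
    refine (and_congr_right fun _ => hcode (g 0) fun q => S.label q = .and).trans ?_
    cases S.label (g 0).1 <;> simp [KindLabel.toLabel, hN1]
  | orGate =>
    change (N ≠ 1 ∧ _) ↔ (S.label (g 0).1).toLabel (g 0).2 = .or
    refine (and_congr_right fun _ => hcode (g 0) fun q => S.label q = .or).trans ?_
    cases S.label (g 0).1 <;> simp [KindLabel.toLabel, hN1]
  | B =>
    change _ ∨ (N ≠ 1 ∧ _) ↔ ((S.label (g 0).1).toLabel (g 0).2).IsTrue x
    rw [hcode (g 0) fun q => S.label q = .one ∨
        ∃ j v, S.label q = .lit j v ∧ x (S.encode hN (g 0) (.inr ⟨q, j⟩)) = v, toLabel_isTrue]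
    simp [hN1, encode_inr]
  | root =>
    change _ ∨ _ ↔ g 0 = o
    subst ho
    simp only [hN1, false_or]
    constructor
    · intro h
      have hq := (S.code_encode hN (g 0)).unique h
      generalize g 0 = g' at *
      obtain ⟨q, v⟩ := g'
      dsimp at hq
      subst hq
      unfold rootGate
      congr
      funext j
      exact isEmptyElim (S.rootEquiv.symm j)
    · intro h
      rw [h]
      exact S.code_encode hN (S.rootGate isEmptyElim)

/-- A universe with one element has only one tuple of each dimension, so there the interpreted
circuit has exactly one gate. This is why `N = 1` is split off in the formulas and in the family. -/
theorem family_uniform : FOUniform (S.family b) := by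
  have := S.finite_kind
  have := S.finite_index
  obtain ⟨D, ⟨e⟩⟩ := Finite.exists_equiv_fin S.Index
  choose φ hφ using fun a (r : CircRel a) =>
    (S.tupleRel_def b r).relabel (Prod.map (id : Fin a → Fin a) e)
  obtain ⟨ψ, hψ⟩ : NDef fun N (v : Fin D → ℕ) => N = 1 ∨ ∃ q, S.Code q fun i => v (e i) :=
    (NDef.card_eq 1).or (.exists_finite fun q => (Code.def S q).relabel e)
  let I : Interpretation stringLang circLang := ⟨D, ψ, fun {a} r => φ a r⟩
  refine ⟨I, fun N hN => ?_⟩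
  match N, hN with
  | 1, _ =>
    refine I.describes_of_bijection _ (fun _ _ => 0) (fun _ _ _ => rfl) (fun x t => ?_)
      fun x a r g => ?_
    · refine (hψ 1 Nat.one_pos x t).trans ?_
      simp only [true_or, true_iff]
      exact ⟨(), Subsingleton.elim _ _⟩
    · refine (hφ a r 1 Nat.one_pos x _).trans ?_
      cases r with
      | E => exact ⟨fun h => (h.1 rfl).elim, False.elim⟩
      | andGate =>
        refine ⟨fun h => (h.1 rfl).elim, fun h => ?_⟩
        have := singleLabel_isInput b
        rw [show singleLabel b = .and from h] at this
        exact this.elim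
      | orGate =>
        refine ⟨fun h => (h.1 rfl).elim, fun h => ?_⟩
        have := singleLabel_isInput b
        rw [show singleLabel b = .or from h] at this
        exact this.elim
      | B =>
        refine Iff.trans ?_ (singleLabel_isTrue b x).symm
        exact ⟨fun h => h.elim (fun h => h.2) fun h => (h.1 rfl).elim, fun h => .inl ⟨rfl, h⟩⟩
      | root => exact ⟨fun _ => rfl, fun _ => .inl rfl⟩
  | N + 2, _ =>
    have h2 : 2 ≤ N + 2 := by omega
    have he : ∀ g : S.Gate (N + 2), (fun i => S.encode h2 g (e.symm (e i))) = S.encode h2 g :=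
      fun g => funext fun i => by rw [e.symm_apply_apply]
    refine I.describes_of_bijection _ (fun g i => S.encode h2 g (e.symm i)) (fun g g' h => ?_)
      (fun x t => ?_) fun x a r g => ?_
    · refine S.encode_injective h2 ?_
      rw [← he g, ← he g']
      exact funext fun i => congrFun h (e i)
    · refine (hψ (N + 2) (by omega) x t).trans ?_
      constructor
      · rintro (h | ⟨q, h⟩)
        · omega
        · obtain ⟨g, hg⟩ := S.exists_encode h2 (t := fun i => t (e i)) h
          exact ⟨g, funext fun i =>
            (congrFun hg (e.symm i)).trans (congrArg t (e.apply_symm_apply i))⟩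
      · rintro ⟨g, rfl⟩
        refine .inr ⟨g.1, ?_⟩
        simp only [e.symm_apply_apply]
        exact S.code_encode h2 g
    · refine (hφ a r (N + 2) (by omega) x _).trans ?_
      simp only [Prod.map_fst, Prod.map_snd, id, e.symm_apply_apply]
      exact S.tupleRel_encode h2 b _ rfl x a r g

theorem family_size : ∃ p : Polynomial ℕ, ∀ N, (S.family b N).size ≤ p.eval N := by
  have := S.finite_kind
  have := S.finite_index
  have := Fintype.ofFinite S.Kind
  refine ⟨∑ q, Polynomial.X ^ Nat.card (S.J q) + 1, fun N => ?_⟩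
  match N with
  | 0 => exact (oneGateCircuit_size_le _).trans (by simp)
  | 1 => exact (oneGateCircuit_size_le _).trans (by simp)
  | N + 2 =>
    have := (S.family b (N + 2)).finite
    have h : (S.family b (N + 2)).size ≤ Nat.card (S.Gate (N + 2)) := Finite.card_subtype_le _
    refine h.trans ?_
    have : Nat.card (S.Gate (N + 2)) = ∑ q, (N + 2) ^ Nat.card (S.J q) := by
      refine (Nat.card_sigma (β := fun q => S.J q → Fin (N + 2))).trans ?_
      exact Finset.sum_congr rfl fun q _ => by rw [Nat.card_fun, Nat.card_fin]
    rw [this]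
    simp [Polynomial.eval_finsetSum]

theorem family_depthLE : (S.family b N).DepthLE (S.rank S.root) := by
  match N with
  | 0 => exact oneGateCircuit_depthLE _ _
  | 1 => exact oneGateCircuit_depthLE _ _
  | N + 2 => exact S.depthLE (S.rootGate isEmptyElim)

end Scheme

/-- Counting functions with a uniform description belong to FO-uniform `#AC⁰`. -/
theorem mem_FOUniformSharpAC0 {F : ∀ N : ℕ, (Fin N → Bool) → (Empty → Fin N) → ℕ}
    (hF : Realizable F) {f : Word → ℕ}
    (h : ∀ w : Word, 2 ≤ w.1.length → f w = F w.1.length w.1.get isEmptyElim)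
    (h1 : ∀ w : Word, w.1.length = 1 → f w ≤ 1) : f ∈ FOUniformSharpAC0 := by
  obtain ⟨S, hS⟩ := hF
  -- On strings of length 1 the function `f` takes only the values 0 and 1, so a single input gate
  -- that is true exactly where `f` is 1 counts correctly.
  let b : Bool → Bool := fun c => decide (f ⟨[c], by simp⟩ = 1)
  refine ⟨S.family b, S.family_uniform b, S.family_size b, ⟨_, fun N => S.family_depthLE b⟩, ?_⟩
  rintro ⟨w, hw⟩
  match w, hw with
  | [c], hw =>
    classical
    refine Eq.symm ((card_proofTree_input _ _ (singleLabel_isInput b)).trans ?_)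
    have : (singleLabel b).IsTrue [c].get ↔ f ⟨[c], hw⟩ = 1 := by
      rw [singleLabel_isTrue]
      simp [b]
    have h2 := h1 ⟨[c], hw⟩ rfl
    refine (if_congr this rfl rfl).trans ?_
    split_ifs <;> omega
  | c :: d :: w, hw => exact (h _ (by simp)).trans (hS _ _ _).symm

/-! ### The separating function has uniform circuits -/

theorem ceil_half (N : ℕ) : ⌈(N : ℚ) / 2⌉₊ = (N + 1) / 2 := by
  rcases Nat.even_or_odd' N with ⟨m, rfl | rfl⟩
  · have : ((2 * m : ℕ) : ℚ) / 2 = (m : ℕ) := by push_cast; ring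
    rw [this, Nat.ceil_natCast]
    omega
  · rw [Nat.ceil_eq_iff (by omega)]
    have : (2 * m + 1 + 1) / 2 = m + 1 := by omega
    rw [this]
    push_cast
    constructor <;> linarith

theorem card_even (N : ℕ) : (Finset.univ.filter fun i : Fin N => (i : ℕ) % 2 = 0).card =
    (N + 1) / 2 := by
  rw [Finset.card_filter, Fin.sum_univ_eq_sum_range (fun i => if i % 2 = 0 then 1 else 0)]
  induction N with
  | zero => rfl
  | succ N ih =>
    rw [Finset.sum_range_succ, ih]
    split_ifs <;> omega

theorem NDef.even {α : Type} (i : α) : NDef fun _ v => v i % 2 = 0 := by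
  refine (NDef.ex (R := fun N v z => z = 0 ∧ ¬ (v i).testBit z = true) ((NDef.const 0 none).and
    (NDef.bit none (some i)).not)).congr fun N hN v _ => ?_
  have : ¬ (v i).testBit 0 = true ↔ v i % 2 = 0 := by
    rw [Nat.testBit_zero, decide_eq_true_eq]
    omega
  rw [← this]
  exact ⟨by rintro ⟨z, -, rfl, h⟩; exact h, fun h => ⟨0, hN, rfl, h⟩⟩

/-- An and-gate ranges over the ⌈N / 2⌉ even positions, and below each of them an or-gate has `N`
true leaves. Evenness is read off from bit 0. -/
theorem pow_half_mem :
    (fun w : Word => w.1.length ^ ⌈(w.1.length : ℚ) / 2⌉₊) ∈ FOUniformSharpAC0 := by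
  have h1 : Realizable fun N _ (_ : Empty ⊕ Unit → Fin N) => N := by
    refine (Realizable.sum (Z := Unit) (β := fun _ => Unit) (R := fun _ _ _ => True)
      (fun _ => .trivial) fun _ => .one).congr fun N x v => ?_
    simp
  refine mem_FOUniformSharpAC0 (Realizable.prod (Z := Unit) (β := fun _ => Unit)
    (R := fun _ _ v => v (.inr ()) % 2 = 0) (fun _ => .even _) fun _ => h1) (fun w _ => ?_)
    fun w hw => ?_
  · dsimp only
    rw [ceil_half, ← card_even, Fintype.prod_unique, ← Finset.prod_const, Finset.prod_filter]
    exact Fintype.prod_equiv (Equiv.funUnique Unit (Fin w.1.length)).symm _ _ fun i => rfl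
  · simp [hw]

/-! ### Quantifier-free formulas -/

section subterms

variable {L : FirstOrder.Language.{0, 0}} {α : Type}

/-- The subterms of a term. -/
def subterms : L.Term α → Set (L.Term α)
  | .var a => {.var a}
  | .func f ts => insert (.func f ts) (⋃ i, subterms (ts i))

theorem mem_subterms_self (t : L.Term α) : t ∈ subterms t := by
  cases t with
  | var a => exact Set.mem_singleton _
  | func f ts => exact Set.mem_insert _ _

theorem finite_subterms (t : L.Term α) : (subterms t).Finite := by
  induction t with
  | var a => exact Set.finite_singleton _
  | func f ts ih => exact (Set.finite_iUnion ih).insert _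

theorem mem_subterms_of_func {n : ℕ} {f : L.Functions n} {ts : Fin n → L.Term α} {t : L.Term α}
    (h : .func f ts ∈ subterms t) (j : Fin n) : ts j ∈ subterms t := by
  induction t with
  | var a => cases h
  | func g us ih =>
    rcases h with h | h
    · cases h
      exact .inr (Set.mem_iUnion.2 ⟨j, mem_subterms_self _⟩)
    · obtain ⟨i, hi⟩ := Set.mem_iUnion.1 h
      exact .inr (Set.mem_iUnion.2 ⟨i, ih i hi⟩)

/-- A quantifier-free formula is a Boolean combination `G` of finitely many atoms, with the same `G`
for all structures and assignments. -/
theorem exists_atoms {n : ℕ} {φ : L.BoundedFormula α n} (h : φ.IsQF) :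
    ∃ (K : Type) (_ : Finite K) (at' : K → L.BoundedFormula α n) (G : (K → Prop) → Prop),
      (∀ k, (at' k).IsAtomic) ∧ ∀ (M : Type) [L.Structure M] (v : α → M) (xs : Fin n → M),
        φ.Realize v xs ↔ G fun k => (at' k).Realize v xs := by
  induction h with
  | falsum => exact ⟨Empty, inferInstance, isEmptyElim, fun _ => False, isEmptyElim, fun _ _ _ _ => Iff.rfl⟩
  | @of_isAtomic φ h => exact ⟨Unit, inferInstance, fun _ => φ, fun p => p (), fun _ => h,
    fun _ _ _ _ => Iff.rfl⟩
  | imp _ _ ih₁ ih₂ =>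
    obtain ⟨K₁, _, a₁, G₁, h₁, H₁⟩ := ih₁
    obtain ⟨K₂, _, a₂, G₂, h₂, H₂⟩ := ih₂
    refine ⟨K₁ ⊕ K₂, inferInstance, Sum.elim a₁ a₂,
      fun p => G₁ (fun k => p (.inl k)) → G₂ fun k => p (.inr k), ?_, fun M _ v xs => ?_⟩
    · rintro (k | k)
      · exact h₁ k
      · exact h₂ k
    · rw [BoundedFormula.realize_imp, H₁, H₂]
      rfl

end subterms

/-! ### Terms and atoms of a quantifier-free formula as finite systems of equations -/

section flat

variable {σ : Vocabulary} {k : ℕ} {b : Fin k → ℕ} {l : ℕ}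

/-- Terms whose arguments are given by an index set `τ`. -/
inductive Node (σ : Vocabulary) {k : ℕ} (b : Fin k → ℕ) (l : ℕ) (τ : Type) : Type
  | var (j : Fin l)
  | min
  | const (c : Fin σ.numConst)
  | app (i : Fin k) (args : Fin (b i) → τ)

/-- The value of a node that is determined by the values of all nodes. -/
def Node.value {τ : Type} {n : ℕ} [NeZero n] (A : FinStr σ n)
    (F : (i : Fin k) → (Fin (b i) → Fin n) → Fin n) (c : Fin l → Fin n) (y : τ → Fin n) :
    Node σ b l τ → Fin n
  | var j => c j
  | min => 0
  | const q => A.const q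
  | app i args => F i fun j => y (args j)

/-- Atomic formulas whose terms are given by an index set `τ`. -/
inductive FlatAtom (σ : Vocabulary) (τ : Type) : Type
  | eq (s t : τ)
  | le (s t : τ)
  | bit (s t : τ)
  | rel (i : Fin σ.numRel) (args : Fin (σ.relArity i) → τ)

/-- The truth of an atomic formula. -/
def FlatAtom.Holds {τ : Type} {n : ℕ} (A : FinStr σ n) (y : τ → Fin n) : FlatAtom σ τ → Prop
  | eq s t => y s = y t
  | le s t => y s ≤ y t
  | bit s t => (y t : ℕ).testBit (y s : ℕ) = true
  | rel i args => A.rel i (fun j => y (args j)) = true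

/-- Change of the index set. -/
def FlatAtom.map {τ τ' : Type} (g : τ → τ') : FlatAtom σ τ → FlatAtom σ τ'
  | eq s t => eq (g s) (g t)
  | le s t => le (g s) (g t)
  | bit s t => bit (g s) (g t)
  | rel i args => rel i fun j => g (args j)

/-- The terms of an atomic formula. -/
def FlatAtom.terms {τ : Type} : FlatAtom σ τ → Set τ
  | eq s t => {s, t}
  | le s t => {s, t}
  | bit s t => {s, t}
  | rel _ args => Set.range args

theorem FlatAtom.finite_terms {τ : Type} (a : FlatAtom σ τ) : a.terms.Finite := by
  cases a with
  | rel i args => exact Set.finite_range _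
  | _ => exact Set.toFinite {_, _}

theorem FlatAtom.holds_map {τ τ' : Type} (g : τ → τ') {n : ℕ} (A : FinStr σ n) (y : τ → Fin n)
    (y' : τ' → Fin n) (a : FlatAtom σ τ) (h : ∀ t ∈ a.terms, y' (g t) = y t) :
    (a.map g).Holds A y' ↔ a.Holds A y := by
  cases a with
  | rel i args =>
    have : (fun j => y' (g (args j))) = fun j => y (args j) :=
      funext fun j => h _ ⟨j, rfl⟩
    simp only [map, Holds, this]
  | _ s t =>
    have hs := h s (.inl rfl)
    have ht := h t (.inr rfl)
    simp only [map, Holds, hs, ht]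

/-- A quantifier-free formula in terms of its atomic formulas and their subterms. -/
structure Flat (φ : (countLang σ b).Formula (Fin l)) where
  τ : Type
  finite_τ : Finite τ
  node : τ → Node σ b l τ
  varNode : Fin l → τ
  node_varNode : ∀ j, node (varNode j) = .var j
  constNode : Fin σ.numConst → τ
  node_constNode : ∀ c, node (constNode c) = .const c
  K : Type
  finite_K : Finite K
  atom : K → FlatAtom σ τ
  G : (K → Prop) → Prop
  exists_valuation : ∀ (n : ℕ) [NeZero n] (A : FinStr σ n)
    (F : (i : Fin k) → (Fin (b i) → Fin n) → Fin n) (c : Fin l → Fin n),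
    ∃ y : τ → Fin n, (∀ t, y t = (node t).value A F c y) ∧
      (∀ y' : τ → Fin n, (∀ t, y' t = (node t).value A F c y') → y' = y) ∧
      (@Formula.Realize (countLang σ b) (Fin n) (A.toStructure F) (Fin l) φ c ↔
        G fun q => (atom q).Holds A y)

theorem exists_flatAtom {φ : (countLang σ b).BoundedFormula (Fin l) 0} (h : φ.IsAtomic) :
    ∃ a : FlatAtom σ ((countLang σ b).Term (Fin l ⊕ Fin 0)), ∀ (n : ℕ) [NeZero n] (A : FinStr σ n)
      (F : (i : Fin k) → (Fin (b i) → Fin n) → Fin n) (c : Fin l → Fin n) (xs : Fin 0 → Fin n),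
      letI := A.toStructure F
      φ.Realize c xs ↔ a.Holds A fun t => t.realize (Sum.elim c xs) := by
  cases h with
  | equal t₁ t₂ =>
    refine ⟨.eq t₁ t₂, fun n _ A F c xs => ?_⟩
    let _ := A.toStructure F
    exact BoundedFormula.realize_bdEqual _ _
  | rel R ts =>
    cases R with
    | le =>
      refine ⟨.le (ts 0) (ts 1), fun n _ A F c xs => ?_⟩
      let _ := A.toStructure F
      exact BoundedFormula.realize_rel
    | bit =>
      refine ⟨.bit (ts 0) (ts 1), fun n _ A F c xs => ?_⟩
      let _ := A.toStructure F
      exact BoundedFormula.realize_rel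
    | rel i =>
      refine ⟨.rel i ts, fun n _ A F c xs => ?_⟩
      let _ := A.toStructure F
      exact BoundedFormula.realize_rel

/-- The node of a function symbol with arguments, where `g` indexes terms. -/
def nodeOfFun {τ T : Type} (g : T → τ) : {n : ℕ} → CountFun σ b n → (Fin n → T) → Node σ b l τ
  | _, .min, _ => .min
  | _, .const c, _ => .const c
  | _, .var i, ts => .app i fun j => g (ts j)

/-- The top node of a term, where `g` indexes terms. -/
def nodeOf {τ : Type} (g : (countLang σ b).Term (Fin l ⊕ Fin 0) → τ) :
    (countLang σ b).Term (Fin l ⊕ Fin 0) → Node σ b l τ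
  | .var (.inl j) => .var j
  | .var (.inr j) => j.elim0
  | .func f ts => nodeOfFun g f ts

/-- The nodes are the terms in a finite set that is closed under subterms. The values of the terms
solve the system of node equations, and by induction on terms this is the only solution. -/
theorem nonempty_flat {φ : (countLang σ b).Formula (Fin l)} (h : BoundedFormula.IsQF φ) :
    Nonempty (Flat φ) := by
  classical
  obtain ⟨K, hK, at', G, hat, hG⟩ := exists_atoms h
  choose a ha using fun q => exists_flatAtom (hat q)
  let Tm := (countLang σ b).Term (Fin l ⊕ Fin 0)
  let min' : Tm := .func (CountFun.min : CountFun σ b 0) Fin.elim0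
  let const' : Fin σ.numConst → Tm := fun c => .func (CountFun.const c : CountFun σ b 0) Fin.elim0
  let var' : Fin l → Tm := fun j => .var (.inl j)
  -- Variables and constants are included even if they do not occur in `φ`: an assignment must be
  -- recoverable from the values of the nodes, and a guess must contain all the constants in order
  -- to check an encoding. The term `min'` is also the default value of `g`.
  let B : Set Tm := {min'} ∪ Set.range const' ∪ Set.range var' ∪ ⋃ q, (a q).terms
  have hB : B.Finite := by
    refine (((Set.finite_singleton _).union (Set.finite_range _)).union (Set.finite_range _)).union
      (Set.finite_iUnion fun q => (a q).finite_terms)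
  let T : Set Tm := ⋃ t ∈ B, subterms t
  have hT : T.Finite := hB.biUnion fun t _ => finite_subterms t
  have hBT : B ⊆ T := fun t ht => Set.mem_biUnion ht (mem_subterms_self t)
  have hcl : ∀ {n} (f : (countLang σ b).Functions n) (ts : Fin n → Tm), .func f ts ∈ T →
      ∀ j, ts j ∈ T := by
    intro n f ts hf j
    obtain ⟨t, ht, hf⟩ := Set.mem_iUnion₂.1 hf
    exact Set.mem_biUnion ht (mem_subterms_of_func hf j)
  have hmin : min' ∈ T := hBT (.inl (.inl (.inl rfl)))
  let g : Tm → T := fun t => if ht : t ∈ T then ⟨t, ht⟩ else ⟨min', hmin⟩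
  have hg : ∀ t ∈ T, (g t).1 = t := fun t ht => by simp [g, ht]
  have hvar : ∀ j, var' j ∈ T := fun j => hBT (.inl (.inr ⟨j, rfl⟩))
  have hconst : ∀ c, const' c ∈ T := fun c => hBT (.inl (.inl (.inr ⟨c, rfl⟩)))
  refine ⟨{
    τ := T
    finite_τ := hT
    node := fun t => nodeOf g t.1
    varNode := fun j => ⟨var' j, hvar j⟩
    node_varNode := fun j => rfl
    constNode := fun c => ⟨const' c, hconst c⟩
    node_constNode := fun c => rfl
    K := K
    finite_K := hK
    atom := fun q => (a q).map g
    G := G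
    exists_valuation := fun n _ A F c => ?_ }⟩
  let _ := A.toStructure F
  let val : Tm → Fin n := fun t => t.realize (Sum.elim c (default : Fin 0 → Fin n))
  refine ⟨fun t => val t.1, ?_, ?_, ?_⟩
  · rintro ⟨t, ht⟩
    rcases t with (j | j) | ⟨f, ts⟩
    · rfl
    · exact j.elim0
    · cases f with
      | min => rfl
      | const q => rfl
      | var i =>
        change F i (fun j => val (ts j)) = F i fun j => val (g (ts j)).1
        congr
        funext j
        rw [hg _ (hcl _ _ ht j)]
  · intro y' hy'
    have key : ∀ (t : Tm) (ht : t ∈ T), y' ⟨t, ht⟩ = val t := by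
      intro t
      induction t with
      | var j =>
        intro ht
        rcases j with j | j
        · exact hy' ⟨_, ht⟩
        · exact j.elim0
      | func f ts ih =>
        intro ht
        cases f with
        | min => exact hy' ⟨_, ht⟩
        | const q => exact hy' ⟨_, ht⟩
        | var i =>
          refine (hy' ⟨_, ht⟩).trans ?_
          change F i (fun j => y' (g (ts j))) = F i fun j => val (ts j)
          congr
          funext j
          have hj := hcl _ _ ht j
          rw [← ih j hj, show g (ts j) = ⟨ts j, hj⟩ from Subtype.ext (hg _ hj)]
    exact funext fun t => key t.1 t.2
  · refine (iff_of_eq (congrArg (BoundedFormula.Realize φ c) (Subsingleton.elim _ _))).trans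
      ((hG (Fin n) c default).trans ?_)
    refine iff_of_eq (congrArg G (funext fun q => propext ?_))
    refine (ha q n A F c default).trans (FlatAtom.holds_map g A val _ (a q) fun t ht => ?_).symm
    exact congrArg val (hg t (hBT (.inr (Set.mem_iUnion.2 ⟨q, ht⟩))))

end flat

/-! ### Encodings of structures -/

section flatMap

variable {β : Type}

theorem length_flatMap_finRange {m : ℕ} (f : Fin m → List β) :
    ((List.finRange m).flatMap f).length = ∑ i, (f i).length := by
  rw [List.length_flatMap, ← Fin.sum_ofFn, List.ofFn_eq_map]

theorem getElem?_flatMap_finRange {m : ℕ} (f : Fin m → List β) (i : Fin m) (j : ℕ)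
    (hj : j < (f i).length) :
    ((List.finRange m).flatMap f)[∑ i' : Fin (i : ℕ), (f (Fin.castLE i.2.le i')).length + j]? =
      (f i)[j]? := by
  induction m with
  | zero => exact i.elim0
  | succ m ih =>
    rw [List.finRange_succ, List.flatMap_cons, List.flatMap_map]
    cases i using Fin.cases with
    | zero =>
      change (f 0 ++ _)[∑ i' : Fin 0, (f (Fin.castLE (Nat.zero_le _) i')).length + j]? = _
      rw [Finset.univ_eq_empty, Finset.sum_empty, zero_add, List.getElem?_append_left hj]
    | succ i =>
      have : ∑ i' : Fin (i.succ : ℕ), (f (Fin.castLE i.succ.2.le i')).length =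
          (f 0).length + ∑ i' : Fin (i : ℕ), (f (Fin.castLE i.2.le i').succ).length :=
        Fin.sum_univ_succ (n := (i : ℕ)) fun i' => (f (Fin.castLE i.succ.2.le i')).length
      rw [this, add_assoc, List.getElem?_append_right (by omega), Nat.add_sub_cancel_left]
      exact ih (fun i => f i.succ) i hj

theorem exists_block {m : ℕ} (len : Fin m → ℕ) {p : ℕ} (hp : p < ∑ i, len i) :
    ∃ (i : Fin m) (j : ℕ), j < len i ∧ p = ∑ i' : Fin (i : ℕ), len (Fin.castLE i.2.le i') + j := by
  obtain ⟨⟨i, j⟩, h⟩ := (finSigmaFinEquiv (n := len)).surjective ⟨p, hp⟩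
  refine ⟨i, j, j.2, ?_⟩
  have := congrArg Fin.val h
  rw [finSigmaFinEquiv_apply] at this
  exact this.symm

end flatMap

section enc

variable {σ : Vocabulary} {n : ℕ}

open Classical in
/-- The length of the additional always false relation. -/
noncomputable def padLen (σ : Vocabulary) (n : ℕ) : ℕ := if ∃ i, 0 < σ.relArity i then 0 else n

/-- The total length of the truth tables. -/
def relLen (σ : Vocabulary) (n : ℕ) : ℕ := ∑ i, n ^ σ.relArity i

/-- The length of the encodings of structures with `n` elements. -/
noncomputable def encLen (σ : Vocabulary) (n : ℕ) : ℕ :=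
  padLen σ n + relLen σ n + σ.numConst * Nat.clog 2 n

/-- The position of the truth value of the `i`-th relation for the tuple `a`. -/
noncomputable def relPos (σ : Vocabulary) (n : ℕ) (i : Fin σ.numRel) (a : Fin (σ.relArity i) → ℕ) :
    ℕ :=
  padLen σ n + (∑ i' : Fin (i : ℕ), n ^ σ.relArity (Fin.castLE i.2.le i') +
    ∑ j : Fin (σ.relArity i), a j.rev * n ^ (j : ℕ))

/-- The position of the `j`-th bit of the `c`-th constant. -/
noncomputable def constPos (σ : Vocabulary) (n : ℕ) (c : Fin σ.numConst) (j : ℕ) : ℕ :=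
  padLen σ n + relLen σ n + ((c : ℕ) * Nat.clog 2 n + j)

namespace FinStr

variable (A : FinStr σ n)

theorem enc_eq : A.enc = List.replicate (padLen σ n) false ++
    (List.finRange σ.numRel).flatMap A.relBits ++
      (List.finRange σ.numConst).flatMap A.constBits := by
  unfold enc padLen
  congr 2
  split_ifs <;> rfl

theorem length_relBits (i : Fin σ.numRel) : (A.relBits i).length = n ^ σ.relArity i :=
  List.length_ofFn

theorem length_constBits (c : Fin σ.numConst) : (A.constBits c).length = Nat.clog 2 n :=
  List.length_ofFn

theorem length_rels : ((List.finRange σ.numRel).flatMap A.relBits).length = relLen σ n := by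
  simp only [length_flatMap_finRange, length_relBits, relLen]

theorem length_consts : ((List.finRange σ.numConst).flatMap A.constBits).length =
    σ.numConst * Nat.clog 2 n := by
  simp only [length_flatMap_finRange, length_constBits, Finset.sum_const, Finset.card_univ,
    Fintype.card_fin, smul_eq_mul]

theorem length_enc : A.enc.length = encLen σ n := by
  rw [enc_eq, List.length_append, List.length_append, length_rels, length_consts,
    List.length_replicate, encLen]

theorem enc_pad {j : ℕ} (hj : j < padLen σ n) : A.enc[j]? = some false := by
  rw [enc_eq, List.append_assoc, List.getElem?_append_left (by simpa using hj)]
  simp [hj]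

theorem enc_rel (i : Fin σ.numRel) (a : Fin (σ.relArity i) → Fin n) :
    A.enc[relPos σ n i fun j => a j]? = some (A.rel i a) := by
  let p : Fin (n ^ σ.relArity i) := finFunctionFinEquiv fun j => a j.rev
  have hp : (p : ℕ) = ∑ j : Fin (σ.relArity i), (a j.rev : ℕ) * n ^ (j : ℕ) :=
    finFunctionFinEquiv_apply _
  have hlen : (p : ℕ) < (A.relBits i).length := by
    rw [length_relBits]
    exact p.2
  have hget := getElem?_flatMap_finRange A.relBits i p hlen
  simp only [length_relBits] at hget
  have hval : (A.relBits i)[(p : ℕ)]? = some (A.rel i a) := by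
    rw [List.getElem?_eq_getElem hlen]
    simp only [relBits, List.getElem_ofFn, Fin.eta, p, Equiv.symm_apply_apply, Fin.rev_rev]
  rw [hval] at hget
  have hlt : ∑ i' : Fin (i : ℕ), n ^ σ.relArity (Fin.castLE i.2.le i') + (p : ℕ) <
      ((List.finRange σ.numRel).flatMap A.relBits).length := by
    by_contra h
    rw [List.getElem?_eq_none (not_lt.1 h)] at hget
    cases hget
  rw [enc_eq, relPos, ← hp, List.append_assoc, List.getElem?_append_right (by simp),
    List.length_replicate, Nat.add_sub_cancel_left, List.getElem?_append_left hlt, hget]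

theorem enc_const (c : Fin σ.numConst) {j : ℕ} (hj : j < Nat.clog 2 n) :
    A.enc[constPos σ n c j]? = some ((A.const c : ℕ).testBit (Nat.clog 2 n - (j + 1))) := by
  have hlen : j < (A.constBits c).length := by rwa [length_constBits]
  have hget := getElem?_flatMap_finRange A.constBits c j hlen
  simp only [length_constBits, Finset.sum_const, Finset.card_univ, Fintype.card_fin,
    smul_eq_mul] at hget
  rw [enc_eq, constPos, List.getElem?_append_right (by
      rw [List.length_append, length_rels, List.length_replicate]
      omega), List.length_append,
    length_rels, List.length_replicate, Nat.add_sub_cancel_left, hget,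
    List.getElem?_eq_getElem hlen]
  simp only [constBits, List.getElem_ofFn, Fin.val_rev]

/-- Every position lies in the padding, in exactly one truth table, or in exactly one constant, so
correct bits at the named positions together with the length determine the string. -/
theorem eq_enc {w : List Bool} (hlen : w.length = encLen σ n)
    (hpad : ∀ j < padLen σ n, w[j]? = some false)
    (hrel : ∀ i (a : Fin (σ.relArity i) → Fin n),
      w[relPos σ n i fun j => a j]? = some (A.rel i a))
    (hconst : ∀ (c : Fin σ.numConst), ∀ j < Nat.clog 2 n,
      w[constPos σ n c j]? = some ((A.const c : ℕ).testBit (Nat.clog 2 n - (j + 1)))) :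
    w = A.enc := by
  refine List.ext_getElem? fun p => ?_
  rcases lt_or_ge p (padLen σ n) with h1 | h1
  · rw [hpad p h1, A.enc_pad h1]
  obtain ⟨p, rfl⟩ := Nat.exists_eq_add_of_le h1
  rcases lt_or_ge p (relLen σ n) with h2 | h2
  · obtain ⟨i, j, hj, rfl⟩ := exists_block (fun i => n ^ σ.relArity i) h2
    let a : Fin (σ.relArity i) → Fin n := fun q => finFunctionFinEquiv.symm ⟨j, hj⟩ q.rev
    have ha : finFunctionFinEquiv (fun q => a q.rev) = ⟨j, hj⟩ := by
      simp only [a, Fin.rev_rev]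
      exact Equiv.apply_symm_apply _ _
    have hpos : relPos σ n i (fun q => a q) = padLen σ n +
        (∑ i' : Fin (i : ℕ), n ^ σ.relArity (Fin.castLE i.2.le i') + j) := by
      have h := congrArg Fin.val ha
      rw [finFunctionFinEquiv_apply] at h
      rw [relPos, h]
    rw [← hpos, hrel, A.enc_rel]
  obtain ⟨p, rfl⟩ := Nat.exists_eq_add_of_le h2
  rcases lt_or_ge p (σ.numConst * Nat.clog 2 n) with h3 | h3
  · obtain ⟨c, j, hj, rfl⟩ := exists_block (fun _ : Fin σ.numConst => Nat.clog 2 n) (p := p)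
      (by simpa using h3)
    have hpos : padLen σ n + (relLen σ n + (∑ _i' : Fin (c : ℕ), Nat.clog 2 n + j)) =
        constPos σ n c j := by
      simp [constPos, add_assoc]
    rw [hpos, hconst c j hj, A.enc_const c hj]
  · rw [List.getElem?_eq_none, List.getElem?_eq_none]
    · rw [length_enc, encLen]
      omega
    · rw [hlen, encLen]
      omega

end FinStr

/-- Either a relation of positive arity has a truth table with at least `n` entries, or the
additional unary relation contributes `n` bits. -/
theorem le_encLen (σ : Vocabulary) (n : ℕ) : n ≤ encLen σ n := by
  unfold encLen padLen relLen
  split_ifs with h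
  · obtain ⟨i, hi⟩ := h
    have h1 : n ≤ n ^ σ.relArity i := Nat.le_self_pow hi.ne' n
    have h2 : n ^ σ.relArity i ≤ ∑ i, n ^ σ.relArity i :=
      Finset.single_le_sum (f := fun i => n ^ σ.relArity i) (fun _ _ => Nat.zero_le _)
        (Finset.mem_univ i)
    omega
  · omega

theorem encLen_lt (σ : Vocabulary) {n m : ℕ} (h : n < m) :
    encLen σ n < encLen σ m := by
  have h1 : ∀ i, n ^ σ.relArity i ≤ m ^ σ.relArity i := fun i => Nat.pow_le_pow_left h.le _
  have h2 : Nat.clog 2 n ≤ Nat.clog 2 m := Nat.clog_mono_right 2 h.le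
  have h3 := Nat.mul_le_mul_left σ.numConst h2
  unfold encLen padLen relLen
  split_ifs with hi
  · obtain ⟨i, hi⟩ := hi
    have : ∑ i, n ^ σ.relArity i < ∑ i, m ^ σ.relArity i :=
      Finset.sum_lt_sum (fun i _ => h1 i) ⟨i, Finset.mem_univ i, Nat.pow_lt_pow_left h hi.ne'⟩
    omega
  · have : ∑ i, n ^ σ.relArity i ≤ ∑ i, m ^ σ.relArity i := Finset.sum_le_sum fun i _ => h1 i
    omega

/-- The length of an encoding determines the size of the structure; thus a guess of the size can be
checked against `N` alone. -/
theorem encLen_injective (σ : Vocabulary) {n m : ℕ} (h : encLen σ n = encLen σ m) : n = m := by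
  rcases lt_trichotomy n m with h' | h' | h'
  · exact absurd h (encLen_lt σ h').ne
  · exact h'
  · exact absurd h (encLen_lt σ h').ne'

end enc

/-! ### The separating function is not in `#Σ₀` -/

section

variable {σ : Vocabulary} {k : ℕ} {b : Fin k → ℕ} {l : ℕ}

theorem card_functions (b : Fin k → ℕ) (n : ℕ) :
    Nat.card ((i : Fin k) → (Fin (b i) → Fin n) → Fin n) = n ^ ∑ i, n ^ b i := by
  rw [Nat.card_pi, ← Finset.prod_pow_eq_pow_sum]
  refine Finset.prod_congr rfl fun i _ => ?_
  simp

theorem countAssignments_le (φ : (countLang σ b).Formula (Fin l)) {n : ℕ} [NeZero n]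
    (A : FinStr σ n) : countAssignments φ A ≤ n ^ (∑ i, n ^ b i + l) := by
  refine (Finite.card_subtype_le _).trans (le_of_eq ?_)
  rw [Nat.card_prod, card_functions, Nat.card_fun, Nat.card_fin, Nat.card_fin, pow_add]

/-- If there is a satisfying assignment, then there are many, as the truth of a quantifier-free
formula depends on a bounded number of values of the functions. -/
theorem le_countAssignments {φ : (countLang σ b).Formula (Fin l)} (S : Flat φ) {n : ℕ} [NeZero n]
    (A : FinStr σ n) (h : countAssignments φ A ≠ 0) :
    n ^ ∑ i, n ^ b i ≤ countAssignments φ A * n ^ Nat.card S.τ := by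
  classical
  have := S.finite_τ
  have : Nonempty {p : ((i : Fin k) → (Fin (b i) → Fin n) → Fin n) × (Fin l → Fin n) //
      @Formula.Realize (countLang σ b) (Fin n) (A.toStructure p.1) (Fin l) φ p.2} := by
    by_contra hne
    rw [not_nonempty_iff] at hne
    exact h Nat.card_of_isEmpty
  obtain ⟨⟨⟨F₀, c₀⟩, h₀⟩⟩ := this
  obtain ⟨y, hy, -, hφ⟩ := S.exists_valuation n A F₀ c₀
  -- `P` marks the function values that are queried when `φ` is evaluated under the satisfying
  -- assignment `F₀`, `c₀`. Any `F` changed to agree with `F₀` there still satisfies `φ`.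
  let P : (i : Fin k) → (Fin (b i) → Fin n) → Prop := fun i a =>
    ∃ t args, S.node t = .app i args ∧ (fun j => y (args j)) = a
  let patch : ((i : Fin k) → (Fin (b i) → Fin n) → Fin n) →
    ((i : Fin k) → (Fin (b i) → Fin n) → Fin n) := fun F i a => if P i a then F₀ i a else F i a
  have hpatch : ∀ F, @Formula.Realize (countLang σ b) (Fin n) (A.toStructure (patch F)) (Fin l)
      φ c₀ := by
    intro F
    obtain ⟨y', -, hy', hφ'⟩ := S.exists_valuation n A (patch F) c₀
    have hyy' : y = y' := by
      refine hy' y fun t => (hy t).trans ?_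
      cases ht : S.node t with
      | app i args => exact (if_pos ⟨t, args, ht, rfl⟩).symm
      | _ => rfl
    rw [hφ', ← hyy']
    exact hφ.1 h₀
  -- The values overwritten by `patch` are recorded at the nodes that query them, so `patch F` and
  -- `query F` together determine `F`.
  let query : ((i : Fin k) → (Fin (b i) → Fin n) → Fin n) → S.τ → Fin n := fun F t =>
    (S.node t).value A F c₀ y
  have hτ : n ^ Nat.card S.τ = Nat.card (S.τ → Fin n) := by rw [Nat.card_fun, Nat.card_fin]
  rw [← card_functions, hτ, countAssignments, ← Nat.card_prod]
  refine Nat.card_le_card_of_injective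
    (fun F => (⟨(patch F, c₀), hpatch F⟩, query F)) fun F F' hFF' => ?_
  have h1 : patch F = patch F' := congrArg (fun p => p.1.1.1) hFF'
  have h2 : query F = query F' := congrArg (fun p => p.2) hFF'
  funext i a
  by_cases hP : P i a
  · obtain ⟨t, args, ht, rfl⟩ := hP
    have := congrFun h2 t
    simpa only [query, ht, Node.value] using this
  · have := congrFun (congrFun h1 i) a
    simpa only [patch, if_neg hP] using this

/-- The growth rate n ^ ⌈n / 2⌉ lies in a gap: function variables of positive arity force n ^ (n -
c), their absence gives only a fixed power of n. -/
theorem pow_half_not_mem :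
    (fun w : Word => w.1.length ^ ⌈(w.1.length : ℚ) / 2⌉₊) ∉ SharpSigma0 := by
  rintro ⟨σ, k, b, l, φ, hφ, hcount, hzero⟩
  have hex : ∀ w : Word, ∃ n, ∃ _ : NeZero n, ∃ A : FinStr σ n, w.1 = A.enc := by
    intro w
    by_contra hne
    have hpos : 0 < w.1.length := List.length_pos_iff.2 w.2
    have := hzero w fun n _ A h => hne ⟨n, ‹_›, A, h⟩
    exact (pow_pos hpos _).ne' this
  have hword : ∀ N, 0 < N → ∃ w : Word, w.1.length = N := fun N hN =>
    ⟨⟨List.replicate N false, by simp; omega⟩, by simp⟩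
  -- Some `n ≤ N` has `encLen σ n = N`, because strings of length `N` encode structures. If `n < N`,
  -- the induction hypothesis gives `encLen σ n = n`, a contradiction.
  have hlen : ∀ N, 0 < N → encLen σ N = N := by
    intro N
    induction N using Nat.strong_induction_on with
    | _ N ih =>
      intro hN
      obtain ⟨w, hw⟩ := hword N hN
      obtain ⟨n, _, A, hA⟩ := hex w
      rw [hA, A.length_enc] at hw
      have := le_encLen σ n
      rcases (this.trans hw.le).lt_or_eq with h | h
      · have := ih n h (NeZero.pos n)
        omega
      · rwa [h] at hw
  obtain ⟨S⟩ := nonempty_flat hφ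
  have key : ∀ n, 0 < n → n ^ ((n + 1) / 2) ≤ n ^ (∑ i, n ^ b i + l) ∧
      n ^ ∑ i, n ^ b i ≤ n ^ ((n + 1) / 2) * n ^ Nat.card S.τ := by
    intro n hn
    obtain ⟨w, hw⟩ := hword n hn
    obtain ⟨m, _, A, hA⟩ := hex w
    have hm : m = n := by
      rw [← hlen m (NeZero.pos m), ← A.length_enc, ← hA, hw]
    subst hm
    have hc := hcount m A w hA
    dsimp only at hc
    rw [hw, ceil_half] at hc
    rw [hc]
    exact ⟨countAssignments_le φ A, le_countAssignments S A
      (by rw [← hc]; exact (pow_pos hn _).ne')⟩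
  by_cases hb : ∃ i, 0 < b i
  · obtain ⟨i, hi⟩ := hb
    -- Chosen so that n exceeds (n + 1) / 2 + |τ|, while the exponents give n ≤ ∑ n ^ b i ≤ (n + 1)
    -- / 2 + |τ|.
    obtain ⟨n, hn⟩ : ∃ n, n = 2 * Nat.card S.τ + 4 := ⟨_, rfl⟩
    have h1 := (key n (by omega)).2
    rw [← pow_add, Nat.pow_le_pow_iff_right (by omega)] at h1
    have h2 : n ≤ n ^ b i := Nat.le_self_pow hi.ne' n
    have h3 : n ^ b i ≤ ∑ i, n ^ b i :=
      Finset.single_le_sum (f := fun i => n ^ b i) (fun _ _ => Nat.zero_le _) (Finset.mem_univ i)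
    omega
  · have hb0 : ∀ i, b i = 0 := fun i => by
      by_contra h
      exact hb ⟨i, Nat.pos_of_ne_zero h⟩
    -- Here (n + 1) / 2 = k + l + 1, one more than the exponent k + l of the upper bound.
    obtain ⟨n, hn⟩ : ∃ n, n = 2 * (k + l) + 2 := ⟨_, rfl⟩
    have h1 := (key n (by omega)).1
    rw [Nat.pow_le_pow_iff_right (by omega)] at h1
    simp only [hb0, pow_zero, Finset.sum_const, Finset.card_univ, Fintype.card_fin, smul_eq_mul,
      mul_one] at h1
    omega

end

/-! ### Uniform circuits for counting functions of quantifier-free formulas -/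

theorem Realizable.mul {α : Type} [Finite α]
    {F G : ∀ N : ℕ, (Fin N → Bool) → (α → Fin N) → ℕ} (hF : Realizable F) (hG : Realizable G) :
    Realizable fun N x v => F N x v * G N x v :=
  (Realizable.prod_finite (F := fun c : Bool => if c then F else G) fun c => by
    cases c
    · exact hG
    · exact hF).congr fun N x v => by simp

section positions

variable {α : Type} {m : ℕ → (α → ℕ) → ℕ}

theorem PolyFn.padLen (σ : Vocabulary) (hm : PolyFn m) : PolyFn fun N v => padLen σ (m N v) := by
  unfold CountAC.padLen
  split_ifs
  · exact .zero
  · exact hm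

theorem PolyFn.relLen (σ : Vocabulary) (hm : PolyFn m) : PolyFn fun N v => relLen σ (m N v) :=
  .sum _ fun _ => hm.pow _

theorem PolyFn.relPos (σ : Vocabulary) (hm : PolyFn m) (i : Fin σ.numRel)
    (a : Fin (σ.relArity i) → α) : PolyFn fun N v => relPos σ (m N v) i fun j => v (a j) :=
  (hm.padLen σ).add (.add (.sum _ fun _ => hm.pow _) (.sum _ fun _ => .mul (.var _) (hm.pow _)))

end positions

namespace Flat

variable {σ : Vocabulary} {k : ℕ} {b : Fin k → ℕ} {l : ℕ} {φ : (countLang σ b).Formula (Fin l)}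
  (S : Flat φ)

instance : Finite S.τ := S.finite_τ

instance : Finite S.K := S.finite_K

/-- The index set of a guess: the values of all terms, the greatest element of the structure, and
the length of the encodings of elements. -/
abbrev Ix : Type := S.τ ⊕ Fin 2

/-- The value of a term is compatible with the other values, for terms that are not applications
of free function variables. -/
def NodeOK {τ : Type} (varNode : Fin l → τ) (constNode : Fin σ.numConst → τ) (w : τ → ℕ) (t : τ) :
    Node σ b l τ → Prop
  | .var j => w t = w (varNode j)
  | .min => w t = 0
  | .const c => w t = w (constNode c)
  | .app _ _ => True

/-- The guessed truth value of an atomic formula without relations of the vocabulary is correct. -/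
def AtomOK {τ : Type} (w : τ → ℕ) (z : Bool) : FlatAtom σ τ → Prop
  | .eq s t => w s = w t ↔ z = true
  | .le s t => w s ≤ w t ↔ z = true
  | .bit s t => (w t).testBit (w s) = true ↔ z = true
  | .rel _ _ => True

/-- The conditions on a guess that do not depend on the input bits. -/
def Guess (N : ℕ) (z : S.K → Bool) (w : S.Ix → ℕ) : Prop :=
  N = encLen σ (w (.inr 0) + 1) ∧ w (.inr 1) = Nat.clog 2 (w (.inr 0) + 1) ∧
    (∀ t, w (.inl t) ≤ w (.inr 0)) ∧
    (∀ t, NodeOK S.varNode S.constNode (fun t => w (.inl t)) t (S.node t)) ∧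
    (S.G fun q => z q = true) ∧ ∀ q, AtomOK (fun t => w (.inl t)) (z q) (S.atom q)

/-- The guess requires that the input bit at the position `p` is `c`. -/
def Lit (N : ℕ) (z : S.K → Bool) (c : Bool) (w : S.Ix → ℕ) (p : ℕ) : Prop :=
  (c = false ∧ p < padLen σ (w (.inr 0) + 1)) ∨
  (∃ q, z q = c ∧ ∃ i args, S.atom q = .rel i args ∧
    p = relPos σ (w (.inr 0) + 1) i fun j => w (.inl (args j))) ∨
  ∃ d : Fin σ.numConst, ∃ j < N, ∃ j' < N, j' + j + 1 = w (.inr 1) ∧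
    ((w (.inl (S.constNode d))).testBit j' = true ↔ c = true) ∧
    p = padLen σ (w (.inr 0) + 1) + relLen σ (w (.inr 0) + 1) + (d * w (.inr 1) + j)

/-- The element `v` is a possible value of the function `i` for the tuple `a`. -/
def Value (i : Fin k) (w : S.Ix → ℕ) (a : Fin (b i) → ℕ) (v : ℕ) : Prop :=
  v ≤ w (.inr 0) ∧ ∀ t, ∀ args, S.node t = .app i args → (∀ j, w (.inl (args j)) = a j) →
    v = w (.inl t)

/-- The length of an encoding involves a logarithm. As the logarithm is guessed too and checked by
`NDef.clog`, the condition on `N` becomes a polynomial equation. -/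
theorem guess_def (z : S.K → Bool) : NDef fun N w => S.Guess N z w := by
  have hn : PolyFn fun _ (w : S.Ix → ℕ) => w (.inr 0) + 1 := .add (.var _) .one
  have hpad : PolyFn fun _ (w : S.Ix → ℕ) =>
      padLen σ (w (.inr 0) + 1) + relLen σ (w (.inr 0) + 1) + σ.numConst * w (.inr 1) :=
    .add ((hn.padLen σ).add (hn.relLen σ)) (.mul (.const _) (.var _))
  refine NDef.congr (R := fun N w => N = padLen σ (w (.inr 0) + 1) + relLen σ (w (.inr 0) + 1) +
    σ.numConst * w (.inr 1) ∧ w (.inr 1) = Nat.clog 2 (w (.inr 0) + 1) ∧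
    (∀ t, w (.inl t) ≤ w (.inr 0)) ∧
    (∀ t, NodeOK S.varNode S.constNode (fun t => w (.inl t)) t (S.node t)) ∧
    (S.G fun q => z q = true) ∧ ∀ q, AtomOK (fun t => w (.inl t)) (z q) (S.atom q))
    ((NDef.poly_eq .card hpad).and ((NDef.clog _ _).and ((NDef.forall_finite fun t => .le _ _).and
      ((NDef.forall_finite fun t => ?_).and ((NDef.prop _).and (NDef.forall_finite fun q => ?_))))))
    fun N _ w _ => ?_
  · cases S.node t with
    | var j => exact .eq _ _
    | min => exact .const _ _
    | const c => exact .eq _ _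
    | app i args => exact .trivial
  · cases S.atom q with
    | eq s t => exact .iff (.eq _ _) (.prop _)
    | le s t => exact .iff (.le _ _) (.prop _)
    | bit s t => exact .iff (.bit _ _) (.prop _)
    | rel i args => exact .trivial
  · unfold Guess encLen
    constructor
    · rintro ⟨h1, h2, h3⟩
      exact ⟨by rw [h1, h2], h2, h3⟩
    · rintro ⟨h1, h2, h3⟩
      exact ⟨by rw [h2]; exact h1, h2, h3⟩

/-- Positions in the encoding are polynomials in the guessed size, the guessed logarithm and the
values of the terms, so `NDef.poly_eq` applies. -/
theorem lit_def (z : S.K → Bool) (c : Bool) : NDef fun N (v : S.Ix ⊕ Unit → ℕ) =>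
    S.Lit N z c (fun i => v (.inl i)) (v (.inr ())) := by
  have hn : ∀ {γ : Type} (i : γ), PolyFn fun _ (w : γ → ℕ) => w i + 1 := fun i =>
    .add (.var _) .one
  have hconst : ∀ d : Fin σ.numConst, NDef fun N (v : S.Ix ⊕ Unit → ℕ) => ∃ j < N, ∃ j' < N,
      j' + j + 1 = v (.inl (.inr 1)) ∧
      ((v (.inl (.inl (S.constNode d)))).testBit j' = true ↔ c = true) ∧ v (.inr ()) =
        padLen σ (v (.inl (.inr 0)) + 1) + relLen σ (v (.inl (.inr 0)) + 1) +
          (d * v (.inl (.inr 1)) + j) := by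
    intro d
    let ι : S.Ix ⊕ Unit → Option (Option (S.Ix ⊕ Unit)) := fun i => some (some i)
    have h1 : NDef fun _ (v : Option (Option (S.Ix ⊕ Unit)) → ℕ) =>
        v none + v (some none) + 1 = v (ι (.inl (.inr 1))) :=
      .poly_eq (.add (.add (.var _) (.var _)) .one) (.var _)
    have h2 : NDef fun _ (v : Option (Option (S.Ix ⊕ Unit)) → ℕ) =>
        (v (ι (.inl (.inl (S.constNode d))))).testBit (v none) = true ↔ c = true :=
      .iff (.bit _ _) (.prop _)
    have h3 : NDef fun _ (v : Option (Option (S.Ix ⊕ Unit)) → ℕ) => v (ι (.inr ())) =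
        padLen σ (v (ι (.inl (.inr 0))) + 1) + relLen σ (v (ι (.inl (.inr 0))) + 1) +
          (d * v (ι (.inl (.inr 1))) + v (some none)) :=
      .poly_eq (.var _) (.add (.add ((hn _).padLen σ) ((hn _).relLen σ))
        (.add (.mul (.const _) (.var _)) (.var _)))
    exact (h1.and (h2.and h3)).ex.ex
  refine .or (.and (.prop _) ?_) (.or (.exists_finite fun q => .and (.prop _) ?_)
    (.exists_finite hconst))
  · unfold padLen
    split_ifs
    · exact NDef.falsum.congr fun _ _ _ _ => by simp
    · exact (NDef.le _ _).congr fun _ _ _ _ => Nat.lt_succ_iff.symm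
  · cases h : S.atom q with
    | rel i args =>
      refine (NDef.poly_eq (.var (.inr ())) ((hn (.inl (.inr 0))).relPos σ i
        fun j => .inl (.inl (args j)))).congr fun N _ v _ => ?_
      constructor
      · exact fun h => ⟨i, args, rfl, h⟩
      · rintro ⟨i', args', h, h'⟩
        cases h
        exact h'
    | _ => exact NDef.falsum.congr fun _ _ _ _ => by simp

theorem value_def (i : Fin k) : NDef fun _ (v : (S.Ix ⊕ Fin (b i)) ⊕ Unit → ℕ) =>
    S.Value i (fun i => v (.inl (.inl i))) (fun j => v (.inl (.inr j))) (v (.inr ())) := by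
  refine .and (.le _ _) (.forall_finite fun t => ?_)
  cases h : S.node t with
  | app i' args =>
    by_cases hi : i' = i
    · subst hi
      refine NDef.congr (.imp (.forall_finite fun j => .eq (.inl (.inl (.inl (args j))))
        (.inl (.inr j))) (.eq (.inr ()) (.inl (.inl (.inl t))))) fun N _ v _ => ?_
      constructor
      · intro h args' h'
        cases h'
        exact h
      · exact fun h => h args rfl
    · refine NDef.trivial.congr fun N _ v _ => ⟨fun _ args' h' => ?_, fun _ => trivial⟩
      cases h'
      exact (hi rfl).elim
  | _ => exact NDef.trivial.congr fun _ _ _ _ => by simp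

open Classical in
/-- The number of ways to complete a guess. -/
noncomputable def body (N : ℕ) (x : Fin N → Bool) (z : S.K → Bool) (w : S.Ix → Fin N) : ℕ :=
  (∏ c : Bool, ∏ p : Unit → Fin N, if S.Lit N z c (fun i => w i) (p ()) then
    if x (p ()) = c then 1 else 0 else 1) *
  ∏ i : Fin k, ∏ a : Fin (b i) → Fin N, if ∀ j, (a j : ℕ) ≤ w (.inr 0) then
    ∑ _ : Unit, ∑ v : Unit → Fin N, if S.Value i (fun i => w i) (fun j => a j) (v ()) then 1 else 0
    else 1

open Classical in
theorem literals_realizable (z : S.K → Bool) : Realizable fun N x (v : Empty ⊕ S.Ix → Fin N) =>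
    ∏ c : Bool, ∏ p : Unit → Fin N, if S.Lit N z c (fun i => v (.inr i)) (p ()) then
      if x (p ()) = c then 1 else 0 else 1 := by
  have h : ∀ c, NDef fun N (v : (Empty ⊕ S.Ix) ⊕ Unit → ℕ) =>
      S.Lit N z c (fun i => v (.inl (.inr i))) (v (.inr ())) := fun c =>
    (S.lit_def z c).relabel (β := (Empty ⊕ S.Ix) ⊕ Unit) (Sum.map Sum.inr id)
  exact Realizable.prod (Z := Bool) (β := fun _ => Unit) h fun c => .lit (.inr ()) c

open Classical in
theorem slots_realizable : Realizable fun N _ (w : Empty ⊕ S.Ix → Fin N) =>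
    ∏ i : Fin k, ∏ a : Fin (b i) → Fin N, if ∀ j, (a j : ℕ) ≤ w (.inr (.inr 0)) then
      ∑ _ : Unit, ∑ v : Unit → Fin N,
        if S.Value i (fun i => w (.inr i)) (fun j => a j) (v ()) then 1 else 0 else 1 := by
  have h1 : ∀ i, NDef fun _ (v : (Empty ⊕ S.Ix) ⊕ Fin (b i) → ℕ) =>
      ∀ j, v (.inr j) ≤ v (.inl (.inr (.inr 0))) := fun i => .forall_finite fun j => .le _ _
  have h2 : ∀ i, NDef fun _ (v : ((Empty ⊕ S.Ix) ⊕ Fin (b i)) ⊕ Unit → ℕ) =>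
      S.Value i (fun i => v (.inl (.inl (.inr i)))) (fun j => v (.inl (.inr j))) (v (.inr ())) :=
    fun i => (S.value_def i).relabel (β := ((Empty ⊕ S.Ix) ⊕ Fin (b i)) ⊕ Unit)
      (Sum.map (Sum.map Sum.inr id) id)
  have h3 : ∀ i, Realizable fun N _ (u : (Empty ⊕ S.Ix) ⊕ Fin (b i) → Fin N) =>
      ∑ _ : Unit, ∑ v : Unit → Fin N, if S.Value i (fun i => u (.inl (.inr i)))
        (fun j => u (.inr j)) (v ()) then 1 else 0 := fun i =>
    Realizable.sum (Z := Unit) (β := fun _ => Unit) (fun _ => h2 i) fun _ => .one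
  refine (Realizable.prod (Z := Fin k) (β := fun i => Fin (b i)) h1 h3).congr fun N x w => ?_
  refine Finset.prod_congr rfl fun i _ => Finset.prod_congr rfl fun a _ => ?_
  exact if_congr Iff.rfl rfl rfl

theorem body_realizable (z : S.K → Bool) :
    Realizable fun N x (v : Empty ⊕ S.Ix → Fin N) => S.body N x z fun i => v (.inr i) :=
  (S.literals_realizable z).mul S.slots_realizable

open Classical in
theorem sum_body_realizable [Fintype (S.K → Bool)] [∀ N, Fintype (S.Ix → Fin N)] :
    Realizable fun N x (_ : Empty → Fin N) => ∑ z : S.K → Bool, ∑ w : S.Ix → Fin N,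
      if S.Guess N z (fun i => w i) then S.body N x z w else 0 :=
  Realizable.sum (Z := S.K → Bool) (β := fun _ => S.Ix)
    (R := fun z N v => S.Guess N z fun i => v (.inr i))
    (F := fun z N x v => S.body N x z fun i => v (.inr i))
    (fun z => (S.guess_def z).relabel Sum.inr) fun z => S.body_realizable z

end Flat

/-! ### Counting assignments by the values of the terms -/

namespace Flat

variable {σ : Vocabulary} {k : ℕ} {b : Fin k → ℕ} {l : ℕ} {φ : (countLang σ b).Formula (Fin l)}
  (S : Flat φ)

section count

variable {n : ℕ}

/-- The element `v` is a possible value of the function `i` for the tuple `a`, if the terms have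
the values `y`. -/
def Possible (y : S.τ → Fin n) (i : Fin k) (a : Fin (b i) → Fin n) (v : Fin n) : Prop :=
  ∀ t, ∀ args, S.node t = .app i args → (∀ j, y (args j) = a j) → v = y t

/-- Compatibility constrains each function value separately, so the choices are independent. -/
theorem card_compatible (y : S.τ → Fin n) :
    Nat.card {F : (i : Fin k) → (Fin (b i) → Fin n) → Fin n //
      ∀ i a, S.Possible y i a (F i a)} =
      ∏ i, ∏ a : Fin (b i) → Fin n, Nat.card {v // S.Possible y i a v} := by
  rw [Nat.card_congr (Equiv.subtypePiEquivPi (p := fun i (g : (Fin (b i) → Fin n) → Fin n) =>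
    ∀ a, S.Possible y i a (g a))), Nat.card_pi]
  refine Finset.prod_congr rfl fun i _ => ?_
  rw [Nat.card_congr (Equiv.subtypePiEquivPi (p := fun a v => S.Possible y i a v)), Nat.card_pi]

variable [NeZero n] (A : FinStr σ n)

/-- The values of the terms can be extended to a satisfying assignment. -/
def Consistent (y : S.τ → Fin n) : Prop :=
  (∀ t, NodeOK S.varNode S.constNode (fun t => (y t : ℕ)) t (S.node t)) ∧
    (∀ c, y (S.constNode c) = A.const c) ∧ S.G fun q => (S.atom q).Holds A y

/-- With `y` fixed, the recursive equations for the values of terms split into conditions on `y`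
alone and separate conditions on single function values. -/
theorem forall_eq_value_iff (F : (i : Fin k) → (Fin (b i) → Fin n) → Fin n) (y : S.τ → Fin n) :
    (∀ t, y t = (S.node t).value A F (fun j => y (S.varNode j)) y) ↔
      (∀ t, NodeOK S.varNode S.constNode (fun t => (y t : ℕ)) t (S.node t)) ∧
        (∀ c, y (S.constNode c) = A.const c) ∧ ∀ i a, S.Possible y i a (F i a) := by
  constructor
  · intro h
    have hc : ∀ c, y (S.constNode c) = A.const c := fun c => by
      have := h (S.constNode c)
      rwa [S.node_constNode] at this
    refine ⟨fun t => ?_, hc, fun i a t args ht ha => ?_⟩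
    · have ht := h t
      cases hn : S.node t with
      | var j =>
        rw [hn] at ht
        exact congrArg Fin.val ht
      | min =>
        rw [hn] at ht
        exact (congrArg Fin.val ht).trans (Fin.val_zero _)
      | const c =>
        rw [hn] at ht
        exact congrArg Fin.val (ht.trans (hc c).symm)
      | app i args => trivial
    · have := h t
      rw [ht] at this
      rw [this, ← funext ha]
      rfl
  · rintro ⟨h1, h2, h3⟩ t
    have ht := h1 t
    cases hn : S.node t with
    | var j =>
      rw [hn] at ht
      exact Fin.ext ht
    | min =>
      rw [hn] at ht
      exact Fin.ext (Eq.trans ht (Fin.val_zero _).symm)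
    | const c =>
      rw [hn] at ht
      exact (Fin.ext ht).trans (h2 c)
    | app i args => exact (h3 i _ t args hn fun _ => rfl).symm

-- The assignments are partitioned by the values `y` of all terms; the individual variables are read
-- off from `y`, and the functions are those compatible with `y`.
open Classical in
theorem countAssignments_eq [Fintype (S.τ → Fin n)] : countAssignments φ A =
    ∑ y : S.τ → Fin n, if S.Consistent A y then
      ∏ i, ∏ a : Fin (b i) → Fin n, Nat.card {v // S.Possible y i a v} else 0 := by
  have key : ∀ (F : (i : Fin k) → (Fin (b i) → Fin n) → Fin n) (y : S.τ → Fin n),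
      S.Consistent A y → (∀ i a, S.Possible y i a (F i a)) →
      ∀ t, y t = (S.node t).value A F (fun j => y (S.varNode j)) y := fun F y h h' =>
    (S.forall_eq_value_iff A F y).2 ⟨h.1, h.2.1, h'⟩
  have hreal : ∀ (F : (i : Fin k) → (Fin (b i) → Fin n) → Fin n) (y : S.τ → Fin n),
      S.Consistent A y → (∀ i a, S.Possible y i a (F i a)) →
      @Formula.Realize (countLang σ b) (Fin n) (A.toStructure F) (Fin l) φ
        fun j => y (S.varNode j) := by
    intro F y h h'
    obtain ⟨y', -, hy', hφ⟩ := S.exists_valuation n A F fun j => y (S.varNode j)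
    rw [hφ, ← hy' y (key F y h h')]
    exact h.2.2
  let T := Σ y : S.τ → Fin n, {F : (i : Fin k) → (Fin (b i) → Fin n) → Fin n //
    S.Consistent A y ∧ ∀ i a, S.Possible y i a (F i a)}
  let e : T → {p : ((i : Fin k) → (Fin (b i) → Fin n) → Fin n) × (Fin l → Fin n) //
      @Formula.Realize (countLang σ b) (Fin n) (A.toStructure p.1) (Fin l) φ p.2} :=
    fun p => ⟨(p.2.1, fun j => p.1 (S.varNode j)), hreal p.2.1 p.1 p.2.2.1 p.2.2.2⟩
  have he : Function.Bijective e := by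
    constructor
    · rintro ⟨y, F, h⟩ ⟨y', F', h'⟩ hyF
      have h1 : F = F' := congrArg (fun p => p.1.1) hyF
      have h2 : (fun j => y (S.varNode j)) = fun j => y' (S.varNode j) :=
        congrArg (fun p => p.1.2) hyF
      subst h1
      -- Uniqueness of the valuation shows that an assignment belongs to only one `y`, so nothing is
      -- counted twice.
      obtain ⟨y₀, -, hy₀, -⟩ := S.exists_valuation n A F fun j => y (S.varNode j)
      have h3 := hy₀ y (key F y h.1 h.2)
      have h4 := hy₀ y' (by rw [h2]; exact key F y' h'.1 h'.2)
      subst h3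
      subst h4
      rfl
    · rintro ⟨⟨F, c⟩, h⟩
      obtain ⟨y, hy, -, hφ⟩ := S.exists_valuation n A F c
      have hc : (fun j => y (S.varNode j)) = c := funext fun j => by
        have := hy (S.varNode j)
        rwa [S.node_varNode] at this
      subst hc
      have h' := (S.forall_eq_value_iff A F y).1 hy
      exact ⟨⟨y, F, ⟨h'.1, h'.2.1, hφ.1 h⟩, h'.2.2⟩, rfl⟩
  have := S.finite_τ
  rw [countAssignments, ← Nat.card_eq_of_bijective e he, Nat.card_sigma]
  refine Finset.sum_congr rfl fun y _ => ?_
  split_ifs with h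
  · rw [← S.card_compatible y]
    exact Nat.card_congr (Equiv.subtypeEquivRight fun F => and_iff_right h)
  · have : IsEmpty {F : (i : Fin k) → (Fin (b i) → Fin n) → Fin n //
        S.Consistent A y ∧ ∀ i a, S.Possible y i a (F i a)} := ⟨fun F => h F.2.1⟩
    exact Nat.card_of_isEmpty

end count

end Flat

theorem clog_two_lt {n : ℕ} (hn : n ≠ 0) : Nat.clog 2 n < n := by
  have h : n - 1 < 2 ^ (n - 1) := Nat.lt_two_pow_self
  have : Nat.clog 2 n ≤ n - 1 := Nat.clog_le_of_le_pow (by omega)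
  omega

/-! ### Correctness of the circuit on encodings and on other strings -/

namespace Flat

variable {σ : Vocabulary} {k : ℕ} {b : Fin k → ℕ} {l : ℕ} {φ : (countLang σ b).Formula (Fin l)}
  (S : Flat φ)

/-- The guess agrees with the input bits. -/
def Agrees {N : ℕ} (x : Fin N → Bool) (z : S.K → Bool) (w : S.Ix → ℕ) : Prop :=
  ∀ (c : Bool) (p : Fin N), S.Lit N z c w p → x p = c

open Classical in
theorem body_eq {N : ℕ} (x : Fin N → Bool) (z : S.K → Bool) (w : S.Ix → Fin N) :
    S.body N x z w = if S.Agrees x z (fun i => w i) then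
      ∏ i : Fin k, ∏ a : Fin (b i) → Fin N, if ∀ j, (a j : ℕ) ≤ w (.inr 0) then
        Nat.card {v : Fin N // S.Value i (fun i => w i) (fun j => a j) v} else 1 else 0 := by
  have h1 : ∀ (P : Fin N → Prop), (∑ _ : Unit, ∑ v : Unit → Fin N, if P (v ()) then 1 else 0) =
      Nat.card {v : Fin N // P v} := by
    intro P
    rw [Finset.univ_unique, Finset.sum_singleton, Nat.card_eq_fintype_card, Fintype.card_subtype,
      Finset.card_filter]
    exact Fintype.sum_equiv (Equiv.funUnique Unit (Fin N)) _ _ fun _ => rfl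
  have h2 : (∏ c : Bool, ∏ p : Unit → Fin N, if S.Lit N z c (fun i => w i) (p ()) then
      if x (p ()) = c then 1 else 0 else 1) = if S.Agrees x z (fun i => w i) then 1 else 0 := by
    have : ∀ c (p : Unit → Fin N), (if S.Lit N z c (fun i => w i) (p ()) then
        if x (p ()) = c then 1 else 0 else 1) =
        if S.Lit N z c (fun i => w i) (p ()) → x (p ()) = c then 1 else 0 := by
      intro c p
      split_ifs <;> tauto
    refine (Finset.prod_congr rfl fun c _ => Finset.prod_congr rfl fun p _ => this c p).trans ?_
    simp only [Finset.prod_boole, Finset.mem_univ, forall_true_left]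
    exact if_congr ⟨fun h c p => h c fun _ => p, fun h c p => h c (p ())⟩ rfl rfl
  unfold body
  rw [h2, ite_mul, one_mul, zero_mul]
  exact if_congr Iff.rfl (Finset.prod_congr rfl fun i _ => Finset.prod_congr rfl fun a _ =>
    if_congr Iff.rfl (h1 fun v => S.Value i (fun i => w i) (fun j => a j) v) rfl) rfl

section count

variable {n : ℕ} [NeZero n] (A : FinStr σ n)

/-- The guess for the values `y` of the terms. -/
def lift {N : ℕ} (hN : n ≤ N) (y : S.τ → Fin n) : S.Ix → Fin N
  | .inl t => Fin.castLE hN (y t)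
  | .inr 0 => ⟨n - 1, by have := NeZero.pos n; omega⟩
  | .inr 1 => ⟨Nat.clog 2 n, (clog_two_lt (NeZero.ne n)).trans_le hN⟩

theorem lift_add_one {N : ℕ} (hN : n ≤ N) (y : S.τ → Fin n) :
    (S.lift hN y (.inr 0) : ℕ) + 1 = n :=
  Nat.sub_add_cancel (NeZero.pos n)

theorem lift_injective {N : ℕ} (hN : n ≤ N) :
    Function.Injective (S.lift hN : (S.τ → Fin n) → S.Ix → Fin N) := fun _ _ h =>
  funext fun t => Fin.castLE_injective hN (congrFun h (.inl t))

theorem exists_lift {N : ℕ} (hN : n ≤ N) (hlen : N = encLen σ n) {z : S.K → Bool}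
    {w : S.Ix → Fin N} (h : S.Guess N z fun i => w i) : ∃ y, S.lift hN y = w := by
  obtain ⟨h1, h2, h3, -⟩ := h
  have hn : (w (.inr 0) : ℕ) + 1 = n := encLen_injective σ (h1.symm.trans hlen)
  rw [hn] at h2
  refine ⟨fun t => ⟨w (.inl t), (Nat.lt_succ_of_le (h3 t)).trans_eq hn⟩, funext fun i => Fin.ext ?_⟩
  match i with
  | .inl t => rfl
  | .inr 0 => exact (Nat.sub_eq_of_eq_add hn.symm)
  | .inr 1 => exact h2.symm

/-- Atoms with built-in relations are checked numerically, relations of the vocabulary and constants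
through the input bits. For each consistent `y` exactly one `z` passes. -/
theorem guess_and_agrees_iff {N : ℕ} (hN : n ≤ N) (hlen : N = encLen σ n) {x : Fin N → Bool}
    (hx : ∀ p : Fin N, A.enc[(p : ℕ)]? = some (x p)) (z : S.K → Bool) (y : S.τ → Fin n) :
    S.Guess N z (fun i => S.lift hN y i) ∧ S.Agrees x z (fun i => S.lift hN y i) ↔
      (∀ q, z q = true ↔ (S.atom q).Holds A y) ∧ S.Consistent A y := by
  have hget : ∀ {p : ℕ} {c : Bool}, A.enc[p]? = some c → ∃ hp : p < N, x ⟨p, hp⟩ = c := by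
    intro p c h
    have hp : p < N := by
      by_contra hp
      rw [List.getElem?_eq_none (by rw [A.length_enc]; omega)] at h
      cases h
    rw [hx ⟨p, hp⟩] at h
    exact ⟨hp, Option.some.inj h⟩
  have hclog : Nat.clog 2 n < N := (clog_two_lt (NeZero.ne n)).trans_le hN
  have hn : (S.lift hN y (.inr 0) : ℕ) + 1 = n := S.lift_add_one hN y
  have hl : (S.lift hN y (.inr 1) : ℕ) = Nat.clog 2 n := rfl
  constructor
  · rintro ⟨⟨-, -, -, h1, h2, h3⟩, h4⟩
    have hz : ∀ q, z q = true ↔ (S.atom q).Holds A y := by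
      intro q
      have hq := h3 q
      cases ha : S.atom q with
      | eq s t =>
        rw [ha] at hq
        exact hq.symm.trans (Fin.ext_iff (a := y s) (b := y t)).symm
      | le s t =>
        rw [ha] at hq
        exact hq.symm
      | bit s t =>
        rw [ha] at hq
        exact hq.symm
      | rel i args =>
        obtain ⟨hp, hp'⟩ := hget (A.enc_rel i fun j => y (args j))
        have := h4 (z q) ⟨_, hp⟩ (.inr (.inl ⟨q, rfl, i, args, ha, by rw [hn]; rfl⟩))
        rw [← this, hp']
        rfl
    refine ⟨hz, h1, fun d => Fin.ext (Nat.eq_of_testBit_eq fun j' => ?_), ?_⟩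
    · rcases lt_or_ge j' (Nat.clog 2 n) with hj | hj
      · have hj2 : Nat.clog 2 n - (j' + 1) < Nat.clog 2 n := by omega
        have hb := A.enc_const d hj2
        rw [show Nat.clog 2 n - (Nat.clog 2 n - (j' + 1) + 1) = j' by omega] at hb
        obtain ⟨hp, hp'⟩ := hget hb
        rw [← hp']
        refine (h4 ((y (S.constNode d) : ℕ).testBit j') ⟨_, hp⟩ (.inr (.inr ⟨d,
          Nat.clog 2 n - (j' + 1), by omega, j', by omega, ?_, Iff.rfl, ?_⟩))).symm
        · change _ = Nat.clog 2 n
          omega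
        · rw [hn]
          rfl
      -- Only `Nat.clog 2 n` bits of a constant are encoded; higher bits of elements below `n`
      -- vanish.
      · have h2n : n ≤ 2 ^ j' :=
          (Nat.le_pow_clog one_lt_two n).trans (Nat.pow_le_pow_right two_pos hj)
        rw [Nat.testBit_lt_two_pow ((y _).2.trans_le h2n),
          Nat.testBit_lt_two_pow ((A.const d).2.trans_le h2n)]
    · have : (fun q => z q = true) = fun q => (S.atom q).Holds A y := funext fun q => propext (hz q)
      rwa [this] at h2
  · rintro ⟨hz, h1, hc, hG⟩
    refine ⟨⟨by rw [hn]; exact hlen, by rw [hn]; exact hl, fun t => ?_, h1, ?_, fun q => ?_⟩, ?_⟩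
    · exact Nat.le_sub_one_of_lt (y t).2
    · have : (fun q => z q = true) = fun q => (S.atom q).Holds A y := funext fun q => propext (hz q)
      rwa [this]
    · have hq := hz q
      cases ha : S.atom q with
      | eq s t =>
        rw [ha] at hq
        exact (hq.trans (Fin.ext_iff (a := y s) (b := y t))).symm
      | le s t =>
        rw [ha] at hq
        exact hq.symm
      | bit s t =>
        rw [ha] at hq
        exact hq.symm
      | rel i args => trivial
    · rintro c p (⟨rfl, hp⟩ | ⟨q, rfl, i, args, ha, hp⟩ | ⟨d, j, -, j', -, hj, hb, hp⟩)
      · rw [hn] at hp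
        exact Option.some.inj ((hx p).symm.trans (A.enc_pad hp))
      · rw [hn] at hp
        have h := hx p
        rw [hp] at h
        have hv := Option.some.inj (h.symm.trans (A.enc_rel i fun j => y (args j)))
        rw [hv, Bool.eq_iff_iff, hz q, ha]
        rfl
      · rw [hn] at hp
        change _ = Nat.clog 2 n at hj
        have h := hx p
        rw [hp] at h
        have hv := Option.some.inj (h.symm.trans (A.enc_const d (by omega)))
        rw [show Nat.clog 2 n - (j + 1) = j' by omega, ← hc d] at hv
        rw [hv, Bool.eq_iff_iff]
        exact hb

/-- The circuit ranges over tuples from the universe of size `N`; a tuple with an entry outside the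
encoded structure contributes the factor 1. -/
theorem prod_card_value {N : ℕ} (hN : n ≤ N) (y : S.τ → Fin n) (i : Fin k)
    [∀ a : Fin (b i) → Fin N, Decidable (∀ j, (a j : ℕ) ≤ S.lift hN y (.inr 0))] :
    (∏ a : Fin (b i) → Fin N, if ∀ j, (a j : ℕ) ≤ S.lift hN y (.inr 0) then
      Nat.card {v : Fin N // S.Value i (fun i => S.lift hN y i) (fun j => a j) v} else 1) =
      ∏ a : Fin (b i) → Fin n, Nat.card {v // S.Possible y i a v} := by
  have hn := S.lift_add_one hN y
  refine (Fintype.prod_of_injective (fun (a : Fin (b i) → Fin n) j => Fin.castLE hN (a j)) ?_ _ _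
    (fun a ha => if_neg fun h => ha ?_) fun a => ?_).symm
  · exact fun a a' h => funext fun j => Fin.castLE_injective hN (congrFun h j)
  · exact ⟨fun j => ⟨a j, by have := h j; omega⟩, rfl⟩
  · have hv : ∀ v : ℕ, v ≤ S.lift hN y (.inr 0) ↔ v < n := fun v => by omega
    refine Eq.trans ?_ (if_pos fun j => (hv _).2 (a j).2).symm
    refine Nat.card_congr
      ⟨fun v => ⟨Fin.castLE hN v.1, (hv _).2 v.1.2, fun t args ht ha => ?_⟩,
        fun v => ⟨⟨v.1, (hv _).1 v.2.1⟩, fun t args ht ha => ?_⟩, fun v => rfl, fun v => rfl⟩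
    · exact congrArg (fun v : Fin n => (v : ℕ)) (v.2 t args ht fun j => Fin.ext (ha j))
    · exact Fin.ext (v.2.2 t args ht fun j => congrArg (fun v : Fin n => (v : ℕ)) (ha j))

-- For each `y` only the correct truth values `z` contribute, so the sum over guesses collapses to
-- `countAssignments_eq`.
open Classical in
theorem sum_body_of_enc [Fintype (S.K → Bool)] {N : ℕ} [Fintype (S.Ix → Fin N)] {x : Fin N → Bool}
    (hx : List.ofFn x = A.enc) : (∑ z : S.K → Bool, ∑ w : S.Ix → Fin N,
      if S.Guess N z (fun i => w i) then S.body N x z w else 0) = countAssignments φ A := by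
  have hlen : N = encLen σ n := by rw [← A.length_enc, ← hx, List.length_ofFn]
  have hN : n ≤ N := hlen ▸ le_encLen σ n
  have hx' : ∀ p : Fin N, A.enc[(p : ℕ)]? = some (x p) := fun p => by simp [← hx]
  have := S.finite_τ
  have := Fintype.ofFinite (S.τ → Fin n)
  rw [S.countAssignments_eq A, Finset.sum_comm]
  symm
  refine Fintype.sum_of_injective (S.lift hN) (S.lift_injective hN) _ _ (fun w hw => ?_) fun y => ?_
  · exact Finset.sum_eq_zero fun z _ => if_neg fun h => hw (S.exists_lift hN hlen h)
  · have h : ∀ z, (if S.Guess N z (fun i => S.lift hN y i) then S.body N x z (S.lift hN y) else 0) =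
        if (z = fun q => decide ((S.atom q).Holds A y)) then (if S.Consistent A y then
          ∏ i, ∏ a : Fin (b i) → Fin n, Nat.card {v // S.Possible y i a v} else 0) else 0 := by
      intro z
      simp only [body_eq, prod_card_value, ← ite_and]
      refine if_congr ((S.guess_and_agrees_iff A hN hlen hx' z y).trans
        (and_congr_left fun _ => ?_)) rfl rfl
      rw [funext_iff]
      exact forall_congr' fun q =>
        (Bool.eq_iff_iff.trans (iff_congr Iff.rfl decide_eq_true_iff)).symm
    simp only [h, Finset.sum_ite_eq', Finset.mem_univ, if_true]

end count

/-- The structure is read off: the relations from the input bits, the constants from the guess. The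
length, the padding and the bits of the constants are right because the guess was checked. So the
circuit counts 0 on a string that is no encoding. -/
theorem exists_enc_of_agrees {N : ℕ} {x : Fin N → Bool} {z : S.K → Bool} {w : S.Ix → Fin N}
    (h : S.Guess N z fun i => w i) (h' : S.Agrees x z fun i => w i) :
    ∃ (n : ℕ) (_ : NeZero n) (A : FinStr σ n), List.ofFn x = A.enc := by
  obtain ⟨h1, h2, h3, -⟩ := h
  obtain ⟨n, hn⟩ : ∃ n, n = (w (.inr 0) : ℕ) + 1 := ⟨_, rfl⟩
  have : NeZero n := ⟨by omega⟩
  dsimp only at h1 h2 h3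
  rw [← hn] at h1 h2
  -- An arbitrary structure of the right size; it serves only to show that the positions lie below
  -- `N`.
  let A₀ : FinStr σ n := ⟨fun _ _ => false, fun _ => 0⟩
  have hpos : ∀ {p : ℕ} {c : Bool}, A₀.enc[p]? = some c → p < N := by
    intro p c h
    by_contra hp
    rw [List.getElem?_eq_none (by rw [A₀.length_enc]; omega)] at h
    cases h
  have hget : ∀ {p : ℕ} (hp : p < N), (List.ofFn x)[p]? = some (x ⟨p, hp⟩) := fun hp => by simp [hp]
  have hclog : Nat.clog 2 n < N := (clog_two_lt (NeZero.ne n)).trans_le (h1 ▸ le_encLen σ n)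
  refine ⟨n, this, ⟨fun i a => x ⟨_, hpos (A₀.enc_rel i a)⟩,
    fun c => ⟨w (.inl (S.constNode c)), (Nat.lt_succ_of_le (h3 _)).trans_eq hn.symm⟩⟩,
    FinStr.eq_enc _ (by rw [List.length_ofFn, ← h1]) (fun j hj => ?_) (fun i a => hget _)
    fun c j hj => ?_⟩
  · rw [hget (hpos (A₀.enc_pad hj)), h' false ⟨j, _⟩ (.inl ⟨rfl, by rwa [← hn]⟩)]
  · rw [hget (hpos (A₀.enc_const c hj))]
    refine congrArg some (h' _ _ (.inr (.inr ⟨c, j, by omega, Nat.clog 2 n - (j + 1), by omega, ?_,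
      Iff.rfl, ?_⟩)))
    · change _ = (w (.inr 1) : ℕ)
      omega
    · change constPos σ n c j = padLen σ (w (.inr 0) + 1) + relLen σ (w (.inr 0) + 1) +
        (c * w (.inr 1) + j)
      rw [← hn, h2, constPos]

end Flat

theorem sharpSigma0_subset : SharpSigma0 ⊆ FOUniformSharpAC0 := by
  classical
  rintro f ⟨σ, k, b, l, φ, hφ, hf, hf'⟩
  obtain ⟨S⟩ := nonempty_flat hφ
  have := Fintype.ofFinite (S.K → Bool)
  have := fun N => Fintype.ofFinite (S.Ix → Fin N)
  refine mem_FOUniformSharpAC0 S.sum_body_realizable (fun w _ => ?_) fun w hw => ?_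
  · by_cases h : ∃ (n : ℕ) (_ : NeZero n) (A : FinStr σ n), w.1 = A.enc
    · obtain ⟨n, _, A, hA⟩ := h
      rw [hf n A w hA]
      exact (S.sum_body_of_enc A (by rw [List.ofFn_get, hA])).symm
    · push Not at h
      rw [hf' w h]
      refine (Finset.sum_eq_zero fun z _ => Finset.sum_eq_zero fun u _ => ?_).symm
      split_ifs with hg
      · rw [S.body_eq, if_neg]
        intro ha
        obtain ⟨n, hn, A, hA⟩ := S.exists_enc_of_agrees hg ha
        exact h n hn A (by rw [← hA, List.ofFn_get])
      · rfl
  -- A structure whose encoding has length 1 has one element, so there is at most one assignment.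
  · by_cases h : ∃ (n : ℕ) (_ : NeZero n) (A : FinStr σ n), w.1 = A.enc
    · obtain ⟨n, hn, A, hA⟩ := h
      have h1 : n ≤ 1 := (le_encLen σ n).trans_eq (by rw [← A.length_enc, ← hA, hw])
      obtain rfl : n = 1 := le_antisymm h1 (NeZero.pos n)
      rw [hf 1 A w hA]
      exact (countAssignments_le φ A).trans_eq (one_pow _)
    · push Not at h
      rw [hf' w h]
      exact zero_le_one

end CountAC

/-- `#Σ₀` is properly contained in FO-uniform `#AC⁰`, and `w ↦ |w| ^ ⌈|w| / 2⌉` separates them. -/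
theorem mainTheorem4 :
    CountAC.SharpSigma0 ⊂ CountAC.FOUniformSharpAC0 ∧
    (fun w : CountAC.Word => w.1.length ^ ⌈(w.1.length : ℚ) / 2⌉₊) ∈
      CountAC.FOUniformSharpAC0 \ CountAC.SharpSigma0 := by
  refine ⟨⟨CountAC.sharpSigma0_subset, fun h => CountAC.pow_half_not_mem (h CountAC.pow_half_mem)⟩,
    CountAC.pow_half_mem, CountAC.pow_half_not_mem⟩
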